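/- **Setting.** Nets are indexed by $\varepsilon\in(0,1]$. A net $(r_\varepsilon)_\varepsilon$ of numbers is *moderate* if $|r_\varepsilon|=O(\varepsilon^{-N})$ as $\varepsilon\to0$ for some $N\in\mathbb N$, and *negligible* if $|r_\varepsilon|=O(\varepsilon^{q})$ for all $q\in\mathbb N$. The rings $\widetilde{\mathbb C}$, $\widetilde{\mathbb R}$ of generalized numbers are the moderate nets in $\mathbb C$, $\mathbb R$ modulo the negligible ones; $\widetilde{\mathbb C}$ carries the topology of $|z|_{\rm e}=e^{-\mathrm{v}(z)}$, $\mathrm{v}([(z_\varepsilon)_\varepsilon])=\sup\{b\in\mathbb R: |z_\varepsilon|=O(\varepsilon^b)\}$. For compact $K\subset\mathbb R^n$ and $j\in\mathbb N$ let $p_{K,j}(f)=\sup_{x\in K,|\alpha|\le j}|\partial^\alpha f(x)|$. The $\widetilde{\mathbb C}$-module $\mathcal G_c(\mathbb R^n)$ consists of the nets $(u_\varepsilon)_\varepsilon$ in $C_c^\infty(\mathbb R^n)$ with supports in a common compact set and with $(p_{K,j}(u_\varepsilon))_\varepsilon$ moderate for all $K,j$, modulo those for which $(p_{K,j}(u_\varepsilon))_\varepsilon$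 is negligible for all $K,j$. The support of $u\in\mathcal G_c(\mathbb R^n)$ is the complement of the largest open set on whose compact subsets all derivatives of $u$ are negligible; $\mathcal G_K$ is the set of $u\in\mathcal G_c(\mathbb R^n)$ with support in $K$, with the topology of the ultra-pseudo-seminorms $e^{-\mathrm v_{K',j}(u)}$, $\mathrm v_{K',j}(u)=\sup\{b: p_{K',j}(u_\varepsilon)=O(\varepsilon^b)\}$, $K'$ compact with $K$ in its interior; and $\mathcal G_c(\mathbb R^n)$ carries the inductive limit topology, that is, the finest locally convex $\widetilde{\mathbb C}$-linear topology for which all inclusions $\mathcal G_K\to\mathcal G_c(\mathbb R^n)$ are continuous. Here a $\widetilde{\mathbb C}$-linear topology is locally convex if $0$ has a base of neighbourhoods $A$ with $A+A\subseteq A$ and $[(\varepsilon^b)_\varepsilon]A\subseteq A$ for all $b\ge0$. $\mathcal L(\mathcal G_c(\mathbb R^n),\widetilde{\mathbb C})$ is the space of continuous $\widetilde{\mathbb C}$-linear functionals. A functional $T\in\mathcal L(\mathcal G_c(\mathbb R^n),\widetilde{\mathbb C})$ is *given by* a net $(T_\varepsilon)_\varepsilon$ of distributions on $\mathbb R^n$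 if for each compact $K$ there are $j,N\in\mathbb N$, $c>0$, $\eta\in(0,1]$ with $|T_\varepsilon(f)|\le c\,\varepsilon^{-N}p_{K,j}(f)$ for all $f\in C^\infty_c(\mathbb R^n)$ supported in $K$ and all $\varepsilon\in(0,\eta]$, and $T(u)=[(T_\varepsilon(u_\varepsilon))_\varepsilon]$ for all $u=[(u_\varepsilon)_\varepsilon]$; it is *basic* if it is given by some such net. Let $\iota_d(\delta)(u)=[(u_\varepsilon(0))_\varepsilon]$. Let $P(D)=\sum_{|\alpha|\le m}a_\alpha D^\alpha$, $D=-i\partial$, with $a_\alpha\in\widetilde{\mathbb C}$. It acts by $(P(D)T)(u)=T(\sum_\alpha(-1)^{|\alpha|}a_\alpha D^\alpha u)$, and $E$ is a *fundamental solution* if $P(D)E=\iota_d(\delta)$. A *representative* of $P$ is a net of polynomials $P_\varepsilon(\xi)=\sum_{|\alpha|\le m}a_{\alpha,\varepsilon}\xi^\alpha$, where $(a_{\alpha,\varepsilon})_\varepsilon$ is a representative of $a_\alpha$. Put $\widetilde P(\xi)=\bigl(\sum_{|\alpha|\le m}|\partial^\alpha P(\xi)|^2\bigr)^{1/2}\in\widetilde{\mathbb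 R}$ for $\xi\in\mathbb R^n$, and likewise $\widetilde{P_\varepsilon}(\xi)\in\mathbb R$. For $k:\mathbb R^n\to[0,\infty)$ continuous, $B_{\infty,k}(\mathbb R^n)$ is the set of tempered distributions $w$ whose Fourier transform $\widehat w$ (with kernel $e^{-ix\xi}$) is a locally integrable function with $\|w\|_{\infty,k}=(2\pi)^{-n}\|k\widehat w\|_{L^\infty}<\infty$. **Theorem.** Let $n,m\in\mathbb N$. (1) For every $P(D)=\sum_{|\alpha|\le m}a_\alpha D^\alpha$ with coefficients in $\widetilde{\mathbb C}$ such that $\widetilde P(\xi_0)$ is invertible in $\widetilde{\mathbb R}$ for some $\xi_0\in\mathbb R^n$, there is a fundamental solution $E\in\mathcal L(\mathcal G_c(\mathbb R^n),\widetilde{\mathbb C})$ of $P(D)$ which is basic. (2) For every $c>0$ there is a constant $C_0$, depending only on $n$, $m$ and $c$, such that for every $P(D)$ as in (1) and every representative $(P_\varepsilon)_\varepsilon$ of $P$ there is a fundamental solution $E\in\mathcal L(\mathcal G_c(\mathbb R^n),\widetilde{\mathbb C})$ of $P(D)$ given by a net of distributions $(E_\varepsilon)_\varepsilon$ such that, for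 all $\varepsilon\in(0,1]$, $E_\varepsilon/\cosh(c|x|)\in B_{\infty,\widetilde{P_\varepsilon}}(\mathbb R^n)$ and $$\Bigl\|\frac{E_\varepsilon}{\cosh(c|x|)}\Bigr\|_{\infty,\widetilde{P_\varepsilon}}\le C_0 .$$ -/

import Mathlib

open Filter Topology Asymptotics MeasureTheory TopologicalSpace
open scoped ContDiff ENNReal SchwartzMap FourierTransform

noncomputable section

namespace Colombeau

/-! ### Nets indexed by `(0,1]` and generalized numbers -/

/-- The index set `(0,1]`. -/
abbrev Idx : Type := Set.Ioc (0 : ℝ) 1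

/-- The filter `ε → 0` on `(0,1]`. -/
def near0 : Filter Idx := comap Subtype.val (𝓝 (0 : ℝ))

/-- `r_ε = O(ε^b)` as `ε → 0`. -/
def OPow (r : Idx → ℝ) (b : ℝ) : Prop := r =O[near0] fun ε => (ε : ℝ) ^ b

theorem OPow.add {r s : Idx → ℝ} {b : ℝ} (hr : OPow r b) (hs : OPow s b) :
    OPow (fun ε => r ε + s ε) b :=
  IsBigO.add hr hs

theorem OPow.mul {r s : Idx → ℝ} {a b : ℝ} (hr : OPow r a) (hs : OPow s b) :
    OPow (fun ε => r ε * s ε) (a + b) := by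
  refine (IsBigO.mul hr hs).congr_right fun ε => ?_
  rw [Real.rpow_add ε.2.1]

theorem OPow.anti {r : Idx → ℝ} {a b : ℝ} (hr : OPow r a) (h : b ≤ a) : OPow r b := by
  refine IsBigO.trans hr (IsBigO.of_bound 1 (Eventually.of_forall fun ε => ?_))
  have h0 := ε.2.1
  rw [Real.norm_of_nonneg (Real.rpow_nonneg h0.le _),
    Real.norm_of_nonneg (Real.rpow_nonneg h0.le _), one_mul]
  exact Real.rpow_le_rpow_of_exponent_ge h0 ε.2.2 h

theorem OPow.mono {r s : Idx → ℝ} {b : ℝ} (hs : OPow s b)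
    (h : ∀ᶠ ε in near0, |r ε| ≤ |s ε|) : OPow r b :=
  IsBigO.trans (IsBigO.of_bound 1 (by simpa using h)) hs

theorem OPow.const_mul {r : Idx → ℝ} {b : ℝ} (c : ℝ) (h : OPow r b) :
    OPow (fun ε => c * r ε) b := IsBigO.const_mul_left h c

theorem OPow.zero (b : ℝ) : OPow (fun _ => 0) b := isBigO_zero _ _

theorem OPow.const (c : ℝ) : OPow (fun _ => c) 0 := by
  simpa [OPow] using isBigO_const_const c (one_ne_zero (α := ℝ)) near0

/-- The growth condition of moderate nets: `r_ε = O(ε^{-N})` for some `N`. -/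
def Moderate (r : Idx → ℝ) : Prop := ∃ N : ℕ, OPow r (-(N : ℝ))

/-- The decay condition of negligible nets: `r_ε = O(ε^q)` for all `q`. -/
def Negligible (r : Idx → ℝ) : Prop := ∀ q : ℕ, OPow r (q : ℝ)

theorem Moderate.add {r s : Idx → ℝ} (hr : Moderate r) (hs : Moderate s) :
    Moderate (fun ε => r ε + s ε) := by
  obtain ⟨N, hN⟩ := hr
  obtain ⟨M, hM⟩ := hs
  refine ⟨N + M, OPow.add (hN.anti ?_) (hM.anti ?_)⟩ <;> push_cast <;>
    linarith [N.cast_nonneg (α := ℝ), M.cast_nonneg (α := ℝ)]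

theorem Moderate.mul {r s : Idx → ℝ} (hr : Moderate r) (hs : Moderate s) :
    Moderate (fun ε => r ε * s ε) := by
  obtain ⟨N, hN⟩ := hr
  obtain ⟨M, hM⟩ := hs
  refine ⟨N + M, (hN.mul hM).anti ?_⟩
  push_cast
  linarith

theorem Moderate.mono {r s : Idx → ℝ} (hs : Moderate s)
    (h : ∀ᶠ ε in near0, |r ε| ≤ |s ε|) : Moderate r :=
  hs.imp fun _ hN => hN.mono h

theorem Moderate.const (c : ℝ) : Moderate (fun _ => c) := ⟨0, by simpa using OPow.const c⟩

theorem Negligible.add {r s : Idx → ℝ} (hr : Negligible r) (hs : Negligible s) :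
    Negligible (fun ε => r ε + s ε) := fun q => (hr q).add (hs q)

theorem Negligible.mono {r s : Idx → ℝ} (hs : Negligible s)
    (h : ∀ᶠ ε in near0, |r ε| ≤ |s ε|) : Negligible r := fun q => (hs q).mono h

theorem Negligible.zero : Negligible (fun _ => 0) := fun q => OPow.zero q

theorem Moderate.mul_negligible {r s : Idx → ℝ} (hr : Moderate r) (hs : Negligible s) :
    Negligible (fun ε => r ε * s ε) := by
  obtain ⟨N, hN⟩ := hr
  intro q
  refine (hN.mul (hs (N + q))).anti ?_
  push_cast
  linarith

/-- The ring `𝓔_M` of moderate nets of numbers. -/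
def ModNet (𝕜 : Type) [NormedField 𝕜] : Subring (Idx → 𝕜) where
  carrier := {r | Moderate fun ε => ‖r ε‖}
  mul_mem' {a b} ha hb := by
    have := Moderate.mul (r := fun ε => ‖a ε‖) (s := fun ε => ‖b ε‖) ha hb
    simpa using this
  one_mem' := by simpa using Moderate.const 1
  add_mem' {a b} ha hb :=
    (Moderate.add (r := fun ε => ‖a ε‖) (s := fun ε => ‖b ε‖) ha hb).mono
      (Eventually.of_forall fun ε => by
        rw [abs_of_nonneg (norm_nonneg _), abs_of_nonneg (by positivity)]
        exact norm_add_le _ _)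
  zero_mem' := by simpa using Moderate.const 0
  neg_mem' {a} ha := by simpa using ha

/-- The ideal `𝓝` of negligible nets of numbers. -/
def NegNet (𝕜 : Type) [NormedField 𝕜] : Ideal (ModNet 𝕜) where
  carrier := {r | Negligible fun ε => ‖(r : Idx → 𝕜) ε‖}
  add_mem' {a b} ha hb :=
    (Negligible.add ha hb).mono
      (Eventually.of_forall fun ε => by
        rw [abs_of_nonneg (norm_nonneg _), abs_of_nonneg (by positivity)]
        exact norm_add_le _ _)
  zero_mem' := by simpa using Negligible.zero
  smul_mem' a b hb := by
    have := Moderate.mul_negligible a.2 hb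
    simpa using this

/-- The ring of generalized numbers over `𝕜`, moderate nets modulo negligible nets;
`GenNum ℂ` is `ℂ~` and `GenNum ℝ` is `ℝ~`. -/
def GenNum (𝕜 : Type) [NormedField 𝕜] : Type := ModNet 𝕜 ⧸ NegNet 𝕜

instance (𝕜 : Type) [NormedField 𝕜] : CommRing (GenNum 𝕜) :=
  inferInstanceAs (CommRing (ModNet 𝕜 ⧸ NegNet 𝕜))

namespace GenNum

variable {𝕜 : Type} [NormedField 𝕜]

/-- The class of a moderate net. -/
def mk : ModNet 𝕜 →+* GenNum 𝕜 := Ideal.Quotient.mk (NegNet 𝕜)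

theorem mk_surjective : Function.Surjective (mk : ModNet 𝕜 → GenNum 𝕜) :=
  Ideal.Quotient.mk_surjective

theorem mk_eq_mk {r s : ModNet 𝕜} :
    mk r = mk s ↔ Negligible fun ε => ‖(r : Idx → 𝕜) ε - (s : Idx → 𝕜) ε‖ :=
  Ideal.Quotient.mk_eq_mk_iff_sub_mem _ _

/-- The net `r` is moderate and its class is `z`. -/
def IsRep (r : Idx → 𝕜) (z : GenNum 𝕜) : Prop := ∃ h : r ∈ ModNet 𝕜, mk ⟨r, h⟩ = z

/-- The embedding of the numbers as constant nets. -/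
def const : 𝕜 →+* GenNum 𝕜 :=
  mk.comp ((Pi.constRingHom Idx 𝕜).codRestrict (ModNet 𝕜) fun c => Moderate.const ‖c‖)

/-- The absolute value `|[(z_ε)]| = [(|z_ε|)]`. -/
def abs : GenNum 𝕜 → GenNum ℝ :=
  Quotient.lift
    (fun r : ModNet 𝕜 => mk (𝕜 := ℝ) ⟨fun ε => ‖(r : Idx → 𝕜) ε‖, by
      have h : Moderate fun ε => ‖(r : Idx → 𝕜) ε‖ := r.2
      change Moderate fun ε => ‖‖(r : Idx → 𝕜) ε‖‖
      simpa only [norm_norm] using h⟩)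
    (by
      intro r s h
      have h' : mk r = mk s := Quotient.sound h
      rw [mk_eq_mk] at h' ⊢
      refine h'.mono (Eventually.of_forall fun ε => ?_)
      simp only [abs_norm]
      exact abs_norm_sub_norm_le _ _)

/-- The square root `√[(r_ε)] = [(√r_ε)]`, meant for `r ≥ 0`. -/
def sqrt : GenNum ℝ → GenNum ℝ :=
  Quotient.lift
    (fun r : ModNet ℝ => mk (𝕜 := ℝ) ⟨fun ε => √((r : Idx → ℝ) ε), by
      have h : Moderate fun ε => ‖(r : Idx → ℝ) ε‖ := r.2
      refine ((Moderate.const 1).add h).mono (Eventually.of_forall fun ε => ?_)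
      rw [abs_of_nonneg (norm_nonneg _), Real.norm_of_nonneg (Real.sqrt_nonneg _),
        abs_of_nonneg (by positivity), Real.norm_eq_abs]
      refine Real.sqrt_le_iff.2 ⟨by positivity, ?_⟩
      nlinarith [le_abs_self ((r : Idx → ℝ) ε), abs_nonneg ((r : Idx → ℝ) ε)]⟩)
    (by
      intro r s h
      have h' : mk r = mk s := Quotient.sound h
      rw [mk_eq_mk] at h' ⊢
      intro q
      obtain ⟨c, hc⟩ := (h' (2 * q)).bound
      refine IsBigO.of_bound (√c) ?_
      filter_upwards [hc] with ε hε
      have h0 := ε.2.1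
      have key : ∀ a b : ℝ, |√a - √b| ≤ √|a - b| := by
        have aux : ∀ a b : ℝ, √a - √b ≤ √|a - b| := by
          intro a b
          have h1 : a ≤ b + |a - b| := by linarith [le_abs_self (a - b)]
          have h2 : √a ≤ √b + √|a - b| := by
            refine Real.sqrt_le_iff.2 ⟨by positivity, ?_⟩
            have hb : b ≤ √b ^ 2 := by
              rcases le_total 0 b with hb | hb
              · rw [Real.sq_sqrt hb]
              · exact hb.trans (sq_nonneg _)
            nlinarith [Real.sq_sqrt (abs_nonneg (a - b)), Real.sqrt_nonneg b,
              Real.sqrt_nonneg |a - b|, mul_nonneg (Real.sqrt_nonneg b)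
              (Real.sqrt_nonneg |a - b|)]
          linarith
        intro a b
        rw [abs_le]
        refine ⟨?_, aux a b⟩
        have := aux b a
        rw [abs_sub_comm] at this
        linarith
      rw [norm_norm] at hε ⊢
      rw [Real.norm_eq_abs] at hε ⊢
      refine (key _ _).trans ?_
      have e : ‖(ε : ℝ) ^ (q : ℝ)‖ = √‖(ε : ℝ) ^ ((2 * q : ℕ) : ℝ)‖ := by
        rw [Real.norm_of_nonneg (Real.rpow_nonneg h0.le _),
          Real.norm_of_nonneg (Real.rpow_nonneg h0.le _), Real.rpow_natCast, Real.rpow_natCast,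
          mul_comm, pow_mul, Real.sqrt_sq (by positivity)]
      rw [e, ← Real.sqrt_mul' _ (norm_nonneg _)]
      exact Real.sqrt_le_sqrt hε)

/-- The valuation `sup {b : |z_ε| = O(ε^b)}` of a generalized number. -/
def val (z : GenNum 𝕜) : EReal :=
  sSup {b | ∃ (a : ℝ) (r : ModNet 𝕜), mk r = z ∧ OPow (fun ε => ‖(r : Idx → 𝕜) ε‖) a ∧ b = a}

/-- The ultra-pseudo-norm `|z|_e = exp (-val z)`. -/
def ultraNorm (z : GenNum 𝕜) : ℝ≥0∞ := EReal.exp (-val z)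

/-- The topology given by the ultra-pseudo-norm. -/
instance : TopologicalSpace (GenNum 𝕜) :=
  generateFrom {S | ∃ (z : GenNum 𝕜) (r : ℝ≥0∞), 0 < r ∧ S = {w | ultraNorm (w - z) < r}}

/-- The class of the net `(ε^b)_ε`. -/
def epsPow (b : ℝ) : GenNum ℂ :=
  mk ⟨fun ε => (((ε : ℝ) ^ b : ℝ) : ℂ), by
    refine ⟨⌈-b⌉₊, ?_⟩
    have : OPow (fun ε : Idx => ‖(((ε : ℝ) ^ b : ℝ) : ℂ)‖) b := by
      simp only [Complex.norm_real]
      exact (isBigO_refl _ _).norm_left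
    exact this.anti (by linarith [Nat.le_ceil (-b)])⟩

end GenNum

/-! ### Test functions, distributions and the seminorms `p_{K,j}` -/

/-- Euclidean space `ℝⁿ`. -/
abbrev Sp (n : ℕ) : Type := EuclideanSpace ℝ (Fin n)

/-- The space `C^∞_c(ℝⁿ)` of complex-valued test functions with its usual topology. -/
abbrev Test (n : ℕ) : Type := TestFunction (⊤ : Opens (Sp n)) ℂ ⊤

/-- The space `𝓓'(ℝⁿ)` of distributions. -/
abbrev Distr (n : ℕ) : Type := Test n →L[ℂ] ℂ

variable {n : ℕ}

/-- The partial derivative `∂_i` on test functions. -/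
def partialD (i : Fin n) : Module.End ℂ (Test n) :=
  (TestFunction.lineDerivCLM ℂ (EuclideanSpace.single i (1 : ℝ)) : Test n →L[ℂ] Test n)

theorem partialD_apply (i : Fin n) (f : Test n) (x : Sp n) :
    partialD i f x = lineDeriv ℝ f x (EuclideanSpace.single i (1 : ℝ)) :=
  TestFunction.lineDerivCLM_apply_of_le (by simp)

/-- The partial derivative `∂_{i₁} ⋯ ∂_{i_k}` for a word `i₁ … i_k`. As partial derivatives of test
functions commute, the operators `wordD w` with `w` of length at most `j` are exactly the
`∂^α` with `|α| ≤ j`. -/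
def wordD (w : List (Fin n)) : Module.End ℂ (Test n) := (w.map partialD).prod

/-- `p_{K,j}(f) = sup {|∂^α f(x)| : x ∈ K, |α| ≤ j}`. -/
def semi (K : Set (Sp n)) (j : ℕ) (f : Test n) : ℝ :=
  sSup {r | ∃ w : List (Fin n), w.length ≤ j ∧ ∃ x ∈ K, r = ‖wordD w f x‖}

theorem semi_bdd (K : Set (Sp n)) (j : ℕ) (f : Test n) :
    BddAbove {r | ∃ w : List (Fin n), w.length ≤ j ∧ ∃ x ∈ K, r = ‖wordD w f x‖} := by
  have h : BddAbove (⋃ w ∈ {w : List (Fin n) | w.length ≤ j},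
      Set.range fun x => ‖wordD w f x‖) := by
    refine (List.finite_length_le (Fin n) j).bddAbove_biUnion.2 fun w _ => ?_
    obtain ⟨C, hC⟩ := (wordD w f).continuous.bounded_above_of_compact_support
      (wordD w f).hasCompactSupport
    exact ⟨C, by rintro _ ⟨x, rfl⟩; exact hC x⟩
  refine h.mono ?_
  rintro _ ⟨w, hw, x, -, rfl⟩
  exact Set.mem_biUnion hw ⟨x, rfl⟩

theorem le_semi {K : Set (Sp n)} {j : ℕ} (f : Test n) {w : List (Fin n)} (hw : w.length ≤ j)
    {x : Sp n} (hx : x ∈ K) : ‖wordD w f x‖ ≤ semi K j f :=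
  le_csSup (semi_bdd K j f) ⟨w, hw, x, hx, rfl⟩

theorem semi_nonneg (K : Set (Sp n)) (j : ℕ) (f : Test n) : 0 ≤ semi K j f :=
  Real.sSup_nonneg (by rintro _ ⟨w, -, x, -, rfl⟩; exact norm_nonneg _)

theorem semi_le {K : Set (Sp n)} {j : ℕ} {f : Test n} {C : ℝ} (hC : 0 ≤ C)
    (h : ∀ w : List (Fin n), w.length ≤ j → ∀ x ∈ K, ‖wordD w f x‖ ≤ C) : semi K j f ≤ C :=
  Real.sSup_le (by rintro _ ⟨w, hw, x, hx, rfl⟩; exact h w hw x hx) hC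

theorem semi_add_le (K : Set (Sp n)) (j : ℕ) (f g : Test n) :
    semi K j (f + g) ≤ semi K j f + semi K j g :=
  semi_le (add_nonneg (semi_nonneg _ _ _) (semi_nonneg _ _ _)) fun w hw x hx => by
    rw [map_add]
    exact (norm_add_le _ _).trans (add_le_add (le_semi f hw hx) (le_semi g hw hx))

theorem semi_smul_le (K : Set (Sp n)) (j : ℕ) (a : ℂ) (f : Test n) :
    semi K j (a • f) ≤ ‖a‖ * semi K j f :=
  semi_le (mul_nonneg (norm_nonneg _) (semi_nonneg _ _ _)) fun w hw x hx => by
    rw [map_smul]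
    change ‖a • (wordD w f x)‖ ≤ _
    rw [norm_smul]
    exact mul_le_mul_of_nonneg_left (le_semi f hw hx) (norm_nonneg _)

theorem semi_partialD_le (K : Set (Sp n)) (j : ℕ) (i : Fin n) (f : Test n) :
    semi K j (partialD i f) ≤ semi K (j + 1) f :=
  semi_le (semi_nonneg _ _ _) fun w hw x hx => by
    have : wordD w (partialD i f) = wordD (w ++ [i]) f := by
      simp [wordD, Module.End.mul_apply]
    rw [this]
    exact le_semi f (by simpa using hw) hx

theorem tsupport_partialD (i : Fin n) (f : Test n) :
    tsupport (partialD i f) ⊆ tsupport f := by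
  refine closure_minimal (fun x hx => ?_) (isClosed_tsupport _)
  by_contra h
  refine hx ?_
  rw [partialD_apply]
  have h0 : (f : Sp n → ℂ) =ᶠ[𝓝 x] fun _ => 0 := notMem_tsupport_iff_eventuallyEq.1 h
  rw [h0.lineDeriv_eq]
  simp [lineDeriv]

/-! ### The Colombeau algebra `𝓖_c(ℝⁿ)` -/

/-- Moderate nets of smooth functions whose supports lie in a common compact set. -/
def EcM (n : ℕ) : Submodule (ModNet ℂ) (Idx → Test n) where
  carrier := {f | (∃ K : Set (Sp n), IsCompact K ∧ ∀ ε, tsupport (f ε) ⊆ K) ∧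
    ∀ K : Set (Sp n), IsCompact K → ∀ j, Moderate fun ε => semi K j (f ε)}
  add_mem' := by
    rintro f g ⟨⟨K, hK, hf⟩, hf'⟩ ⟨⟨L, hL, hg⟩, hg'⟩
    refine ⟨⟨K ∪ L, hK.union hL, fun ε => ?_⟩, fun M hM j => ?_⟩
    · exact (tsupport_add (f ε) (g ε)).trans (Set.union_subset_union (hf ε) (hg ε))
    · refine ((hf' M hM j).add (hg' M hM j)).mono (Eventually.of_forall fun ε => ?_)
      rw [abs_of_nonneg (semi_nonneg _ _ _),
        abs_of_nonneg (add_nonneg (semi_nonneg _ _ _) (semi_nonneg _ _ _))]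
      exact semi_add_le _ _ _ _
  zero_mem' := by
    refine ⟨⟨∅, isCompact_empty, fun ε => ?_⟩, fun M hM j => ?_⟩
    · change tsupport (fun _ : Sp n => (0 : ℂ)) ⊆ ∅
      simp
    · refine (Moderate.const 0).mono (Eventually.of_forall fun ε => ?_)
      rw [abs_of_nonneg (semi_nonneg _ _ _), abs_zero]
      refine semi_le le_rfl fun w _ x _ => ?_
      rw [Pi.zero_apply, map_zero]
      simp
  smul_mem' := by
    rintro r f ⟨⟨K, hK, hf⟩, hf'⟩
    refine ⟨⟨K, hK, fun ε => ?_⟩, fun M hM j => ?_⟩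
    · exact (tsupport_smul_subset_right (fun _ : Sp n => (r : Idx → ℂ) ε) (f ε)).trans (hf ε)
    · refine (Moderate.mul r.2 (hf' M hM j)).mono (Eventually.of_forall fun ε => ?_)
      rw [abs_of_nonneg (semi_nonneg _ _ _),
        abs_of_nonneg (mul_nonneg (norm_nonneg _) (semi_nonneg _ _ _))]
      exact semi_smul_le _ _ _ _

instance : Module (ModNet ℂ) (EcM n) := Submodule.module _

instance : SMul (ModNet ℂ) (EcM n) := (Submodule.module (EcM n)).toSMul

/-- The negligible nets among them. -/
def Nc (n : ℕ) : Submodule (ModNet ℂ) (EcM n) where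
  carrier := {f | ∀ K : Set (Sp n), IsCompact K → ∀ j,
    Negligible fun ε => semi K j ((f : Idx → Test n) ε)}
  add_mem' := by
    rintro f g hf hg M hM j
    refine ((hf M hM j).add (hg M hM j)).mono (Eventually.of_forall fun ε => ?_)
    rw [abs_of_nonneg (semi_nonneg _ _ _),
      abs_of_nonneg (add_nonneg (semi_nonneg _ _ _) (semi_nonneg _ _ _))]
    exact semi_add_le _ _ _ _
  zero_mem' := by
    intro M hM j
    refine Negligible.zero.mono (Eventually.of_forall fun ε => ?_)
    rw [abs_of_nonneg (semi_nonneg _ _ _), abs_zero]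
    refine semi_le le_rfl fun w _ x _ => ?_
    rw [ZeroMemClass.coe_zero, Pi.zero_apply, map_zero]
    simp
  smul_mem' := by
    rintro r f hf M hM j
    refine (Moderate.mul_negligible r.2 (hf M hM j)).mono (Eventually.of_forall fun ε => ?_)
    rw [abs_of_nonneg (semi_nonneg _ _ _),
      abs_of_nonneg (mul_nonneg (norm_nonneg _) (semi_nonneg _ _ _))]
    exact semi_smul_le _ _ _ _

/-- The Colombeau algebra `𝓖_c(ℝⁿ)` of compactly supported generalized functions, as a
`ℂ~`-module. (Multiplying a representative by a cut-off function, one sees that every generalized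
function with compact support is represented by a net with supports in a common compact set.) -/
def Gc (n : ℕ) : Type := EcM n ⧸ Nc n

instance : AddCommGroup (Gc n) := inferInstanceAs (AddCommGroup (EcM n ⧸ Nc n))

theorem Nc_torsion (n : ℕ) :
    Module.IsTorsionBySet (ModNet ℂ) (EcM n ⧸ Nc n) (NegNet ℂ : Set (ModNet ℂ)) := by
  rintro u ⟨r, hr⟩
  obtain ⟨f, rfl⟩ := Submodule.Quotient.mk_surjective _ u
  change r • Submodule.Quotient.mk f = 0
  rw [← Submodule.Quotient.mk_smul, Submodule.Quotient.mk_eq_zero]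
  intro M hM j
  refine (Moderate.mul_negligible (f.2.2 M hM j) hr).mono (Eventually.of_forall fun ε => ?_)
  rw [abs_of_nonneg (semi_nonneg _ _ _),
    abs_of_nonneg (mul_nonneg (semi_nonneg _ _ _) (norm_nonneg _)), mul_comm]
  exact semi_smul_le _ _ _ _

/-- The `ℂ~`-module structure: `[(r_ε)] • [(f_ε)] = [(r_ε f_ε)]`. -/
instance : Module (GenNum ℂ) (Gc n) := (Nc_torsion n).module

namespace Gc

/-- The class of a net. -/
def mk (f : EcM n) : Gc n := Submodule.Quotient.mk f

theorem mk_surjective : Function.Surjective (mk : EcM n → Gc n) :=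
  Submodule.Quotient.mk_surjective _

theorem mk_add (f g : EcM n) : mk (f + g) = mk f + mk g := rfl

theorem mk_smul (r : ModNet ℂ) (f : EcM n) : mk (r • f) = GenNum.mk r • mk f := rfl

theorem mk_eq_mk {f g : EcM n} : mk f = mk g ↔ f - g ∈ Nc n := Submodule.Quotient.eq _

/-- The support of `u`: the complement of the largest open set on which `u` vanishes, that is, on
whose compact subsets all derivatives of a representative are negligible. -/
def supp (u : Gc n) : Set (Sp n) :=
  (⋃₀ {V | IsOpen V ∧ ∃ f : EcM n, mk f = u ∧ ∀ K ⊆ V, IsCompact K →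
    ∀ j, Negligible fun ε => semi K j ((f : Idx → Test n) ε)})ᶜ

/-- The valuation `val_{p_{K,j}}(u) = sup {b : p_{K,j}(u_ε) = O(ε^b)}`. -/
def val (K : Set (Sp n)) (j : ℕ) (u : Gc n) : EReal :=
  sSup {b | ∃ (a : ℝ) (f : EcM n), mk f = u ∧
    OPow (fun ε => semi K j ((f : Idx → Test n) ε)) a ∧ b = a}

/-- The ultra-pseudo-seminorm `exp (-val_{p_{K,j}}(u))`. -/
def ultraSemi (K : Set (Sp n)) (j : ℕ) (u : Gc n) : ℝ≥0∞ := EReal.exp (-val K j u)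

/-- The set `𝓖_K(ℝⁿ)` of the elements of `𝓖_c(ℝⁿ)` with support in `K`. -/
abbrev GK (K : Set (Sp n)) : Type := {u : Gc n // supp u ⊆ K}

/-- The topology of `𝓖_K(ℝⁿ)`, given by the ultra-pseudo-seminorms of `p_{K',j}`, where `K'` is a
compact set containing `K` in its interior. -/
@[reducible]
def topGK (K : Set (Sp n)) : TopologicalSpace (GK K) :=
  generateFrom {S | ∃ (K' : Set (Sp n)) (j : ℕ) (u : GK K) (r : ℝ≥0∞),
    IsCompact K' ∧ K ⊆ interior K' ∧ 0 < r ∧ S = {v : GK K | ultraSemi K' j (v.1 - u.1) < r}}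

end Gc

/-- `ℂ~`-convex subsets of a `ℂ~`-module. -/
def GenConvex {M : Type} [AddCommGroup M] [Module (GenNum ℂ) M] (A : Set M) : Prop :=
  (∀ u ∈ A, ∀ v ∈ A, u + v ∈ A) ∧ ∀ b : ℝ, 0 ≤ b → ∀ u ∈ A, GenNum.epsPow b • u ∈ A

/-- Locally convex `ℂ~`-linear topologies: the module is a topological `ℂ~`-module and `0` has a
base of `ℂ~`-convex neighbourhoods. -/
def IsLocallyConvexTop {M : Type} [AddCommGroup M] [Module (GenNum ℂ) M]
    (t : TopologicalSpace M) : Prop :=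
  @IsTopologicalAddGroup M t _ ∧ @ContinuousSMul (GenNum ℂ) M _ _ t ∧
    ∀ U ∈ @nhds M t 0, ∃ A ∈ @nhds M t 0, A ⊆ U ∧ GenConvex A

/-- The inductive limit topology of `𝓖_c(ℝⁿ)`: the finest locally convex `ℂ~`-linear topology for
which all the inclusions `𝓖_K(ℝⁿ) → 𝓖_c(ℝⁿ)`, `K` compact, are continuous. -/
instance : TopologicalSpace (Gc n) :=
  sInf {t | IsLocallyConvexTop t ∧
    ∀ K : Set (Sp n), IsCompact K → (Gc.topGK K).coinduced Subtype.val ≤ t}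

/-! ### Functionals on `𝓖_c(ℝⁿ)` given by nets of distributions -/

/-- Moderate nets of distributions: for each compact `K` there are `j`, `c`, `N`, `η` with
`|T_ε(f)| ≤ c ε^{-N} p_{K,j}(f)` for all `f ∈ C^∞_K(ℝⁿ)` and `ε ∈ (0,η]`. -/
def ModDistr (T : Idx → Distr n) : Prop :=
  ∀ K : Set (Sp n), IsCompact K → ∃ (j : ℕ) (c : ℝ) (N : ℕ) (η : ℝ), 0 < c ∧ 0 < η ∧ η ≤ 1 ∧
    ∀ f : Test n, tsupport f ⊆ K → ∀ ε : Idx, (ε : ℝ) ≤ η →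
      ‖T ε f‖ ≤ c * (ε : ℝ) ^ (-(N : ℝ)) * semi K j f

theorem eventually_le_near0 {η : ℝ} (h : 0 < η) : ∀ᶠ ε : Idx in near0, (ε : ℝ) ≤ η :=
  (eventually_le_nhds h).comap _

theorem ModDistr.bound {T : Idx → Distr n} (hT : ModDistr T) (f : EcM n) :
    ∃ (K : Set (Sp n)) (j : ℕ) (s : Idx → ℝ), IsCompact K ∧ Moderate s ∧ ∀ᶠ ε in near0,
      ‖T ε ((f : Idx → Test n) ε)‖ ≤ |s ε * semi K j ((f : Idx → Test n) ε)| := by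
  obtain ⟨⟨K, hK, hf⟩, -⟩ := f.2
  obtain ⟨j, c, N, η, hc, hη, -, h⟩ := hT K hK
  refine ⟨K, j, fun ε => c * (ε : ℝ) ^ (-(N : ℝ)), hK,
    ⟨N, OPow.const_mul c (isBigO_refl _ _)⟩, ?_⟩
  filter_upwards [eventually_le_near0 hη] with ε hε
  exact (h _ (hf ε) ε hε).trans (le_abs_self _)

theorem ModDistr.moderate {T : Idx → Distr n} (hT : ModDistr T) (f : EcM n) :
    (fun ε => T ε ((f : Idx → Test n) ε)) ∈ ModNet ℂ := by
  obtain ⟨K, j, s, hK, hs, h⟩ := hT.bound f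
  refine (hs.mul (f.2.2 K hK j)).mono ?_
  simpa only [abs_norm] using h

theorem ModDistr.negligible {T : Idx → Distr n} (hT : ModDistr T) {f : EcM n} (hf : f ∈ Nc n) :
    Negligible fun ε => ‖T ε ((f : Idx → Test n) ε)‖ := by
  obtain ⟨K, j, s, hK, hs, h⟩ := hT.bound f
  refine (hs.mul_negligible (hf K hK j)).mono ?_
  simpa only [abs_norm] using h

/-- The functional `u ↦ [(T_ε(u_ε))_ε]` on `𝓖_c(ℝⁿ)` given by a moderate net of distributions. -/
def ofNet (T : Idx → Distr n) (hT : ModDistr T) : Gc n →ₗ[GenNum ℂ] GenNum ℂ where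
  toFun := Quotient.lift (fun f : EcM n => GenNum.mk ⟨_, hT.moderate f⟩) (by
    intro f g h
    have h' : Gc.mk f = Gc.mk g := Quotient.sound h
    rw [Gc.mk_eq_mk] at h'
    rw [GenNum.mk_eq_mk]
    simpa using hT.negligible h')
  map_add' := by
    intro u v
    obtain ⟨f, rfl⟩ := Gc.mk_surjective u
    obtain ⟨g, rfl⟩ := Gc.mk_surjective v
    change GenNum.mk ⟨_, hT.moderate (f + g)⟩ =
      GenNum.mk ⟨_, hT.moderate f⟩ + GenNum.mk ⟨_, hT.moderate g⟩
    rw [← map_add]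
    congr 1
    ext ε
    simp
  map_smul' := by
    intro z u
    obtain ⟨r, rfl⟩ := GenNum.mk_surjective z
    obtain ⟨f, rfl⟩ := Gc.mk_surjective u
    change GenNum.mk ⟨_, hT.moderate (r • f)⟩ = GenNum.mk r * GenNum.mk ⟨_, hT.moderate f⟩
    rw [← map_mul]
    congr 1
    ext ε
    exact map_smul (T ε) _ _

/-- The continuous functional `T` is given by the net `(T_ε)_ε` of distributions: the net is
moderate and `T u = [(T_ε(u_ε))_ε]` for all `u`. -/
def IsGivenBy (T : Gc n →L[GenNum ℂ] GenNum ℂ) (Tnet : Idx → Distr n) : Prop :=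
  ∃ h : ModDistr Tnet, (T : Gc n →ₗ[GenNum ℂ] GenNum ℂ) = ofNet Tnet h

/-- Basic functionals. -/
def IsBasic (T : Gc n →L[GenNum ℂ] GenNum ℂ) : Prop := ∃ Tnet : Idx → Distr n, IsGivenBy T Tnet

/-- The Dirac distribution `δ`. -/
def dirac (n : ℕ) : Distr n where
  toFun f := f 0
  map_add' _ _ := rfl
  map_smul' _ _ := rfl
  cont := continuous_eval_const _

theorem modDistr_dirac (n : ℕ) : ModDistr fun _ => dirac n := by
  intro K hK
  refine ⟨0, 1, 0, 1, one_pos, one_pos, le_rfl, fun f hf ε _ => ?_⟩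
  simp only [Nat.cast_zero, neg_zero, Real.rpow_zero, one_mul]
  change ‖f 0‖ ≤ _
  by_cases h : (0 : Sp n) ∈ K
  · exact le_semi (w := []) f le_rfl h
  · rw [image_eq_zero_of_notMem_tsupport fun h' => h (hf h'), norm_zero]
    exact semi_nonneg _ _ _

/-- The functional `ι_d(δ) : u ↦ [(δ(u_ε))_ε]`. -/
def iotaDelta (n : ℕ) : Gc n →ₗ[GenNum ℂ] GenNum ℂ := ofNet (fun _ => dirac n) (modDistr_dirac n)

/-! ### Differential operators with generalized constant coefficients -/

/-- `D_i = -i ∂_i` on moderate nets with compact support. -/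
def netD (i : Fin n) : EcM n →ₗ[ModNet ℂ] EcM n where
  toFun f := ⟨fun ε => (-Complex.I) • partialD i ((f : Idx → Test n) ε), by
    obtain ⟨⟨K, hK, hf⟩, hf'⟩ := f.2
    refine ⟨⟨K, hK, fun ε => ?_⟩, fun M hM j => ?_⟩
    · exact (tsupport_smul_subset_right (fun _ : Sp n => -Complex.I) _).trans
        ((tsupport_partialD i _).trans (hf ε))
    · refine (hf' M hM (j + 1)).mono (Eventually.of_forall fun ε => ?_)
      rw [abs_of_nonneg (semi_nonneg _ _ _), abs_of_nonneg (semi_nonneg _ _ _)]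
      refine (semi_smul_le _ _ _ _).trans ?_
      simpa using semi_partialD_le M j i _⟩
  map_add' f g := by
    refine Subtype.ext (funext fun ε => ?_)
    change (-Complex.I) • partialD i ((f : Idx → Test n) ε + (g : Idx → Test n) ε) =
      (-Complex.I) • partialD i ((f : Idx → Test n) ε) +
        (-Complex.I) • partialD i ((g : Idx → Test n) ε)
    rw [map_add, smul_add]
  map_smul' r f := by
    refine Subtype.ext (funext fun ε => ?_)
    change (-Complex.I) • partialD i ((r : Idx → ℂ) ε • (f : Idx → Test n) ε) =
      (r : Idx → ℂ) ε • ((-Complex.I) • partialD i ((f : Idx → Test n) ε))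
    rw [map_smul, smul_comm]

theorem netD_mem_Nc (i : Fin n) {f : EcM n} (hf : f ∈ Nc n) : netD i f ∈ Nc n := by
  intro M hM j
  refine (hf M hM (j + 1)).mono (Eventually.of_forall fun ε => ?_)
  rw [abs_of_nonneg (semi_nonneg _ _ _), abs_of_nonneg (semi_nonneg _ _ _)]
  refine (semi_smul_le _ _ _ _).trans ?_
  simpa using semi_partialD_le M j i _

/-- The map `[(f_ε)] ↦ [(D_i f_ε)]`. -/
def Gc.mapD (i : Fin n) : Gc n → Gc n :=
  Quotient.lift (fun f : EcM n => Gc.mk (netD i f)) (by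
    intro f g h
    have h' : Gc.mk f = Gc.mk g := Quotient.sound h
    rw [Gc.mk_eq_mk] at h' ⊢
    rw [← map_sub]
    exact netD_mem_Nc i h')

theorem Gc.mapD_mk (i : Fin n) (f : EcM n) : Gc.mapD i (Gc.mk f) = Gc.mk (netD i f) := rfl

theorem Gc.mapD_add (i : Fin n) (u v : Gc n) :
    Gc.mapD i (u + v) = Gc.mapD i u + Gc.mapD i v := by
  obtain ⟨f, rfl⟩ := Gc.mk_surjective u
  obtain ⟨g, rfl⟩ := Gc.mk_surjective v
  rw [← Gc.mk_add, Gc.mapD_mk, Gc.mapD_mk, Gc.mapD_mk, ← Gc.mk_add]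
  exact congrArg Gc.mk ((netD i).map_add f g)

theorem Gc.mapD_smul (i : Fin n) (z : GenNum ℂ) (u : Gc n) :
    Gc.mapD i (z • u) = z • Gc.mapD i u := by
  obtain ⟨r, rfl⟩ := GenNum.mk_surjective z
  obtain ⟨f, rfl⟩ := Gc.mk_surjective u
  rw [← Gc.mk_smul, Gc.mapD_mk, Gc.mapD_mk, ← Gc.mk_smul]
  exact congrArg Gc.mk ((netD i).map_smul r f)

/-- `D_i = -i ∂_i` on `𝓖_c(ℝⁿ)`. -/
def Gc.D (i : Fin n) : Module.End (GenNum ℂ) (Gc n) where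
  toFun := Gc.mapD i
  map_add' := Gc.mapD_add i
  map_smul' := Gc.mapD_smul i

/-- `D^α = D_1^{α_1} ⋯ D_n^{α_n}` on `𝓖_c(ℝⁿ)`. -/
def Gc.Dpow (α : Fin n →₀ ℕ) : Module.End (GenNum ℂ) (Gc n) :=
  ((List.finRange n).map fun i => Gc.D i ^ α i).prod

/-- The transpose `ᵗP(D) = ∑_α (-1)^{|α|} a_α D^α` of `P(D) = ∑_α a_α D^α`. -/
def transposeD (P : MvPolynomial (Fin n) (GenNum ℂ)) : Module.End (GenNum ℂ) (Gc n) :=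
  ∑ α ∈ P.support, (P.coeff α * (-1) ^ α.degree) • Gc.Dpow α

/-- The action of `P(D)` on functionals: `(P(D)T)(u) = T(ᵗP(D)u)`. -/
def actD (P : MvPolynomial (Fin n) (GenNum ℂ)) (T : Gc n →ₗ[GenNum ℂ] GenNum ℂ) :
    Gc n →ₗ[GenNum ℂ] GenNum ℂ :=
  T ∘ₗ transposeD P

/-- `E` is a fundamental solution of `P(D)`: `P(D)E = ι_d(δ)`. -/
def IsFundamentalSolution (P : MvPolynomial (Fin n) (GenNum ℂ))
    (E : Gc n →L[GenNum ℂ] GenNum ℂ) : Prop :=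
  actD P E = iotaDelta n

/-- The net `(P_ε)_ε` of polynomials of degree at most `m` is a representative of `P`: its
coefficients are representatives of the coefficients of `P`. -/
def IsRepresentative (m : ℕ) (P : MvPolynomial (Fin n) (GenNum ℂ))
    (Pnet : Idx → MvPolynomial (Fin n) ℂ) : Prop :=
  (∀ ε, (Pnet ε).totalDegree ≤ m) ∧
    ∀ α, GenNum.IsRep (fun ε => (Pnet ε).coeff α) (P.coeff α)

/-- The formal derivative `∂^α P` of a polynomial. -/
def polyD {R : Type} [CommRing R] (α : Fin n → ℕ) (P : MvPolynomial (Fin n) R) :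
    MvPolynomial (Fin n) R :=
  ((List.finRange n).map fun i =>
    ((MvPolynomial.pderiv i).toLinearMap : Module.End R (MvPolynomial (Fin n) R)) ^ α i).prod P

/-- The multi-indices `α` with `|α| ≤ m`. -/
def multiIdx (n m : ℕ) : Finset (Fin n → ℕ) :=
  (Finset.range (m + 1)).biUnion fun k => Finset.piAntidiag Finset.univ k

/-- The generalized weight `P~(ξ) = (∑_{|α| ≤ m} |∂^α P(ξ)|²)^{1/2}` in `ℝ~` of a polynomial of
degree at most `m` with coefficients in `ℂ~`, at a point `ξ` of `ℝⁿ`. -/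
def genWeight (m : ℕ) (P : MvPolynomial (Fin n) (GenNum ℂ)) (ξ : Sp n) : GenNum ℝ :=
  GenNum.sqrt (∑ α ∈ multiIdx n m,
    GenNum.abs (MvPolynomial.eval (fun i => GenNum.const (ξ i : ℂ)) (polyD α P)) ^ 2)

/-- The weight `p~(ξ) = (∑_{|α| ≤ m} |∂^α p(ξ)|²)^{1/2}` of a complex polynomial of degree at
most `m`. -/
def weight (m : ℕ) (p : MvPolynomial (Fin n) ℂ) (ξ : Sp n) : ℝ :=
  √(∑ α ∈ multiIdx n m, ‖MvPolynomial.eval (fun i => (ξ i : ℂ)) (polyD α p)‖ ^ 2)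

/-! ### The spaces `B_{p,k}` and the quotient by `cosh(c|x|)` -/

/-- The Fourier transform `φ^(x) = ∫ e^{-i⟨x,ξ⟩} φ(ξ) dξ` on the Schwartz space. -/
def hat (φ : 𝓢(Sp n, ℂ)) : 𝓢(Sp n, ℂ) :=
  SchwartzMap.compCLMOfContinuousLinearEquiv ℂ
    (ContinuousLinearEquiv.smulLeft (Units.mk0 (2 * Real.pi)⁻¹ (by positivity))) (𝓕 φ)

theorem hat_apply (φ : 𝓢(Sp n, ℂ)) (x : Sp n) :
    hat φ x = ∫ ξ, Complex.exp (-Complex.I * inner ℝ x ξ) * φ ξ := by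
  change (𝓕 φ) ((2 * Real.pi)⁻¹ • x) = _
  rw [SchwartzMap.fourier_coe, Real.fourier_eq']
  congr 1
  ext ξ
  rw [smul_eq_mul, inner_smul_right, real_inner_comm]
  congr 2
  push_cast
  field_simp

/-- The Fourier transform of the tempered distribution `w` is the locally integrable
function `g`. -/
def HasFourierFun (w : 𝓢'(Sp n, ℂ)) (g : Sp n → ℂ) : Prop :=
  LocallyIntegrable g ∧
    ∀ φ : 𝓢(Sp n, ℂ), HasCompactSupport φ → w (hat φ) = ∫ ξ, g ξ * φ ξ

/-- `‖w‖_{p,k} = (2π)^{-n} ‖k w^‖_p`; this is `∞` if `w^` is not a function, and otherwise the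
infimum is over the functions which are almost everywhere equal to `w^`. -/
def normB (p : ℝ≥0∞) (k : Sp n → ℝ) (w : 𝓢'(Sp n, ℂ)) : ℝ≥0∞ :=
  ⨅ (g : Sp n → ℂ) (_ : HasFourierFun w g),
    ENNReal.ofReal (((2 * Real.pi) ^ n)⁻¹) * eLpNorm (fun ξ => (k ξ : ℂ) * g ξ) p

/-- `w ∈ B_{p,k}(ℝⁿ)`. -/
def MemB (p : ℝ≥0∞) (k : Sp n → ℝ) (w : 𝓢'(Sp n, ℂ)) : Prop :=
  (∃ g, HasFourierFun w g) ∧ normB p k w < ⊤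

theorem contDiff_cosh_norm (c : ℝ) :
    ContDiff ℝ ∞ fun x : Sp n => Real.cosh (c * ‖x‖) := by
  set a : ℕ → ℝ := fun k => ((2 * k).factorial : ℝ)⁻¹ with ha
  set p := FormalMultilinearSeries.ofScalars ℝ a with hp
  have hrad : p.radius = ⊤ := by
    refine FormalMultilinearSeries.ofScalars_radius_eq_top_of_tendsto ℝ a
      (Eventually.of_forall fun k => by simp only [ha]; positivity) ?_
    refine squeeze_zero (fun k => by positivity) (fun k => ?_)
      (tendsto_one_div_add_atTop_nhds_zero_nat (𝕜 := ℝ))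
    have h1 : (2 * (k + 1)).factorial = (2 * k + 2) * ((2 * k + 1) * (2 * k).factorial) := by
      rw [show 2 * (k + 1) = 2 * k + 1 + 1 by ring, Nat.factorial_succ, Nat.factorial_succ]
    have h2 : (0 : ℝ) < (2 * k).factorial := by positivity
    simp only [ha, Nat.succ_eq_add_one, h1, norm_inv, Real.norm_natCast]
    push_cast
    rw [div_le_div_iff₀ (by positivity) (by positivity), inv_mul_eq_div, one_mul, div_le_iff₀
      (by positivity)]
    rw [inv_mul_eq_div, le_div_iff₀ h2]
    nlinarith [mul_nonneg h2.le (k.cast_nonneg (α := ℝ)),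
      mul_nonneg (mul_nonneg h2.le (k.cast_nonneg (α := ℝ))) (k.cast_nonneg (α := ℝ))]
  have han : ContDiff ℝ ∞ p.sum := by
    have h := (p.hasFPowerSeriesOnBall (by rw [hrad]; simp)).analyticOnNhd
    rw [hrad, Metric.eball_top] at h
    exact h.contDiff
  have heq : (fun x : Sp n => Real.cosh (c * ‖x‖)) =
      fun x => p.sum (c ^ 2 * ‖x‖ ^ 2) := by
    funext x
    rw [Real.cosh_eq_tsum, hp]
    change _ = FormalMultilinearSeries.ofScalarsSum a (c ^ 2 * ‖x‖ ^ 2)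
    rw [FormalMultilinearSeries.ofScalars_sum_eq]
    refine tsum_congr fun k => ?_
    rw [ha, smul_eq_mul, pow_mul, mul_pow]
    ring
  rw [heq]
  exact han.comp (contDiff_const.mul (contDiff_norm_sq ℝ))

/-- The test function `f / cosh(c|x|)`. -/
def divCosh (c : ℝ) (f : Test n) : Test n where
  toFun x := f x / (Real.cosh (c * ‖x‖) : ℂ)
  contDiff' := by
    have h : ContDiff ℝ ∞ fun x : Sp n => (Real.cosh (c * ‖x‖))⁻¹ • f x :=
      ((contDiff_cosh_norm c).inv fun x => (Real.cosh_pos _).ne').smul f.contDiff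
    convert h using 2 with x
    rw [Complex.real_smul, Complex.ofReal_inv, div_eq_inv_mul]
  hasCompactSupport' := by
    simp_rw [div_eq_mul_inv]
    exact f.hasCompactSupport.mul_right
  tsupport_subset' := Set.subset_univ _

/-- The tempered distribution `w` is the distribution `E / cosh(c|x|) : f ↦ E(f / cosh(c|x|))`. -/
def IsDivCosh (c : ℝ) (E : Distr n) (w : 𝓢'(Sp n, ℂ)) : Prop :=
  ∀ f : Test n, w (f.hasCompactSupport.toSchwartzMap f.contDiff) = E (divCosh c f)

end Colombeau

end

open Colombeau

/-!
Hörmander's construction, carried out with uniform constants in `ε`. For a polynomial `p ≠ 0` of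
degree at most `m`, compactness of the unit sphere of Taylor coefficients yields a finite set of
directions such that for every `ξ` some direction `θ(ξ)` in it satisfies `|p(ξ + zθ(ξ))| ≥ κ p̃(ξ)`
on the circle `|z| = 1`, where `κ` depends only on `n`, `m` and `ρ = sup |θ|`. With `F_f` the
Fourier–Laplace transform of `f`, put

`E(f) = (2π)^{-n} ∫ ⨍_{|z| = 1} F_f(ξ + zθ(ξ)) / p(ξ + zθ(ξ)) dz dξ`.

On `ᵗp(D) f` the denominator cancels, and the mean value property over circles followed by Fourier
inversion gives `f(0)`. The quotient by `cosh(c|x|)` is controlled because `1 / cosh(c|x|)` and its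
derivatives decay like `e^{-c|x|}`, so that its Fourier–Laplace transform exists and decays rapidly
in a strip around `ℝⁿ` containing all the circles, provided `ρ` is small.

For a net of polynomials, `|E_ε(f)|` is bounded by a seminorm of `f` divided by `P̃_ε(ξ₀)`, so
invertibility of `P̃(ξ₀)` makes the net moderate. When `P_ε = 0`, which can occur only for `ε`
bounded away from `0`, take `E_ε = 0`.
-/

noncomputable section

namespace Colombeau

variable {n : ℕ}

/-! ### The topology of the ring of generalized numbers -/

theorem OPow.of_le {r s : Idx → ℝ} {b : ℝ} (hs : OPow s b) (hr : ∀ ε, 0 ≤ r ε)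
    (h : ∀ ε, r ε ≤ s ε) : OPow r b :=
  hs.mono (Eventually.of_forall fun ε => abs_le_abs_of_nonneg (hr ε) (h ε))

theorem Moderate.of_le {r s : Idx → ℝ} (hs : Moderate s) (hr : ∀ ε, 0 ≤ r ε)
    (h : ∀ ε, r ε ≤ s ε) : Moderate r :=
  hs.imp fun _ hN => hN.of_le hr h

theorem Negligible.of_le {r s : Idx → ℝ} (hs : Negligible s) (hr : ∀ ε, 0 ≤ r ε)
    (h : ∀ ε, r ε ≤ s ε) : Negligible r :=
  fun q => (hs q).of_le hr h

theorem oPow_rpow (b : ℝ) : OPow (fun ε => (ε : ℝ) ^ b) b := isBigO_refl _ _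

theorem zero_lt_exp_neg (a : ℝ) : 0 < EReal.exp (-(a : EReal)) := by
  rw [EReal.zero_lt_exp_iff, ← EReal.coe_neg]
  exact EReal.bot_lt_coe _

theorem exists_exp_neg_btwn {x r : ℝ≥0∞} (h : x < r) :
    ∃ a : ℝ, x < EReal.exp (-(a : EReal)) ∧ EReal.exp (-(a : EReal)) < r := by
  obtain ⟨s, hxs, hsr⟩ := ENNReal.lt_iff_exists_nnreal_btwn.1 h
  have hs : (0 : ℝ) < s := by exact_mod_cast zero_le.trans_lt hxs
  have hexp : EReal.exp (-((-Real.log s : ℝ) : EReal)) = s := by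
    rw [EReal.coe_neg, neg_neg, EReal.exp_coe, Real.exp_log hs, ENNReal.ofReal_coe_nnreal]
  exact ⟨-Real.log s, by rwa [hexp], by rwa [hexp]⟩

theorem exp_neg_sSup_lt_iff {S : Set ℝ} (hS : IsLowerSet S) {r : ℝ≥0∞} :
    EReal.exp (-sSup ((↑) '' S)) < r ↔ ∃ a ∈ S, EReal.exp (-(a : EReal)) < r := by
  constructor
  · intro h
    obtain ⟨a, hSa, har⟩ := exists_exp_neg_btwn h
    have ha : (a : EReal) < sSup ((↑) '' S) :=
      EReal.neg_lt_neg_iff.1 (EReal.exp_strictMono.lt_iff_lt.1 hSa)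
    obtain ⟨_, ⟨b, hb, rfl⟩, hab⟩ := lt_sSup_iff.1 ha
    exact ⟨a, hS (EReal.coe_le_coe_iff.1 hab.le) hb, har⟩
  · rintro ⟨a, ha, har⟩
    exact (EReal.exp_monotone (EReal.neg_le_neg_iff.2
      (le_sSup (Set.mem_image_of_mem _ ha)))).trans_lt har

namespace GenNum

variable {𝕜 : Type} [NormedField 𝕜]

/-- The generalized numbers with a representative that is `O(ε^a)`. This is the set `{val ≥ a}` up
to the boundary case `val = a`; in contrast to balls, these sets are visibly subgroups. -/
def orderGe (𝕜 : Type) [NormedField 𝕜] (a : ℝ) : AddSubgroup (GenNum 𝕜) where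
  carrier := {z | ∃ r : ModNet 𝕜, mk r = z ∧ OPow (fun ε => ‖(r : Idx → 𝕜) ε‖) a}
  add_mem' := by
    rintro _ _ ⟨r, rfl, hr⟩ ⟨s, rfl, hs⟩
    exact ⟨r + s, map_add _ _ _,
      (hr.add hs).of_le (fun _ => norm_nonneg _) fun _ => norm_add_le _ _⟩
  zero_mem' := ⟨0, map_zero _, by simpa using OPow.zero a⟩
  neg_mem' := by
    rintro _ ⟨r, rfl, hr⟩
    exact ⟨-r, map_neg _ _, by simpa using hr⟩

theorem mk_mem_orderGe {a : ℝ} {r : ModNet 𝕜} (h : OPow (fun ε => ‖(r : Idx → 𝕜) ε‖) a) :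
    mk r ∈ orderGe 𝕜 a := ⟨r, rfl, h⟩

theorem orderGe_antitone : Antitone (orderGe 𝕜) := by
  rintro a b h _ ⟨r, rfl, hr⟩
  exact ⟨r, rfl, hr.anti h⟩

theorem mul_mem_orderGe {a b : ℝ} {z w : GenNum 𝕜} (hz : z ∈ orderGe 𝕜 a)
    (hw : w ∈ orderGe 𝕜 b) : z * w ∈ orderGe 𝕜 (a + b) := by
  obtain ⟨r, rfl, hr⟩ := hz
  obtain ⟨s, rfl, hs⟩ := hw
  exact ⟨r * s, map_mul _ _ _, by simpa using hr.mul hs⟩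

theorem exists_mem_orderGe (z : GenNum 𝕜) : ∃ N : ℕ, z ∈ orderGe 𝕜 (-(N : ℝ)) := by
  obtain ⟨r, rfl⟩ := mk_surjective z
  obtain ⟨N, hN⟩ : Moderate fun ε => ‖(r : Idx → 𝕜) ε‖ := r.2
  exact ⟨N, r, rfl, hN⟩

theorem epsPow_mem_orderGe (b : ℝ) : epsPow b ∈ orderGe ℂ b :=
  mk_mem_orderGe <| (oPow_rpow b).of_le (fun _ => norm_nonneg _) fun ε => by
    rw [Complex.norm_of_nonneg (Real.rpow_nonneg ε.2.1.le b)]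

theorem ringSubgroupsBasis_orderGe : RingSubgroupsBasis (orderGe 𝕜) := by
  refine RingSubgroupsBasis.of_comm _ (fun a b => ⟨max a b, ?_⟩) (fun a => ⟨max a 0, ?_⟩)
    fun x a => ?_
  · exact le_inf (orderGe_antitone (le_max_left _ _)) (orderGe_antitone (le_max_right _ _))
  · rintro _ ⟨z, hz, w, hw, rfl⟩
    refine orderGe_antitone ?_ (mul_mem_orderGe hz hw)
    linarith [le_max_left a 0, le_max_right a 0]
  · obtain ⟨N, hN⟩ := exists_mem_orderGe x
    refine ⟨a + N, fun w hw => orderGe_antitone ?_ (mul_mem_orderGe hN hw)⟩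
    linarith

theorem ultraNorm_lt_iff {z : GenNum 𝕜} {r : ℝ≥0∞} :
    ultraNorm z < r ↔ ∃ a : ℝ, z ∈ orderGe 𝕜 a ∧ EReal.exp (-(a : EReal)) < r := by
  have hval : val z = sSup ((↑) '' {a : ℝ | z ∈ orderGe 𝕜 a}) :=
    congrArg sSup <| Set.ext fun b => ⟨fun ⟨a, s, hs, hsa, hb⟩ => ⟨a, ⟨s, hs, hsa⟩, hb.symm⟩,
      fun ⟨a, ⟨s, hs, hsa⟩, hb⟩ => ⟨a, s, hs, hsa, hb.symm⟩⟩
  rw [ultraNorm, hval]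
  exact exp_neg_sSup_lt_iff fun _ _ hab ha => orderGe_antitone hab ha

theorem orderGe_mem_nhds (z : GenNum 𝕜) (a : ℝ) : {w | w - z ∈ orderGe 𝕜 a} ∈ 𝓝 z := by
  have ho : IsOpen {w : GenNum 𝕜 | ultraNorm (w - z) < EReal.exp (-a)} :=
    isOpen_generateFrom_of_mem ⟨z, _, zero_lt_exp_neg a, rfl⟩
  refine mem_of_superset (ho.mem_nhds (ultraNorm_lt_iff.2 ⟨a + 1, ?_, ?_⟩)) fun w hw => ?_
  · rw [sub_self]
    exact zero_mem _
  · rw [EReal.exp_strictMono.lt_iff_lt, EReal.neg_lt_neg_iff]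
    exact_mod_cast lt_add_one a
  · obtain ⟨b, hwb, hb⟩ := ultraNorm_lt_iff.1 hw
    rw [EReal.exp_strictMono.lt_iff_lt, EReal.neg_lt_neg_iff, EReal.coe_lt_coe_iff] at hb
    exact orderGe_antitone hb.le hwb

theorem topology_eq_ringSubgroupsBasis : (instTopologicalSpace : TopologicalSpace (GenNum 𝕜)) =
    (ringSubgroupsBasis_orderGe (𝕜 := 𝕜)).topology := by
  refine le_antisymm (le_of_nhds_le_nhds fun z s hs => ?_) (le_generateFrom ?_)
  · obtain ⟨a, -, ha⟩ := ((ringSubgroupsBasis_orderGe (𝕜 := 𝕜)).hasBasis_nhds z).mem_iff.1 hs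
    exact mem_of_superset (orderGe_mem_nhds z a) ha
  · rintro _ ⟨z, r, -, rfl⟩
    refine (@isOpen_iff_mem_nhds _ (ringSubgroupsBasis_orderGe (𝕜 := 𝕜)).topology _).2
      fun w hw => ?_
    obtain ⟨a, hwa, ha⟩ := ultraNorm_lt_iff.1 hw
    refine ((ringSubgroupsBasis_orderGe (𝕜 := 𝕜)).hasBasis_nhds w).mem_iff.2
      ⟨a, trivial, fun v hv => ultraNorm_lt_iff.2 ⟨a, ?_, ha⟩⟩
    rw [← sub_add_sub_cancel v w z]
    exact add_mem hv hwa

instance : IsTopologicalRing (GenNum 𝕜) := by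
  rw [topology_eq_ringSubgroupsBasis]
  exact (ringSubgroupsBasis_orderGe (𝕜 := 𝕜)).toRingFilterBasis.isTopologicalRing

theorem hasBasis_nhds (z : GenNum 𝕜) :
    (𝓝 z).HasBasis (fun _ : ℝ => True) fun a => {w | w - z ∈ orderGe 𝕜 a} := by
  rw [topology_eq_ringSubgroupsBasis]
  exact (ringSubgroupsBasis_orderGe (𝕜 := 𝕜)).hasBasis_nhds z

theorem hasBasis_nhds_zero :
    (𝓝 (0 : GenNum 𝕜)).HasBasis (fun _ : ℝ => True) fun a => (orderGe 𝕜 a : Set (GenNum 𝕜)) := by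
  rw [topology_eq_ringSubgroupsBasis]
  exact (ringSubgroupsBasis_orderGe (𝕜 := 𝕜)).hasBasis_nhds_zero

end GenNum

theorem genConvex_preimage_orderGe {M : Type} [AddCommGroup M] [Module (GenNum ℂ) M]
    (T : M →ₗ[GenNum ℂ] GenNum ℂ) (a : ℝ) : GenConvex (T ⁻¹' (GenNum.orderGe ℂ a)) := by
  refine ⟨fun u hu v hv => ?_, fun b hb u hu => ?_⟩
  · rw [Set.mem_preimage, map_add]
    exact add_mem hu hv
  · rw [Set.mem_preimage, map_smul, smul_eq_mul]
    exact GenNum.orderGe_antitone (by linarith)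
      (GenNum.mul_mem_orderGe (GenNum.epsPow_mem_orderGe b) hu)

theorem isLocallyConvexTop_induced {M : Type} [AddCommGroup M] [Module (GenNum ℂ) M]
    (T : M →ₗ[GenNum ℂ] GenNum ℂ) : IsLocallyConvexTop (induced T inferInstance) := by
  refine ⟨topologicalAddGroup_induced T, continuousSMul_induced T, fun U hU => ?_⟩
  have hbasis := GenNum.hasBasis_nhds_zero.comap T
  rw [← map_zero T, ← nhds_induced] at hbasis
  obtain ⟨a, -, ha⟩ := hbasis.mem_iff.1 hU
  exact ⟨_, hbasis.mem_of_mem trivial, ha, genConvex_preimage_orderGe T a⟩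

theorem continuous_of_forall_continuous_GK (T : Gc n →ₗ[GenNum ℂ] GenNum ℂ)
    (hT : ∀ K : Set (Sp n), IsCompact K →
      Continuous[Gc.topGK K, inferInstance] fun u : Gc.GK K => T u) : Continuous T := by
  rw [continuous_iff_le_induced]
  refine sInf_le ⟨isLocallyConvexTop_induced T, fun K hK => ?_⟩
  rw [← continuous_iff_coinduced_le, continuous_induced_rng]
  exact hT K hK


/-! ### Continuity of the functionals given by moderate nets -/

/-- The pointwise product of two test functions. -/
def mulTest (χ f : Test n) : Test n where
  toFun x := χ x * f x
  contDiff' := χ.contDiff.mul f.contDiff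
  hasCompactSupport' := f.hasCompactSupport.mul_left
  tsupport_subset' := Set.subset_univ _

theorem partialD_eq_fderiv (i : Fin n) (f : Test n) (x : Sp n) :
    partialD i f x = fderiv ℝ f x (EuclideanSpace.single i (1 : ℝ)) := by
  rw [partialD_apply, (f.contDiff.differentiable (by simp) x).lineDeriv_eq_fderiv]

theorem partialD_mulTest (i : Fin n) (χ f : Test n) :
    partialD i (mulTest χ f) = mulTest (partialD i χ) f + mulTest χ (partialD i f) := by
  ext x
  change _ = partialD i χ x * f x + χ x * partialD i f x
  have hmul : (mulTest χ f : Sp n → ℂ) = fun x => χ x * f x := rfl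
  simp only [partialD_eq_fderiv, hmul]
  rw [fderiv_fun_mul (χ.contDiff.differentiable (by simp) x)
    (f.contDiff.differentiable (by simp) x)]
  simp only [add_apply, smul_apply, smul_eq_mul]
  ring

theorem wordD_cons (i : Fin n) (w : List (Fin n)) (f : Test n) :
    wordD (i :: w) f = partialD i (wordD w f) := rfl

theorem wordD_append_singleton (w : List (Fin n)) (i : Fin n) (f : Test n) :
    wordD (w ++ [i]) f = wordD w (partialD i f) := by
  simp [wordD, Module.End.mul_apply]

theorem tsupport_wordD (w : List (Fin n)) (f : Test n) : tsupport (wordD w f) ⊆ tsupport f := by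
  induction w with
  | nil => rfl
  | cons i w ih => exact (tsupport_partialD i _).trans ih

theorem wordD_eq_zero_of_eqOn_zero {U : Set (Sp n)} (hU : IsOpen U) {f : Test n}
    (hf : Set.EqOn f 0 U) (w : List (Fin n)) {x : Sp n} (hx : x ∈ U) : wordD w f x = 0 :=
  image_eq_zero_of_notMem_tsupport fun h =>
    notMem_tsupport_iff_eventuallyEq.2 (hf.eventuallyEq_of_mem (hU.mem_nhds hx))
      (tsupport_wordD w f h)

theorem semi_mono_order (K : Set (Sp n)) {j k : ℕ} (h : j ≤ k) (f : Test n) :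
    semi K j f ≤ semi K k f :=
  semi_le (semi_nonneg _ _ _) fun _ hw _ hx => le_semi f (hw.trans h) hx

theorem semi_mono_set {K L : Set (Sp n)} (h : K ⊆ L) (j : ℕ) (f : Test n) :
    semi K j f ≤ semi L j f :=
  semi_le (semi_nonneg _ _ _) fun _ hw _ hx => le_semi f hw (h hx)

theorem semi_empty (j : ℕ) (f : Test n) : semi ∅ j f = 0 :=
  (semi_le le_rfl fun _ _ _ hx => hx.elim).antisymm (semi_nonneg _ _ _)

theorem semi_union_le (K L : Set (Sp n)) (j : ℕ) (f : Test n) :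
    semi (K ∪ L) j f ≤ semi K j f + semi L j f :=
  semi_le (add_nonneg (semi_nonneg _ _ _) (semi_nonneg _ _ _)) fun _ hw _ hx =>
    hx.elim (fun h => (le_semi f hw h).trans (le_add_of_nonneg_right (semi_nonneg _ _ _)))
      fun h => (le_semi f hw h).trans (le_add_of_nonneg_left (semi_nonneg _ _ _))

theorem semi_sub_le (K : Set (Sp n)) (j : ℕ) (f g : Test n) :
    semi K j (f - g) ≤ semi K j f + semi K j g :=
  semi_le (add_nonneg (semi_nonneg _ _ _) (semi_nonneg _ _ _)) fun w hw x hx => by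
    rw [map_sub]
    exact (norm_sub_le _ _).trans (add_le_add (le_semi f hw hx) (le_semi g hw hx))

theorem exists_norm_wordD_mulTest_le (w : List (Fin n)) (χ : Test n) : ∃ C : ℝ, 0 ≤ C ∧
    ∀ (f : Test n) (K : Set (Sp n)), ∀ x ∈ K,
      ‖wordD w (mulTest χ f) x‖ ≤ C * semi K w.length f := by
  induction w using List.reverseRecOn generalizing χ with
  | nil =>
    obtain ⟨C, hC⟩ := χ.continuous.bounded_above_of_compact_support χ.hasCompactSupport
    have hC0 : 0 ≤ C := (norm_nonneg _).trans (hC 0)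
    refine ⟨C, hC0, fun f K x hx => ?_⟩
    change ‖χ x * f x‖ ≤ _
    rw [norm_mul]
    exact mul_le_mul (hC x) (le_semi (w := []) f le_rfl hx) (norm_nonneg _) hC0
  | append_singleton w i ih =>
    obtain ⟨C₁, hC₁, h₁⟩ := ih (partialD i χ)
    obtain ⟨C₂, hC₂, h₂⟩ := ih χ
    refine ⟨C₁ + C₂, by positivity, fun f K x hx => ?_⟩
    rw [wordD_append_singleton, partialD_mulTest, map_add, add_mul, List.length_append,
      List.length_singleton]
    refine (norm_add_le _ _).trans (add_le_add ((h₁ f K x hx).trans ?_)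
      ((h₂ _ K x hx).trans ?_))
    · exact mul_le_mul_of_nonneg_left (semi_mono_order _ (Nat.le_succ _) _) hC₁
    · exact mul_le_mul_of_nonneg_left (semi_partialD_le _ _ _ _) hC₂

theorem exists_semi_mulTest_le (χ : Test n) (j : ℕ) : ∃ C : ℝ, 0 ≤ C ∧
    ∀ (f : Test n) (K : Set (Sp n)), semi K j (mulTest χ f) ≤ C * semi K j f := by
  choose C hC hle using fun w : List (Fin n) => exists_norm_wordD_mulTest_le w χ
  set S := (List.finite_length_le (Fin n) j).toFinset
  have hS : 0 ≤ ∑ w ∈ S, C w := Finset.sum_nonneg fun w _ => hC w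
  refine ⟨∑ w ∈ S, C w, hS, fun f K => semi_le (mul_nonneg hS (semi_nonneg _ _ _))
    fun w hw x hx => (hle w f K x hx).trans ?_⟩
  exact mul_le_mul (Finset.single_le_sum (fun w _ => hC w) (by simpa [S] using hw))
    (semi_mono_order _ hw _) (semi_nonneg _ _ _) hS

theorem exists_cutoff {K K' : Set (Sp n)} (hK : IsCompact K) (hK' : IsCompact K')
    (h : K ⊆ interior K') : ∃ χ : Test n, tsupport χ ⊆ K' ∧
      ∃ U : Set (Sp n), IsOpen U ∧ K ⊆ U ∧ Set.EqOn χ 1 U := by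
  obtain ⟨f, hf, h0, -⟩ := exists_contMDiffMap_one_nhds_of_subset_interior
    (modelWithCornersSelf ℝ (Sp n)) (n := ⊤) hK.isClosed h
  have hsupp : tsupport (fun x => ((f x : ℝ) : ℂ)) ⊆ K' := by
    refine closure_minimal (fun x hx => ?_) hK'.isClosed
    by_contra hx'
    exact hx (by simp [h0 x hx'])
  obtain ⟨U, hU, hKU, hfU⟩ := mem_nhdsSet_iff_exists.1 hf
  refine ⟨⟨fun x => ((f x : ℝ) : ℂ), Complex.ofRealCLM.contDiff.comp
    (contMDiff_iff_contDiff.1 f.contMDiff), hK'.of_isClosed_subset (isClosed_tsupport _) hsupp,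
    Set.subset_univ _⟩, hsupp, U, hU, hKU, fun x hx => ?_⟩
  have hfx : f x = 1 := hfU hx
  change ((f x : ℝ) : ℂ) = 1
  rw [hfx, Complex.ofReal_one]

theorem exists_semi_sub_mulTest_le {χ : Test n} {U : Set (Sp n)} (hU : IsOpen U)
    (hχ : Set.EqOn χ 1 U) (j : ℕ) : ∃ C : ℝ, 0 ≤ C ∧ ∀ (f : Test n) (K : Set (Sp n)),
      semi K j (f - mulTest χ f) ≤ C * semi (K \ U) j f := by
  obtain ⟨C, hC, hle⟩ := exists_semi_mulTest_le χ j
  have hC' : 0 ≤ 1 + C := by positivity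
  refine ⟨1 + C, hC', fun f K => semi_le (mul_nonneg hC' (semi_nonneg _ _ _)) fun w hw x hx => ?_⟩
  by_cases hxU : x ∈ U
  · have hzero : Set.EqOn (f - mulTest χ f : Test n) 0 U := fun y hy => by
      change f y - χ y * f y = 0
      rw [hχ hy, Pi.one_apply, one_mul, sub_self]
    rw [wordD_eq_zero_of_eqOn_zero hU hzero w hxU, norm_zero]
    exact mul_nonneg hC' (semi_nonneg _ _ _)
  · calc ‖wordD w (f - mulTest χ f) x‖ ≤ semi (K \ U) j (f - mulTest χ f) :=
          le_semi _ hw ⟨hx, hxU⟩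
      _ ≤ semi (K \ U) j f + C * semi (K \ U) j f :=
          (semi_sub_le _ _ _ _).trans (by gcongr; exact hle _ _)
      _ = (1 + C) * semi (K \ U) j f := by ring

namespace Gc

/-- The product of a net with a fixed test function. -/
def mulNet (χ : Test n) (f : EcM n) : EcM n :=
  ⟨fun ε => mulTest χ ((f : Idx → Test n) ε),
    ⟨tsupport χ, χ.hasCompactSupport, fun _ => tsupport_mul_subset_left⟩, fun M hM j => by
      obtain ⟨C, -, hle⟩ := exists_semi_mulTest_le χ j
      exact ((Moderate.const C).mul (f.2.2 M hM j)).of_le (fun _ => semi_nonneg _ _ _)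
        fun _ => hle _ _⟩

theorem negligible_semi_of_subset_compl_supp {f : EcM n} {L : Set (Sp n)} (hL : IsCompact L)
    (h : L ⊆ (supp (mk f))ᶜ) (j : ℕ) :
    Negligible fun ε => semi L j ((f : Idx → Test n) ε) := by
  refine hL.induction_on (p := fun s => Negligible fun ε => semi s j ((f : Idx → Test n) ε))
    ?_ ?_ ?_ ?_
  · simpa only [semi_empty] using Negligible.zero
  · exact fun s t hst ht => ht.of_le (fun _ => semi_nonneg _ _ _) fun _ => semi_mono_set hst _ _
  · exact fun s t hs ht =>
      (hs.add ht).of_le (fun _ => semi_nonneg _ _ _) fun _ => semi_union_le _ _ _ _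
  · intro x hx
    have hx' := h hx
    rw [supp, compl_compl] at hx'
    obtain ⟨V, ⟨hV, g, hg, hgV⟩, hxV⟩ := hx'
    obtain ⟨N, hN, hxN, hNV⟩ := exists_compact_subset hV hxV
    have hfg : f - g ∈ Nc n := mk_eq_mk.1 hg.symm
    refine ⟨N, mem_nhdsWithin_of_mem_nhds (mem_interior_iff_mem_nhds.1 hxN),
      ((hfg N hN j).add (hgV N hNV hN j)).of_le (fun _ => semi_nonneg _ _ _) fun ε => ?_⟩
    calc semi N j ((f : Idx → Test n) ε)
        = semi N j (((f - g : EcM n) : Idx → Test n) ε + (g : Idx → Test n) ε) :=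
          congrArg _ (sub_add_cancel _ _).symm
      _ ≤ _ := semi_add_le _ _ _ _

theorem mk_mulNet {f : EcM n} {χ : Test n} {U : Set (Sp n)} (hU : IsOpen U)
    (hf : supp (mk f) ⊆ U) (hχ : Set.EqOn χ 1 U) : mk (mulNet χ f) = mk f := by
  refine (mk_eq_mk.2 fun M hM j => ?_).symm
  obtain ⟨C, -, hle⟩ := exists_semi_sub_mulTest_le hU hχ j
  have hneg := negligible_semi_of_subset_compl_supp (f := f) (hM.diff hU)
    (fun x hx h => hx.2 (hf h)) j
  exact ((Moderate.const C).mul_negligible hneg).of_le (fun _ => semi_nonneg _ _ _)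
    fun _ => hle _ _

theorem supp_sub_subset {K : Set (Sp n)} {u v : Gc n} (hu : supp u ⊆ K) (hv : supp v ⊆ K) :
    supp (u - v) ⊆ K := by
  intro x hx
  by_contra hxK
  have hxu : x ∈ (supp u)ᶜ := fun h => hxK (hu h)
  have hxv : x ∈ (supp v)ᶜ := fun h => hxK (hv h)
  rw [supp, compl_compl] at hxu hxv
  obtain ⟨V, ⟨hV, f, rfl, hf⟩, hxV⟩ := hxu
  obtain ⟨W, ⟨hW, g, rfl, hg⟩, hxW⟩ := hxv
  refine hx ⟨V ∩ W, ⟨hV.inter hW, f - g, rfl, fun L hL hLc j => ?_⟩, hxV, hxW⟩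
  exact ((hf L (hL.trans Set.inter_subset_left) hLc j).add
    (hg L (hL.trans Set.inter_subset_right) hLc j)).of_le (fun _ => semi_nonneg _ _ _)
      fun _ => semi_sub_le _ _ _ _

theorem ultraSemi_lt_iff {K : Set (Sp n)} {j : ℕ} {u : Gc n} {r : ℝ≥0∞} :
    ultraSemi K j u < r ↔ ∃ a : ℝ, (∃ f : EcM n, mk f = u ∧
      OPow (fun ε => semi K j ((f : Idx → Test n) ε)) a) ∧ EReal.exp (-(a : EReal)) < r := by
  have hval : val K j u = sSup ((↑) '' {a : ℝ | ∃ f : EcM n, mk f = u ∧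
      OPow (fun ε => semi K j ((f : Idx → Test n) ε)) a}) :=
    congrArg sSup <| Set.ext fun b => ⟨fun ⟨a, f, hf, hfa, hb⟩ => ⟨a, ⟨f, hf, hfa⟩, hb.symm⟩,
      fun ⟨a, ⟨f, hf, hfa⟩, hb⟩ => ⟨a, f, hf, hfa, hb.symm⟩⟩
  rw [ultraSemi, hval]
  exact exp_neg_sSup_lt_iff (by rintro b a hab ⟨f, hf, hfb⟩; exact ⟨f, hf, hfb.anti hab⟩)

theorem ultraSemi_zero (K : Set (Sp n)) (j : ℕ) : ultraSemi K j (0 : Gc n) = 0 := by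
  refine le_antisymm (le_of_forall_gt fun r hr => ?_) zero_le
  obtain ⟨a, -, har⟩ := exists_exp_neg_btwn hr
  refine ultraSemi_lt_iff.2 ⟨a, ⟨0, rfl, ?_⟩, har⟩
  refine (OPow.zero a).of_le (fun _ => semi_nonneg _ _ _) fun ε => semi_le le_rfl fun w _ x _ => ?_
  rw [ZeroMemClass.coe_zero, Pi.zero_apply, map_zero]
  simp

theorem exists_rep_of_ultraSemi_lt {K : Set (Sp n)} {j : ℕ} {u : Gc n} {a : ℝ}
    (h : ultraSemi K j u < EReal.exp (-a)) :
    ∃ f : EcM n, mk f = u ∧ OPow (fun ε => semi K j ((f : Idx → Test n) ε)) a := by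
  obtain ⟨b, ⟨f, hf, hfb⟩, hb⟩ := ultraSemi_lt_iff.1 h
  rw [EReal.exp_strictMono.lt_iff_lt, EReal.neg_lt_neg_iff, EReal.coe_lt_coe_iff] at hb
  exact ⟨f, hf, hfb.anti hb.le⟩

end Gc

section ofNet

variable {T : Idx → Distr n} (hT : ModDistr T)
include hT

/-- Cutting off near `K` replaces a representative that is small in `p_{K',j}` by one whose
supports lie in `K'`, to which the moderateness estimate applies. -/
theorem ModDistr.exists_ofNet_mem_orderGe {K : Set (Sp n)} (hK : IsCompact K) :
    ∃ (K' : Set (Sp n)) (j N : ℕ), IsCompact K' ∧ K ⊆ interior K' ∧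
      ∀ u : Gc n, Gc.supp u ⊆ K → ∀ a : ℝ, Gc.ultraSemi K' j u < EReal.exp (-a) →
        ofNet T hT u ∈ GenNum.orderGe ℂ (a - N) := by
  obtain ⟨K', hK', hKK'⟩ := exists_compact_superset hK
  obtain ⟨χ, hχK', U, hU, hKU, hχ⟩ := exists_cutoff hK hK' hKK'
  obtain ⟨j, c, N, η, hc, hη, -, hT'⟩ := hT K' hK'
  obtain ⟨C, -, hC⟩ := exists_semi_mulTest_le χ j
  refine ⟨K', j, N, hK', hKK', fun u hu a ha => ?_⟩
  obtain ⟨f, rfl, hf⟩ := Gc.exists_rep_of_ultraSemi_lt ha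
  rw [← Gc.mk_mulNet hU (hu.trans hKU) hχ]
  refine GenNum.mk_mem_orderGe ?_
  have hbound : OPow (fun ε : Idx => (c * C) * ((ε : ℝ) ^ (-(N : ℝ)) *
      semi K' j ((f : Idx → Test n) ε))) (a - N) :=
    (((oPow_rpow (-(N : ℝ))).mul hf).anti (by linarith)).const_mul _
  refine hbound.mono ?_
  filter_upwards [eventually_le_near0 hη] with ε hε
  have hpow : 0 ≤ c * (ε : ℝ) ^ (-(N : ℝ)) := mul_nonneg hc.le (Real.rpow_nonneg ε.2.1.le _)
  rw [abs_norm]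
  calc ‖T ε (mulTest χ ((f : Idx → Test n) ε))‖
      ≤ c * (ε : ℝ) ^ (-(N : ℝ)) * semi K' j (mulTest χ ((f : Idx → Test n) ε)) :=
        hT' _ (tsupport_mul_subset_left.trans hχK') ε hε
    _ ≤ c * (ε : ℝ) ^ (-(N : ℝ)) * (C * semi K' j ((f : Idx → Test n) ε)) :=
        mul_le_mul_of_nonneg_left (hC _ _) hpow
    _ = c * C * ((ε : ℝ) ^ (-(N : ℝ)) * semi K' j ((f : Idx → Test n) ε)) := by ring
    _ ≤ _ := le_abs_self _

theorem ModDistr.continuous_ofNet : Continuous (ofNet T hT) := by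
  refine continuous_of_forall_continuous_GK _ fun K hK => ?_
  let _ := Gc.topGK K
  refine continuous_iff_continuousAt.2 fun u => ?_
  obtain ⟨K', j, N, hK', hKK', hmem⟩ := hT.exists_ofNet_mem_orderGe hK
  refine (GenNum.hasBasis_nhds _).tendsto_right_iff.2 fun a _ => ?_
  have hpos := zero_lt_exp_neg (a + N)
  have ho : IsOpen {v : Gc.GK K | Gc.ultraSemi K' j (v.1 - u.1) <
      EReal.exp (-((a + N : ℝ) : EReal))} :=
    isOpen_generateFrom_of_mem ⟨K', j, u, _, hK', hKK', hpos, rfl⟩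
  filter_upwards [ho.mem_nhds (by simpa only [Set.mem_ofPred_eq, sub_self, Gc.ultraSemi_zero])]
    with v hv
  have hdiff := hmem _ (Gc.supp_sub_subset v.2 u.2) _ hv
  rwa [map_sub, add_sub_cancel_right] at hdiff

end ofNet

/-! ### Derivatives of polynomials and the weight -/

section Polynomial

theorem mem_multiIdx {m : ℕ} {α : Fin n → ℕ} : α ∈ multiIdx n m ↔ ∑ i, α i ≤ m := by
  simp [multiIdx]

variable {R : Type} [CommRing R]

theorem coeff_pderiv_pow (i : Fin n) (k : ℕ) (P : MvPolynomial (Fin n) R) (s : Fin n →₀ ℕ) :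
    ((((MvPolynomial.pderiv i).toLinearMap : Module.End R (MvPolynomial (Fin n) R)) ^ k) P).coeff s
      = (s i + k).descFactorial k * P.coeff (s + Finsupp.single i k) := by
  induction k generalizing s with
  | zero => simp
  | succ k ih =>
    rw [pow_succ', Module.End.mul_apply]
    change MvPolynomial.coeff s (MvPolynomial.pderiv i _) = _
    have hsi : (s + Finsupp.single i 1 : Fin n →₀ ℕ) i = s i + 1 := by simp
    rw [MvPolynomial.coeff_pderiv, ih, add_assoc, ← Finsupp.single_add, hsi, add_comm 1 k,
      show s i + 1 + k = s i + (k + 1) by ring, Nat.descFactorial_succ,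
      show s i + (k + 1) - k = s i + 1 by lia]
    push_cast
    ring

theorem coeff_prod_pderiv_pow (α : Fin n → ℕ) (P : MvPolynomial (Fin n) R) {l : List (Fin n)}
    (hl : l.Nodup) (s : Fin n →₀ ℕ) :
    ((l.map fun i => ((MvPolynomial.pderiv i).toLinearMap :
        Module.End R (MvPolynomial (Fin n) R)) ^ α i).prod P).coeff s =
      ((l.map fun i => (s i + α i).descFactorial (α i)).prod : ℕ) *
        P.coeff (s + (l.map fun i => Finsupp.single i (α i)).sum) := by
  induction l generalizing s with
  | nil => simp
  | cons i l ih =>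
    rw [List.nodup_cons] at hl
    have hrest : (l.map fun j => ((s + Finsupp.single i (α i)) j + α j).descFactorial (α j)) =
        l.map fun j => (s j + α j).descFactorial (α j) := by
      refine List.map_congr_left fun j hj => ?_
      have hij : i ≠ j := fun h => hl.1 (h ▸ hj)
      simp [hij]
    rw [List.map_cons, List.prod_cons, Module.End.mul_apply, coeff_pderiv_pow, ih hl.2,
      List.map_cons, List.prod_cons, List.map_cons, List.sum_cons, ← mul_assoc, ← add_assoc, hrest]
    push_cast
    ring

theorem coeff_polyD (α : Fin n → ℕ) (P : MvPolynomial (Fin n) R) (s : Fin n →₀ ℕ) :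
    (polyD α P).coeff s = (∏ i, (s i + α i).descFactorial (α i) : ℕ) *
      P.coeff (s + Finsupp.equivFunOnFinite.symm α) := by
  rw [polyD, coeff_prod_pderiv_pow α P (List.nodup_finRange n), ← List.ofFn_eq_map,
    List.prod_ofFn, ← List.ofFn_eq_map, List.sum_ofFn]
  congr 3
  ext j
  simp [Finsupp.single_apply]

theorem polyD_polyD (α β : Fin n → ℕ) (P : MvPolynomial (Fin n) R) :
    polyD α (polyD β P) = polyD (α + β) P := by
  ext s
  have hshift : s + Finsupp.equivFunOnFinite.symm α + Finsupp.equivFunOnFinite.symm β =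
      s + Finsupp.equivFunOnFinite.symm (α + β) := by
    ext i
    simp [add_assoc]
  rw [coeff_polyD, coeff_polyD, coeff_polyD, ← mul_assoc, hshift, ← Nat.cast_mul,
    ← Finset.prod_mul_distrib]
  congr 2
  refine Finset.prod_congr rfl fun i _ => ?_
  simp only [Finsupp.coe_add, Pi.add_apply, Finsupp.equivFunOnFinite_symm_apply_apply]
  rw [← add_assoc, add_comm (α i) (β i), mul_comm,
    ← Nat.descFactorial_mul_descFactorial (Nat.le_add_right (β i) (α i)), Nat.add_sub_cancel,
    Nat.add_sub_cancel_left, mul_comm]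

theorem polyD_monomial_of_lt {α : Fin n → ℕ} {s : Fin n →₀ ℕ} {i : Fin n} (hi : s i < α i) (a : R) :
    polyD α (MvPolynomial.monomial s a) = 0 := by
  classical
  ext t
  have hs : s ≠ t + Finsupp.equivFunOnFinite.symm α := by
    rintro rfl
    simp at hi
  rw [coeff_polyD, MvPolynomial.coeff_monomial, if_neg hs, mul_zero, MvPolynomial.coeff_zero]

theorem polyD_monomial_of_le {α : Fin n → ℕ} {s : Fin n →₀ ℕ} (hα : α ≤ s) (a : R) :
    polyD α (MvPolynomial.monomial s a) =
      MvPolynomial.monomial (s - Finsupp.equivFunOnFinite.symm α)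
        ((∏ i, (s i).descFactorial (α i) : ℕ) * a) := by
  classical
  obtain ⟨t, rfl⟩ : ∃ t, s = t + Finsupp.equivFunOnFinite.symm α :=
    ⟨s - Finsupp.equivFunOnFinite.symm α,
      (tsub_add_cancel_of_le fun i => by simpa using hα i).symm⟩
  ext u
  rw [coeff_polyD, MvPolynomial.coeff_monomial, MvPolynomial.coeff_monomial]
  by_cases htu : t = u
  · simp [htu]
  · simp [htu]

theorem totalDegree_le_iff_coeff {R : Type*} [CommSemiring R] {m : ℕ}
    {P : MvPolynomial (Fin n) R} :
    P.totalDegree ≤ m ↔ ∀ s : Fin n →₀ ℕ, m < ∑ i, s i → P.coeff s = 0 := by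
  have hdeg (s : Fin n →₀ ℕ) : (s.sum fun _ e => e) = ∑ i, s i :=
    Finsupp.sum_fintype _ _ fun _ => rfl
  simp_rw [MvPolynomial.totalDegree, Finset.sup_le_iff, hdeg, MvPolynomial.mem_support_iff,
    ← not_le]
  exact forall_congr' fun _ => not_imp_comm

theorem mem_multiIdx_of_mem_support {m : ℕ} {P : MvPolynomial (Fin n) R} (hP : P.totalDegree ≤ m)
    {s : Fin n →₀ ℕ} (hs : s ∈ P.support) : (s : Fin n → ℕ) ∈ multiIdx n m := by
  rw [mem_multiIdx, ← Finsupp.sum_fintype s (fun _ e => e) fun _ => rfl]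
  exact (MvPolynomial.le_totalDegree hs).trans hP

theorem sum_support_eq_sum_multiIdx {M : Type*} [AddCommMonoid M] {m : ℕ}
    {P : MvPolynomial (Fin n) R} (hP : P.totalDegree ≤ m) (F : (Fin n →₀ ℕ) → R → M)
    (hF : ∀ s, F s 0 = 0) :
    ∑ s ∈ P.support, F s (P.coeff s) = ∑ α ∈ multiIdx n m,
      F (Finsupp.equivFunOnFinite.symm α) (P.coeff (Finsupp.equivFunOnFinite.symm α)) := by
  refine Finset.sum_of_injOn (fun s : Fin n →₀ ℕ => (s : Fin n → ℕ))
    (fun s _ t _ h => DFunLike.coe_injective h) (fun s hs => mem_multiIdx_of_mem_support hP hs)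
    (fun α _ hα => ?_) fun s _ => by simp
  have hcoeff : P.coeff (Finsupp.equivFunOnFinite.symm α) = 0 := by
    by_contra hne
    exact hα ⟨_, MvPolynomial.mem_support_iff.2 hne, rfl⟩
  rw [hcoeff, hF]

theorem eval_eq_sum_multiIdx {m : ℕ} {P : MvPolynomial (Fin n) R} (hP : P.totalDegree ≤ m)
    (z : Fin n → R) :
    MvPolynomial.eval z P = ∑ α ∈ multiIdx n m,
      P.coeff (Finsupp.equivFunOnFinite.symm α) * ∏ i, z i ^ α i := by
  rw [MvPolynomial.eval_eq', sum_support_eq_sum_multiIdx hP fun s a => a * ∏ i, z i ^ s i]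
  · simp
  · simp

theorem totalDegree_polyD_le {m : ℕ} {P : MvPolynomial (Fin n) R} (hP : P.totalDegree ≤ m)
    (α : Fin n → ℕ) : (polyD α P).totalDegree ≤ m := by
  rw [totalDegree_le_iff_coeff] at hP ⊢
  intro s hs
  rw [coeff_polyD, hP, mul_zero]
  exact hs.trans_le (Finset.sum_le_sum fun i _ => by simp)

theorem polyD_eq_zero {m : ℕ} {P : MvPolynomial (Fin n) R} (hP : P.totalDegree ≤ m)
    {α : Fin n → ℕ} (hα : m < ∑ i, α i) : polyD α P = 0 := by
  ext s
  rw [coeff_polyD, totalDegree_le_iff_coeff.1 hP, mul_zero, MvPolynomial.coeff_zero]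
  exact hα.trans_le (Finset.sum_le_sum fun i _ => by simp)

theorem polyD_eq_C {P : MvPolynomial (Fin n) R} {s : Fin n →₀ ℕ}
    (hs : P.totalDegree = ∑ i, s i) :
    polyD s P = MvPolynomial.C (((∏ i, (s i).factorial : ℕ) : R) * P.coeff s) := by
  classical
  ext t
  rw [coeff_polyD, MvPolynomial.coeff_C]
  split_ifs with ht
  · subst ht
    simp [Nat.descFactorial_self]
  · obtain ⟨i, hi⟩ := Finsupp.ne_iff.1 (Ne.symm ht)
    rw [totalDegree_le_iff_coeff.1 le_rfl, mul_zero]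
    rw [hs]
    refine Finset.sum_lt_sum (fun i _ => by simp) ⟨i, Finset.mem_univ _, ?_⟩
    simpa using Nat.pos_of_ne_zero hi

end Polynomial

section Taylor

variable {𝕜 : Type} [Field 𝕜] [CharZero 𝕜]

theorem eval_add_monomial {m : ℕ} {s : Fin n →₀ ℕ} (hs : (s : Fin n → ℕ) ∈ multiIdx n m) (a : 𝕜)
    (z y : Fin n → 𝕜) :
    MvPolynomial.eval (z + y) (MvPolynomial.monomial s a) =
      ∑ α ∈ multiIdx n m, MvPolynomial.eval z (polyD α (MvPolynomial.monomial s a)) *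
        ∏ i, y i ^ α i / ((α i).factorial : 𝕜) := by
  have hbox : ∀ α : Fin n → ℕ,
      α ∈ Fintype.piFinset (fun i => Finset.range (s i + 1)) ↔ α ≤ s := fun α => by
    simp only [Fintype.mem_piFinset, Finset.mem_range, Nat.lt_succ_iff, Pi.le_def]
  rw [← Finset.sum_subset (s₁ := Fintype.piFinset fun i => Finset.range (s i + 1))]
  · have hbinom : ∀ i, (z + y) i ^ s i = ∑ k ∈ Finset.range (s i + 1),
        y i ^ k * z i ^ (s i - k) * ((s i).choose k : 𝕜) := fun i => by
      rw [Pi.add_apply, add_comm, add_pow]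
    rw [MvPolynomial.eval_monomial, Finsupp.prod_fintype _ _ fun _ => pow_zero _]
    simp_rw [hbinom, Finset.prod_univ_sum, Finset.mul_sum]
    refine Finset.sum_congr rfl fun α hα => ?_
    rw [polyD_monomial_of_le ((hbox α).1 hα), MvPolynomial.eval_monomial,
      Finsupp.prod_fintype _ _ fun _ => pow_zero _, Nat.cast_prod, mul_comm _ a, mul_assoc,
      mul_assoc, ← Finset.prod_mul_distrib, ← Finset.prod_mul_distrib]
    congr 1
    refine Finset.prod_congr rfl fun i _ => ?_
    rw [Nat.choose_eq_descFactorial_div_factorial, Nat.cast_div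
      (Nat.factorial_dvd_descFactorial _ _) (by exact_mod_cast Nat.factorial_ne_zero _)]
    simp only [Finsupp.coe_tsub, Pi.sub_apply, Finsupp.equivFunOnFinite_symm_apply_apply]
    ring
  · intro α hα
    exact mem_multiIdx.2 <|
      (Finset.sum_le_sum fun i _ => (hbox α).1 hα i).trans (mem_multiIdx.1 hs)
  · intro α _ hα
    rw [hbox, Pi.le_def] at hα
    obtain ⟨i, hi⟩ := not_forall.1 hα
    rw [polyD_monomial_of_lt (not_le.1 hi), map_zero, zero_mul]

theorem eval_add_eq_sum_polyD {m : ℕ} {p : MvPolynomial (Fin n) 𝕜} (hp : p.totalDegree ≤ m)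
    (z y : Fin n → 𝕜) :
    MvPolynomial.eval (z + y) p = ∑ α ∈ multiIdx n m, MvPolynomial.eval z (polyD α p) *
        ∏ i, y i ^ α i / ((α i).factorial : 𝕜) := by
  have hD : ∀ α, polyD α p = ∑ s ∈ p.support, polyD α (MvPolynomial.monomial s (p.coeff s)) := by
    intro α
    conv_lhs => rw [p.as_sum]
    exact map_sum _ _ _
  conv_lhs => rw [p.as_sum]
  simp_rw [hD, map_sum, Finset.sum_mul]
  rw [Finset.sum_comm]
  exact Finset.sum_congr rfl fun s hs =>
    eval_add_monomial (mem_multiIdx_of_mem_support hp hs) _ _ _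

theorem norm_prod_pow_div_factorial_le {m : ℕ} {y : Fin n → ℂ} {r : ℝ} (hr : 1 ≤ r)
    (hy : ∀ i, ‖y i‖ ≤ r) {α : Fin n → ℕ} (hα : α ∈ multiIdx n m) :
    ‖∏ i, y i ^ α i / ((α i).factorial : ℂ)‖ ≤ r ^ m := by
  rw [norm_prod]
  calc ∏ i, ‖y i ^ α i / ((α i).factorial : ℂ)‖ ≤ ∏ i, r ^ α i := by
        refine Finset.prod_le_prod (fun _ _ => norm_nonneg _) fun i _ => ?_
        rw [norm_div, norm_pow, Complex.norm_natCast]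
        refine (div_le_self (by positivity) ?_).trans (pow_le_pow_left₀ (norm_nonneg _) (hy i) _)
        exact_mod_cast Nat.factorial_pos _
    _ = r ^ ∑ i, α i := Finset.prod_pow_eq_pow_sum _ _ _
    _ ≤ r ^ m := pow_le_pow_right₀ hr (mem_multiIdx.1 hα)

end Taylor

section Weight

variable {m : ℕ} {p : MvPolynomial (Fin n) ℂ}

theorem weight_nonneg (m : ℕ) (p : MvPolynomial (Fin n) ℂ) (ξ : Sp n) : 0 ≤ weight m p ξ :=
  Real.sqrt_nonneg _

theorem norm_eval_polyD_le_weight (p : MvPolynomial (Fin n) ℂ) (ξ : Sp n) {α : Fin n → ℕ}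
    (hα : α ∈ multiIdx n m) :
    ‖MvPolynomial.eval (fun i => (ξ i : ℂ)) (polyD α p)‖ ≤ weight m p ξ :=
  Real.le_sqrt_of_sq_le <| Finset.single_le_sum
    (f := fun α => ‖MvPolynomial.eval (fun i => (ξ i : ℂ)) (polyD α p)‖ ^ 2)
    (fun _ _ => sq_nonneg _) hα

theorem weight_le_sum (m : ℕ) (p : MvPolynomial (Fin n) ℂ) (ξ : Sp n) :
    weight m p ξ ≤
      ∑ α ∈ multiIdx n m, ‖MvPolynomial.eval (fun i => (ξ i : ℂ)) (polyD α p)‖ := by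
  rw [weight, Real.sqrt_le_left (Finset.sum_nonneg fun _ _ => norm_nonneg _)]
  exact Finset.sum_sq_le_sq_sum_of_nonneg fun _ _ => norm_nonneg _

theorem exists_forall_le_weight (hp : p.totalDegree ≤ m) (hp0 : p ≠ 0) :
    ∃ κ : ℝ, 0 < κ ∧ ∀ ξ, κ ≤ weight m p ξ := by
  obtain ⟨s, hs, hdeg⟩ := Finset.exists_mem_eq_sup p.support
    (MvPolynomial.support_nonempty.2 hp0) fun s => s.sum fun _ e => e
  have hdeg' : p.totalDegree = ∑ i, s i := by
    rw [MvPolynomial.totalDegree, hdeg, Finsupp.sum_fintype _ _ fun _ => rfl]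
  refine ⟨‖((∏ i, (s i).factorial : ℕ) : ℂ) * p.coeff s‖, ?_, fun ξ => ?_⟩
  · refine norm_pos_iff.2 (mul_ne_zero ?_ (MvPolynomial.mem_support_iff.1 hs))
    exact_mod_cast Finset.prod_ne_zero_iff.2 fun i _ => Nat.factorial_ne_zero _
  · have hle := norm_eval_polyD_le_weight p ξ (mem_multiIdx_of_mem_support hp hs)
    rwa [polyD_eq_C hdeg', MvPolynomial.eval_C] at hle

theorem norm_eval_polyD_le_weight_mul (hp : p.totalDegree ≤ m) (ξ η : Sp n) (β : Fin n → ℕ) :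
    ‖MvPolynomial.eval (fun i => (η i : ℂ)) (polyD β p)‖ ≤
      (multiIdx n m).card * ((1 + ‖η - ξ‖) ^ m * weight m p ξ) := by
  have hη : (fun i => (η i : ℂ)) = (fun i => (ξ i : ℂ)) + fun i => (((η - ξ) i : ℝ) : ℂ) := by
    ext i
    simp
  rw [hη, eval_add_eq_sum_polyD (totalDegree_polyD_le hp β), ← nsmul_eq_mul]
  refine (norm_sum_le _ _).trans (Finset.sum_le_card_nsmul _ _ _ fun α hα => ?_)
  rw [norm_mul, mul_comm]
  refine mul_le_mul ?_ ?_ (norm_nonneg _) (by positivity)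
  · refine norm_prod_pow_div_factorial_le (by linarith [norm_nonneg (η - ξ)]) (fun i => ?_) hα
    rw [Complex.norm_real]
    linarith [PiLp.norm_apply_le (η - ξ) i]
  · rw [polyD_polyD]
    by_cases hαβ : α + β ∈ multiIdx n m
    · exact norm_eval_polyD_le_weight p ξ hαβ
    · rw [mem_multiIdx, not_le] at hαβ
      rw [polyD_eq_zero hp hαβ, map_zero, norm_zero]
      exact weight_nonneg _ _ _

theorem weight_le_mul_weight (hp : p.totalDegree ≤ m) (ξ η : Sp n) :
    weight m p η ≤ ((multiIdx n m).card : ℝ) ^ 2 * (1 + ‖η - ξ‖) ^ m * weight m p ξ := by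
  refine (weight_le_sum m p η).trans ((Finset.sum_le_card_nsmul _ _ _ fun β _ =>
    norm_eval_polyD_le_weight_mul hp ξ η β).trans_eq ?_)
  rw [nsmul_eq_mul]
  ring

end Weight

/-! ### A measurable choice of circles avoiding the zeros of a polynomial -/

theorem exists_measurable_selection {X Y : Type*} [MeasurableSpace X] [MeasurableSpace Y]
    [Nonempty Y] (t : Finset Y) {S : X → Y → Prop} (hS : ∀ y, MeasurableSet {x | S x y}) :
    ∃ f : X → Y, Measurable f ∧ ∀ x, (∃ y ∈ t, S x y) → f x ∈ t ∧ S x (f x) := by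
  classical
  induction t using Finset.induction_on with
  | empty => exact ⟨fun _ => Classical.arbitrary Y, measurable_const, by simp⟩
  | insert y t _ ih =>
    obtain ⟨f, hf, hfS⟩ := ih
    refine ⟨fun x => if S x y then y else f x, measurable_const.ite (hS y) hf, fun x hx => ?_⟩
    by_cases hxy : S x y
    · simp [hxy]
    · rw [Finset.exists_mem_insert, or_iff_right hxy] at hx
      simp [hxy, hfS x hx]

theorem eval_aeval_C_mul_X {σ 𝕜 : Type*} [CommRing 𝕜] (p : MvPolynomial σ 𝕜) (y : σ → 𝕜) (z : 𝕜) :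
    (MvPolynomial.aeval (fun i => Polynomial.C (y i) * Polynomial.X) p).eval z =
      MvPolynomial.eval (z • y) p := by
  induction p using MvPolynomial.induction_on with
  | C a => simp
  | add p q hp hq => simp [hp, hq]
  | mul_X p i hp => simp [hp, mul_comm z]

/-- On a line on which `p` does not vanish identically, all but finitely many radii are good. -/
theorem exists_circle_eval_ne_zero {σ : Type*} [Fintype σ] {p : MvPolynomial σ ℂ} (hp : p ≠ 0)
    {ρ : ℝ} (hρ : 0 < ρ) :
    ∃ θ : σ → ℂ, ‖θ‖ ≤ ρ ∧ ∀ z : ℂ, ‖z‖ = 1 → MvPolynomial.eval (z • θ) p ≠ 0 := by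
  obtain ⟨y, hy⟩ : ∃ y, MvPolynomial.eval y p ≠ 0 := by
    by_contra! hzero
    exact hp (MvPolynomial.funext fun y => by simpa using hzero y)
  set q : Polynomial ℂ := MvPolynomial.aeval (fun i => Polynomial.C (y i) * Polynomial.X) p with hq
  have hq0 : q ≠ 0 := by
    intro hzero
    rw [← one_smul ℂ y, ← eval_aeval_C_mul_X, ← hq, hzero, Polynomial.eval_zero] at hy
    exact hy rfl
  obtain ⟨r, ⟨hr0, hrρ⟩, hr⟩ : (Set.Ioo 0 (ρ / (1 + ‖y‖)) \
      ((fun z : ℂ => ‖z‖) '' {z | q.IsRoot z})).Nonempty :=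
    ((Set.Ioo_infinite (by positivity)).sdiff
      ((Polynomial.finite_setOfPred_isRoot hq0).image _)).nonempty
  refine ⟨(r : ℂ) • y, ?_, fun z hz hzero => hr ⟨z * r, ?_, ?_⟩⟩
  · rw [norm_smul, Complex.norm_real, Real.norm_of_nonneg hr0.le]
    rw [lt_div_iff₀ (by positivity)] at hrρ
    nlinarith [norm_nonneg y]
  · change q.eval _ = 0
    rw [hq, eval_aeval_C_mul_X, mul_smul, hzero]
  · simp [hz, abs_of_pos hr0]

section Circle

variable {m : ℕ}

/-- The polynomial of degree at most `m` with Taylor coefficients `∂^α p(0) = a α`. -/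
def taylorPoly (a : multiIdx n m → ℂ) : MvPolynomial (Fin n) ℂ :=
  ∑ α : multiIdx n m, MvPolynomial.monomial (Finsupp.equivFunOnFinite.symm (α : Fin n → ℕ))
    (a α / ∏ i, (((α : Fin n → ℕ) i).factorial : ℂ))

theorem eval_taylorPoly (a : multiIdx n m → ℂ) (y : Fin n → ℂ) :
    MvPolynomial.eval y (taylorPoly a) =
      ∑ α, a α * ∏ i, y i ^ (α : Fin n → ℕ) i / (((α : Fin n → ℕ) i).factorial : ℂ) := by
  rw [taylorPoly, map_sum]
  refine Finset.sum_congr rfl fun α _ => ?_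
  rw [MvPolynomial.eval_monomial, Finsupp.prod_fintype _ _ fun _ => pow_zero _,
    Finset.prod_div_distrib]
  simp only [Finsupp.equivFunOnFinite_symm_apply_apply]
  ring

theorem eval_taylorPoly_smul (c : ℂ) (a : multiIdx n m → ℂ) (y : Fin n → ℂ) :
    MvPolynomial.eval y (taylorPoly (c • a)) = c * MvPolynomial.eval y (taylorPoly a) := by
  simp [eval_taylorPoly, Finset.mul_sum, mul_assoc]

theorem taylorPoly_ne_zero {a : multiIdx n m → ℂ} (ha : a ≠ 0) : taylorPoly a ≠ 0 := by
  classical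
  obtain ⟨α, hα⟩ := Function.ne_iff.1 ha
  refine MvPolynomial.ne_zero_iff.2 ⟨Finsupp.equivFunOnFinite.symm (α : Fin n → ℕ), ?_⟩
  rw [taylorPoly, MvPolynomial.coeff_sum, Finset.sum_eq_single α]
  · rw [MvPolynomial.coeff_monomial, if_pos rfl]
    refine div_ne_zero hα ?_
    exact_mod_cast Finset.prod_ne_zero_iff.2 fun i _ => Nat.factorial_ne_zero _
  · intro β _ hβ
    rw [MvPolynomial.coeff_monomial, if_neg]
    exact fun h => hβ (Subtype.ext (Finsupp.equivFunOnFinite.symm.injective h))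
  · simp

/-- The family `(∂^α p(ξ))_{|α| ≤ m}`: the weight of `p` at `ξ` is its Euclidean norm, while the
function type carries the equivalent sup norm. -/
def taylorCoeffs (m : ℕ) (p : MvPolynomial (Fin n) ℂ) (ξ : Sp n) (α : multiIdx n m) : ℂ :=
  MvPolynomial.eval (fun i => (ξ i : ℂ)) (polyD (α : Fin n → ℕ) p)

theorem continuous_taylorCoeffs (m : ℕ) (p : MvPolynomial (Fin n) ℂ) :
    Continuous (taylorCoeffs m p) :=
  continuous_pi fun _ => (MvPolynomial.continuous_eval _).comp (by fun_prop)

theorem eval_add_eq_eval_taylorPoly {p : MvPolynomial (Fin n) ℂ} (hp : p.totalDegree ≤ m)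
    (ξ : Sp n) (y : Fin n → ℂ) :
    MvPolynomial.eval ((fun i => (ξ i : ℂ)) + y) p =
      MvPolynomial.eval y (taylorPoly (taylorCoeffs m p ξ)) := by
  rw [eval_add_eq_sum_polyD hp, eval_taylorPoly, ← Finset.sum_coe_sort]
  rfl

theorem weight_le_card_mul_norm_taylorCoeffs (m : ℕ) (p : MvPolynomial (Fin n) ℂ) (ξ : Sp n) :
    weight m p ξ ≤ (multiIdx n m).card * ‖taylorCoeffs m p ξ‖ := by
  rw [← nsmul_eq_mul]
  exact (weight_le_sum m p ξ).trans <| Finset.sum_le_card_nsmul _ _ _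
    fun α hα => norm_le_pi_norm (taylorCoeffs m p ξ) ⟨α, hα⟩

theorem taylorCoeffs_ne_zero {p : MvPolynomial (Fin n) ℂ} (hp : p.totalDegree ≤ m) (hp0 : p ≠ 0)
    (ξ : Sp n) : taylorCoeffs m p ξ ≠ 0 := by
  obtain ⟨κ, hκ, hκ'⟩ := exists_forall_le_weight hp hp0
  have hpos := (hκ.trans_le (hκ' ξ)).trans_le (weight_le_card_mul_norm_taylorCoeffs m p ξ)
  exact norm_pos_iff.1 (pos_of_mul_pos_right hpos (Nat.cast_nonneg _))

theorem exists_circle_eventually_le {a : multiIdx n m → ℂ} (ha : a ≠ 0) {ρ : ℝ} (hρ : 0 < ρ) :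
    ∃ (θ : Fin n → ℂ) (c : ℝ), ‖θ‖ ≤ ρ ∧ 0 < c ∧ ∀ᶠ b in 𝓝 a, ∀ z ∈ Metric.sphere (0 : ℂ) 1,
      c ≤ ‖MvPolynomial.eval (z • θ) (taylorPoly b)‖ := by
  obtain ⟨θ, hθ, hne⟩ := exists_circle_eval_ne_zero (taylorPoly_ne_zero ha) hρ
  have hcont : Continuous fun w : (multiIdx n m → ℂ) × ℂ =>
      ‖MvPolynomial.eval (w.2 • θ) (taylorPoly w.1)‖ := by
    simp_rw [eval_taylorPoly]
    fun_prop
  obtain ⟨z₀, hz₀, hmin⟩ := (isCompact_sphere (0 : ℂ) 1).exists_isMinOn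
    (NormedSpace.sphere_nonempty.2 zero_le_one)
    (hcont.comp (Continuous.prodMk_right a)).continuousOn
  have hpos : 0 < ‖MvPolynomial.eval (z₀ • θ) (taylorPoly a)‖ :=
    norm_pos_iff.2 (hne z₀ (by simpa using hz₀))
  refine ⟨θ, _, hθ, half_pos hpos,
    (isCompact_sphere (0 : ℂ) 1).eventually_forall_of_forall_eventually fun z hz => ?_⟩
  exact (hcont.continuousAt (x := (a, z))).eventually_const_le
    ((half_lt_self hpos).trans_le (hmin hz))

theorem exists_finset_circle_of_isCompact {s : Set (multiIdx n m → ℂ)} (hs : IsCompact s)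
    (h0 : 0 ∉ s) {ρ : ℝ} (hρ : 0 < ρ) :
    ∃ (t : Finset (Fin n → ℂ)) (c : ℝ), 0 < c ∧ (∀ θ ∈ t, ‖θ‖ ≤ ρ) ∧
      ∀ a ∈ s, ∃ θ ∈ t, ∀ z ∈ Metric.sphere (0 : ℂ) 1,
        c ≤ ‖MvPolynomial.eval (z • θ) (taylorPoly a)‖ := by
  classical
  refine hs.induction_on (p := fun s => ∃ (t : Finset (Fin n → ℂ)) (c : ℝ), 0 < c ∧
    (∀ θ ∈ t, ‖θ‖ ≤ ρ) ∧ ∀ a ∈ s, ∃ θ ∈ t, ∀ z ∈ Metric.sphere (0 : ℂ) 1,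
      c ≤ ‖MvPolynomial.eval (z • θ) (taylorPoly a)‖) ?_ ?_ ?_ ?_
  · exact ⟨∅, 1, one_pos, by simp, by simp⟩
  · rintro s s' hss' ⟨t, c, hc, hρt, ht⟩
    exact ⟨t, c, hc, hρt, fun a ha => ht a (hss' ha)⟩
  · rintro s s' ⟨t, c, hc, hρt, ht⟩ ⟨t', c', hc', hρt', ht'⟩
    refine ⟨t ∪ t', min c c', lt_min hc hc', fun θ hθ =>
      (Finset.mem_union.1 hθ).elim (hρt θ) (hρt' θ), ?_⟩
    rintro a (ha | ha)
    · obtain ⟨θ, hθ, hz⟩ := ht a ha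
      exact ⟨θ, Finset.mem_union_left _ hθ, fun z h => (min_le_left _ _).trans (hz z h)⟩
    · obtain ⟨θ, hθ, hz⟩ := ht' a ha
      exact ⟨θ, Finset.mem_union_right _ hθ, fun z h => (min_le_right _ _).trans (hz z h)⟩
  · intro a ha
    obtain ⟨θ, c, hθ, hc, hev⟩ := exists_circle_eventually_le (ne_of_mem_of_not_mem ha h0) hρ
    exact ⟨_, mem_nhdsWithin_of_mem_nhds hev, {θ}, c, hc, by simpa using hθ,
      fun b hb => ⟨θ, Finset.mem_singleton_self θ, hb⟩⟩

theorem exists_finset_circle (n m : ℕ) {ρ : ℝ} (hρ : 0 < ρ) :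
    ∃ (t : Finset (Fin n → ℂ)) (c : ℝ), 0 < c ∧ (∀ θ ∈ t, ‖θ‖ ≤ ρ) ∧
      ∀ a : multiIdx n m → ℂ, a ≠ 0 → ∃ θ ∈ t, ∀ z : ℂ, ‖z‖ = 1 →
        c * ‖a‖ ≤ ‖MvPolynomial.eval (z • θ) (taylorPoly a)‖ := by
  obtain ⟨t, c, hc, hρt, ht⟩ := exists_finset_circle_of_isCompact
    (isCompact_sphere (0 : multiIdx n m → ℂ) 1) (by simp) hρ
  refine ⟨t, c, hc, hρt, fun a ha => ?_⟩
  obtain ⟨θ, hθ, hz⟩ := ht ((‖a‖ : ℂ)⁻¹ • a) (by simp [norm_smul, norm_ne_zero_iff.2 ha])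
  refine ⟨θ, hθ, fun z hz1 => ?_⟩
  have hle := hz z (by simpa using hz1)
  rwa [eval_taylorPoly_smul, norm_mul, norm_inv, Complex.norm_real, norm_norm, inv_mul_eq_div,
    le_div_iff₀ (norm_pos_iff.2 ha)] at hle

theorem exists_measurable_circle (n m : ℕ) {ρ : ℝ} (hρ : 0 < ρ) :
    ∃ c : ℝ, 0 < c ∧ ∀ p : MvPolynomial (Fin n) ℂ, p.totalDegree ≤ m → p ≠ 0 →
      ∃ θ : Sp n → Fin n → ℂ, Measurable θ ∧ (∀ ξ, ‖θ ξ‖ ≤ ρ) ∧ ∀ ξ (z : ℂ), ‖z‖ = 1 →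
        c * weight m p ξ ≤ ‖MvPolynomial.eval ((fun i => (ξ i : ℂ)) + z • θ ξ) p‖ := by
  obtain ⟨t, c, hc, hρt, ht⟩ := exists_finset_circle n m hρ
  have hcard : (0 : ℝ) < (multiIdx n m).card :=
    Nat.cast_pos.2 (Finset.card_pos.2 ⟨0, by simp [mem_multiIdx]⟩)
  refine ⟨c / (multiIdx n m).card, div_pos hc hcard, fun p hp hp0 => ?_⟩
  have hmeas (θ : Fin n → ℂ) : MeasurableSet {ξ | ∀ z : ℂ, ‖z‖ = 1 → c * ‖taylorCoeffs m p ξ‖ ≤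
      ‖MvPolynomial.eval ((fun i => (ξ i : ℂ)) + z • θ) p‖} := by
    simp only [Set.ofPred_forall]
    exact (isClosed_iInter fun z => isClosed_iInter fun _ => isClosed_le
      (continuous_const.mul (continuous_taylorCoeffs m p).norm)
      ((MvPolynomial.continuous_eval _).comp (by fun_prop)).norm).measurableSet
  obtain ⟨θ, hθ, hsel⟩ := exists_measurable_selection t hmeas
  have hspec (ξ) : θ ξ ∈ t ∧ ∀ z : ℂ, ‖z‖ = 1 → c * ‖taylorCoeffs m p ξ‖ ≤
      ‖MvPolynomial.eval ((fun i => (ξ i : ℂ)) + z • θ ξ) p‖ := by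
    refine hsel ξ ?_
    simp_rw [eval_add_eq_eval_taylorPoly hp]
    exact ht _ (taylorCoeffs_ne_zero hp hp0 ξ)
  refine ⟨θ, hθ, fun ξ => hρt _ (hspec ξ).1, fun ξ z hz => le_trans ?_ ((hspec ξ).2 z hz)⟩
  rw [div_mul_eq_mul_div, div_le_iff₀ hcard, mul_assoc, mul_comm ‖_‖]
  exact mul_le_mul_of_nonneg_left (weight_le_card_mul_norm_taylorCoeffs m p ξ) hc.le

end Circle

/-! ### The Fourier-Laplace transform of exponentially decaying functions -/

/-- The directional derivative along the `j`-th coordinate, of functions which unlike those acted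
on by `partialD` need not have compact support. -/
def dirD (j : Fin n) (f : Sp n → ℂ) : Sp n → ℂ :=
  fun x => fderiv ℝ f x (EuclideanSpace.single j (1 : ℝ))

theorem contDiff_dirD (j : Fin n) {f : Sp n → ℂ} (hf : ContDiff ℝ ∞ f) :
    ContDiff ℝ ∞ (dirD j f) :=
  (hf.fderiv_right (m := ∞) (by simp)).clm_apply contDiff_const

theorem contDiff_dirD_iterate (j : Fin n) {f : Sp n → ℂ} (hf : ContDiff ℝ ∞ f) (k : ℕ) :
    ContDiff ℝ ∞ ((dirD j)^[k] f) := by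
  induction k with
  | zero => exact hf
  | succ k ih =>
    rw [Function.iterate_succ_apply']
    exact contDiff_dirD j ih

/-- The bilinear pairing `x · z` of a real and a complex vector. -/
def pair (x : Sp n) (z : Fin n → ℂ) : ℂ := ∑ i, (x i : ℂ) * z i

theorem continuous_pair : Continuous fun q : Sp n × (Fin n → ℂ) => pair q.1 q.2 := by
  unfold pair
  fun_prop

theorem pair_add_right (x : Sp n) (z y : Fin n → ℂ) : pair x (z + y) = pair x z + pair x y := by
  simp [pair, mul_add, Finset.sum_add_distrib]

theorem pair_smul_right (x : Sp n) (c : ℂ) (z : Fin n → ℂ) : pair x (c • z) = c * pair x z := by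
  simp only [pair, Finset.mul_sum, Pi.smul_apply, smul_eq_mul]
  exact Finset.sum_congr rfl fun i _ => by ring

theorem pair_ofReal (x ξ : Sp n) : pair x (fun i => (ξ i : ℂ)) = (inner ℝ x ξ : ℝ) := by
  simp [pair, PiLp.inner_apply, mul_comm]

theorem norm_exp_pair_le {x : Sp n} {z : Fin n → ℂ} {ρ : ℝ} (hz : ∀ i, |(z i).im| ≤ ρ) :
    ‖Complex.exp (Complex.I * pair x z)‖ ≤ Real.exp (n * ρ * ‖x‖) := by
  have hre : (Complex.I * pair x z).re = ∑ i, -(x i * (z i).im) := by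
    simp [pair, Complex.mul_re]
  rw [Complex.norm_exp, Real.exp_le_exp, hre]
  refine (Finset.sum_le_card_nsmul _ _ (ρ * ‖x‖) fun i _ => ?_).trans_eq (by simp [mul_assoc])
  refine (neg_le_abs _).trans ?_
  rw [abs_mul, mul_comm]
  exact mul_le_mul (hz i) (PiLp.norm_apply_le x i) (abs_nonneg _) ((abs_nonneg _).trans (hz i))

theorem hasFDerivAt_exp_pair (z : Fin n → ℂ) (x : Sp n) :
    HasFDerivAt (fun x : Sp n => Complex.exp (Complex.I * pair x z))
      (Complex.exp (Complex.I * pair x z) • (Complex.I • ∑ i,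
        (Complex.ofRealCLM.comp (EuclideanSpace.proj i : Sp n →L[ℝ] ℝ)).smulRight (z i))) x := by
  set ℓ : Sp n →L[ℝ] ℂ :=
    ∑ i, (Complex.ofRealCLM.comp (EuclideanSpace.proj i : Sp n →L[ℝ] ℝ)).smulRight (z i)
  have hpair : (fun y : Sp n => pair y z) = ℓ := by
    ext y
    simp [pair, ℓ]
  have hℓ : HasFDerivAt (fun y : Sp n => pair y z) ℓ x := hpair ▸ ℓ.hasFDerivAt
  exact (hℓ.const_mul Complex.I).cexp

theorem dirD_exp_pair (j : Fin n) (z : Fin n → ℂ) (x : Sp n) :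
    dirD j (fun x : Sp n => Complex.exp (Complex.I * pair x z)) x =
      Complex.I * z j * Complex.exp (Complex.I * pair x z) := by
  rw [dirD, (hasFDerivAt_exp_pair z x).fderiv]
  simp only [smul_apply, sum_apply, ContinuousLinearMap.smulRight_apply,
    ContinuousLinearMap.comp_apply, PiLp.proj_apply, Complex.ofRealCLM_apply, smul_eq_mul]
  rw [Finset.sum_eq_single j (fun i _ hij => by simp [hij]) (by simp)]
  simp
  ring

section Integrable

variable {F : Type*} [NormedAddCommGroup F] [NormedSpace ℝ F] [FiniteDimensional ℝ F]
  [MeasurableSpace F] [BorelSpace F] (μ : Measure F) [μ.IsAddHaarMeasure]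

theorem integrable_one_add_norm_pow_inv {k : ℕ} (hk : Module.finrank ℝ F < k) :
    Integrable (fun x : F => ((1 + ‖x‖) ^ k)⁻¹) μ := by
  refine (integrable_one_add_norm (μ := μ) (r := k) (by exact_mod_cast hk)).congr
    (Eventually.of_forall fun x => ?_)
  simp only [Real.rpow_neg (add_nonneg zero_le_one (norm_nonneg x)), Real.rpow_natCast]

theorem integrable_exp_neg_norm {b : ℝ} (hb : 0 < b) :
    Integrable (fun x : F => Real.exp (-b * ‖x‖)) μ := by
  set k := Module.finrank ℝ F + 1
  refine ((integrable_one_add_norm_pow_inv μ (k := k) (Nat.lt_succ_self _)).const_mul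
    (Real.exp b * (k.factorial / b ^ k))).mono' (by fun_prop) (Eventually.of_forall fun x => ?_)
  have hexp : Real.exp (-b * ‖x‖) = Real.exp b * (Real.exp (b * (1 + ‖x‖)))⁻¹ := by
    rw [← Real.exp_neg, ← Real.exp_add]
    ring_nf
  rw [Real.norm_of_nonneg (Real.exp_pos _).le, hexp, mul_assoc]
  refine mul_le_mul_of_nonneg_left ?_ (Real.exp_pos _).le
  rw [inv_le_comm₀ (Real.exp_pos _) (by positivity)]
  refine le_trans (le_of_eq ?_)
    (Real.pow_div_factorial_le_exp (b * (1 + ‖x‖)) (by positivity) k)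
  rw [mul_pow]
  field_simp

end Integrable

/-- The integral of `e^{-b|x|}`, in terms of which Fourier-Laplace transforms are bounded. -/
def expInt (n : ℕ) (b : ℝ) : ℝ := ∫ x : Sp n, Real.exp (-b * ‖x‖)

theorem expInt_nonneg (n : ℕ) (b : ℝ) : 0 ≤ expInt n b :=
  integral_nonneg fun _ => (Real.exp_pos _).le

/-- The Fourier-Laplace transform `∫ e^{i x·z} f(x) dx`; the sign of the exponent is the one which
turns the transpose of `P(D)` into multiplication by `P(z)`. -/
def fourierLaplace (f : Sp n → ℂ) (z : Fin n → ℂ) : ℂ :=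
  ∫ x, Complex.exp (Complex.I * pair x z) * f x

section Decay

variable {f : Sp n → ℂ} {B a ρ : ℝ} {z : Fin n → ℂ}

theorem norm_exp_pair_mul_le (hB : ∀ x, ‖f x‖ ≤ B * Real.exp (-a * ‖x‖))
    (hz : ∀ i, |(z i).im| ≤ ρ) (x : Sp n) :
    ‖Complex.exp (Complex.I * pair x z) * f x‖ ≤ B * Real.exp (-(a - n * ρ) * ‖x‖) := by
  rw [norm_mul]
  refine (mul_le_mul (norm_exp_pair_le hz) (hB x) (norm_nonneg _) (Real.exp_pos _).le).trans_eq ?_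
  rw [mul_left_comm, ← Real.exp_add]
  ring_nf

theorem integrable_exp_pair_mul (hf : Continuous f) (hB : ∀ x, ‖f x‖ ≤ B * Real.exp (-a * ‖x‖))
    (hz : ∀ i, |(z i).im| ≤ ρ) (ha : n * ρ < a) :
    Integrable fun x => Complex.exp (Complex.I * pair x z) * f x := by
  refine ((integrable_exp_neg_norm volume (sub_pos.2 ha)).const_mul B).mono' ?_
    (Eventually.of_forall (norm_exp_pair_mul_le hB hz))
  have hpair : Continuous fun x : Sp n => pair x z :=
    continuous_pair.comp (continuous_id.prodMk continuous_const)
  exact ((Complex.continuous_exp.comp (continuous_const.mul hpair)).mul hf).aestronglyMeasurable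

theorem norm_fourierLaplace_le (hB : ∀ x, ‖f x‖ ≤ B * Real.exp (-a * ‖x‖))
    (hz : ∀ i, |(z i).im| ≤ ρ) (ha : n * ρ < a) :
    ‖fourierLaplace f z‖ ≤ B * expInt n (a - n * ρ) := by
  rw [expInt, ← integral_const_mul]
  exact norm_integral_le_of_norm_le ((integrable_exp_neg_norm volume (sub_pos.2 ha)).const_mul B)
    (Eventually.of_forall (norm_exp_pair_mul_le hB hz))

theorem fourierLaplace_dirD (hf : ContDiff ℝ ∞ f) (j : Fin n)
    (hB : ∀ x, ‖f x‖ ≤ B * Real.exp (-a * ‖x‖))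
    (hB' : ∀ x, ‖dirD j f x‖ ≤ B * Real.exp (-a * ‖x‖))
    (hz : ∀ i, |(z i).im| ≤ ρ) (ha : n * ρ < a) :
    fourierLaplace (dirD j f) z = -(Complex.I * z j) * fourierLaplace f z := by
  have hint := integrable_exp_pair_mul hf.continuous hB hz ha
  have hint' := integrable_exp_pair_mul (contDiff_dirD j hf).continuous hB' hz ha
  have hexp (x) : fderiv ℝ (fun x : Sp n => Complex.exp (Complex.I * pair x z)) x
      (EuclideanSpace.single j (1 : ℝ)) * f x =
      Complex.I * z j * (Complex.exp (Complex.I * pair x z) * f x) := by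
    rw [← mul_assoc, ← dirD_exp_pair, dirD]
  calc fourierLaplace (dirD j f) z
      = -∫ x, fderiv ℝ (fun x : Sp n => Complex.exp (Complex.I * pair x z)) x
          (EuclideanSpace.single j (1 : ℝ)) * f x :=
        integral_mul_fderiv_eq_neg_fderiv_mul_of_integrable
          (by simp_rw [hexp]; exact hint.const_mul _) hint' hint
          (fun x _ => (hasFDerivAt_exp_pair z x).differentiableAt)
          fun x _ => hf.differentiable (by simp) x
    _ = -(Complex.I * z j) * fourierLaplace f z := by
        simp_rw [hexp, integral_const_mul, neg_mul, fourierLaplace]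

/-- Smooth functions which are, together with their iterated derivatives of order at most `M` along
each coordinate axis, bounded by `B e^{-a|x|}`. The bound on the function itself is a separate
condition because there are no axes in dimension zero. -/
structure ExpDecay (M : ℕ) (B a : ℝ) (f : Sp n → ℂ) : Prop where
  contDiff : ContDiff ℝ ∞ f
  norm_le : ∀ x, ‖f x‖ ≤ B * Real.exp (-a * ‖x‖)
  norm_dirD_le : ∀ j, ∀ k ≤ M, ∀ x, ‖(dirD j)^[k] f x‖ ≤ B * Real.exp (-a * ‖x‖)

namespace ExpDecay

variable {M : ℕ}

theorem nonneg (hf : ExpDecay M B a f) : 0 ≤ B := by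
  simpa using (norm_nonneg _).trans (hf.norm_le 0)

theorem fourierLaplace_dirD_iterate (hf : ExpDecay M B a f) (j : Fin n) {k : ℕ} (hk : k ≤ M)
    (hz : ∀ i, |(z i).im| ≤ ρ) (ha : n * ρ < a) :
    fourierLaplace ((dirD j)^[k] f) z = (-(Complex.I * z j)) ^ k * fourierLaplace f z := by
  induction k with
  | zero => simp
  | succ k ih =>
    have hk' : k ≤ M := k.le_succ.trans hk
    have hnext := hf.norm_dirD_le j _ hk
    rw [Function.iterate_succ_apply'] at hnext ⊢
    rw [fourierLaplace_dirD (contDiff_dirD_iterate j hf.contDiff k) j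
      (hf.norm_dirD_le j k hk') hnext hz ha, ih hk', pow_succ', mul_assoc]

theorem norm_pow_mul_fourierLaplace_le (hf : ExpDecay M B a f) (j : Fin n)
    (hz : ∀ i, |(z i).im| ≤ ρ) (ha : n * ρ < a) :
    ‖z j‖ ^ M * ‖fourierLaplace f z‖ ≤ B * expInt n (a - n * ρ) := by
  have hle := norm_fourierLaplace_le (hf.norm_dirD_le j M le_rfl) hz ha
  rwa [hf.fourierLaplace_dirD_iterate j le_rfl hz ha, norm_mul, norm_pow, norm_neg, norm_mul,
    Complex.norm_I, one_mul] at hle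

theorem max_one_norm_pow_mul_fourierLaplace_le (hf : ExpDecay M B a f)
    (hz : ∀ i, |(z i).im| ≤ ρ) (ha : n * ρ < a) :
    max 1 ‖z‖ ^ M * ‖fourierLaplace f z‖ ≤ B * expInt n (a - n * ρ) := by
  rcases le_or_gt ‖z‖ 1 with hz1 | hz1
  · rw [max_eq_left hz1, one_pow, one_mul]
    exact norm_fourierLaplace_le hf.norm_le hz ha
  · have : Nonempty (Fin n) := by
      by_contra hempty
      rw [not_nonempty_iff] at hempty
      rw [Subsingleton.elim z 0, norm_zero] at hz1
      exact zero_lt_one.not_gt hz1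
    obtain ⟨j, hj⟩ := Finite.exists_max fun i => ‖z i‖
    have hzj : ‖z‖ = ‖z j‖ :=
      le_antisymm ((pi_norm_le_iff_of_nonempty z).2 hj) (norm_le_pi_norm z j)
    rw [max_eq_right hz1.le, hzj]
    exact hf.norm_pow_mul_fourierLaplace_le j hz ha

end ExpDecay

theorem one_add_norm_le_mul_max (ξ : Sp n) {ζ : Fin n → ℂ} (hζ : ‖ζ‖ ≤ ρ) :
    1 + ‖ξ‖ ≤ (1 + n * ρ + n) * max 1 ‖(fun i => (ξ i : ℂ)) + ζ‖ := by
  set z : Fin n → ℂ := (fun i => (ξ i : ℂ)) + ζ with hz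
  have hcoord (i) : ‖ξ i‖ ≤ ρ + ‖z‖ := by
    have hξ : (ξ i : ℂ) = z i - ζ i := by simp [hz]
    rw [← Complex.norm_real, hξ]
    linarith [norm_sub_le (z i) (ζ i), norm_le_pi_norm z i, (norm_le_pi_norm ζ i).trans hζ]
  have hξ : ‖ξ‖ ≤ n * (ρ + ‖z‖) := by
    calc ‖ξ‖ ≤ ∑ i, ‖ξ i‖ := by
          rw [EuclideanSpace.norm_eq,
            Real.sqrt_le_left (Finset.sum_nonneg fun _ _ => norm_nonneg _)]
          exact Finset.sum_sq_le_sq_sum_of_nonneg fun _ _ => norm_nonneg _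
      _ ≤ n * (ρ + ‖z‖) := by
          refine (Finset.sum_le_card_nsmul _ _ _ fun i _ => hcoord i).trans_eq ?_
          rw [nsmul_eq_mul, Finset.card_univ, Fintype.card_fin]
  have hρ : 0 ≤ (n : ℝ) * ρ := mul_nonneg n.cast_nonneg ((norm_nonneg _).trans hζ)
  calc 1 + ‖ξ‖ ≤ 1 + n * ρ + n * ‖z‖ := by linarith
    _ ≤ (1 + n * ρ) * max 1 ‖z‖ + n * max 1 ‖z‖ :=
        add_le_add (le_mul_of_one_le_right (by positivity) (le_max_left _ _))
          (mul_le_mul_of_nonneg_left (le_max_right _ _) n.cast_nonneg)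
    _ = (1 + n * ρ + n) * max 1 ‖z‖ := (add_mul _ _ _).symm

theorem abs_im_ofReal_add_le (ξ : Sp n) {ζ : Fin n → ℂ} (hζ : ‖ζ‖ ≤ ρ) (i : Fin n) :
    |(((fun i => (ξ i : ℂ)) + ζ) i).im| ≤ ρ := by
  simpa using (Complex.abs_im_le_norm _).trans ((norm_le_pi_norm ζ i).trans hζ)

theorem ExpDecay.one_add_norm_pow_mul_fourierLaplace_le {M : ℕ} (hf : ExpDecay M B a f)
    (ha : n * ρ < a) (ξ : Sp n) {ζ : Fin n → ℂ} (hζ : ‖ζ‖ ≤ ρ) :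
    (1 + ‖ξ‖) ^ M * ‖fourierLaplace f ((fun i => (ξ i : ℂ)) + ζ)‖ ≤
      (1 + n * ρ + n) ^ M * (B * expInt n (a - n * ρ)) := by
  have hρ : 0 ≤ ρ := (norm_nonneg _).trans hζ
  set z : Fin n → ℂ := (fun i => (ξ i : ℂ)) + ζ
  calc (1 + ‖ξ‖) ^ M * ‖fourierLaplace f z‖
      ≤ ((1 + n * ρ + n) * max 1 ‖z‖) ^ M * ‖fourierLaplace f z‖ :=
        mul_le_mul_of_nonneg_right (pow_le_pow_left₀ (by positivity)
          (one_add_norm_le_mul_max ξ hζ) _) (norm_nonneg _)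
    _ = (1 + n * ρ + n) ^ M * (max 1 ‖z‖ ^ M * ‖fourierLaplace f z‖) := by
        rw [mul_pow, mul_assoc]
    _ ≤ _ := mul_le_mul_of_nonneg_left
        (hf.max_one_norm_pow_mul_fourierLaplace_le (abs_im_ofReal_add_le ξ hζ) ha) (by positivity)

end Decay

/-! ### Derivatives of `1 / cosh(c|x|)` -/

/-- The entire function `w ↦ cosh √w = ∑ w^k / (2k)!`. -/
def coshSqrt : ℂ → ℂ :=
  FormalMultilinearSeries.ofScalarsSum fun k => ((2 * k).factorial : ℂ)⁻¹

theorem differentiable_coshSqrt : Differentiable ℂ coshSqrt := by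
  set p := FormalMultilinearSeries.ofScalars ℂ fun k => ((2 * k).factorial : ℂ)⁻¹
  have hrad : p.radius = ⊤ := by
    refine p.radius_eq_top_of_summable_norm fun r => ?_
    refine (Real.summable_pow_div_factorial r).of_nonneg_of_le (fun k => by positivity) fun k => ?_
    rw [FormalMultilinearSeries.ofScalars_norm, norm_inv, Complex.norm_natCast, inv_mul_eq_div]
    have hk : (k.factorial : ℝ) ≤ (2 * k).factorial :=
      Nat.cast_le.2 (Nat.factorial_le (Nat.le_mul_of_pos_left k two_pos))
    gcongr
  have hana := (p.hasFPowerSeriesOnBall (by rw [hrad]; exact ENNReal.zero_lt_top)).analyticOnNhd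
  rw [hrad, Metric.eball_top] at hana
  exact fun z => (hana z (Set.mem_univ z)).differentiableAt

theorem coshSqrt_sq (u : ℂ) : coshSqrt (u ^ 2) = Complex.cosh u := by
  rw [coshSqrt, FormalMultilinearSeries.ofScalars_sum_eq, Complex.cosh_eq_tsum]
  refine tsum_congr fun k => ?_
  rw [smul_eq_mul, ← pow_mul, inv_mul_eq_div]

theorem norm_cosh_sq (u : ℂ) :
    ‖Complex.cosh u‖ ^ 2 = Real.sinh u.re ^ 2 + Real.cos u.im ^ 2 := by
  have hcosh : Complex.cosh u = ((Real.cosh u.re * Real.cos u.im : ℝ) : ℂ) +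
      ((Real.sinh u.re * Real.sin u.im : ℝ) : ℂ) * Complex.I := by
    conv_lhs => rw [← Complex.re_add_im u, Complex.cosh_add, Complex.cosh_mul_I, Complex.sinh_mul_I]
    push_cast
    ring
  rw [← Complex.normSq_eq_norm_sq, hcosh, Complex.normSq_add_mul_I]
  nlinarith [Real.cosh_sq u.re, Real.sin_sq_add_cos_sq u.im]

theorem exp_abs_div_two_le_cosh (x : ℝ) : Real.exp |x| / 2 ≤ Real.cosh x := by
  rw [← Real.cosh_abs, Real.cosh_eq]
  linarith [Real.exp_pos (-|x|)]

theorem exp_abs_re_div_four_le_norm_cosh {u : ℂ} (hu : |u.im| ≤ Real.pi / 4) :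
    Real.exp |u.re| / 4 ≤ ‖Complex.cosh u‖ := by
  have hcos : 1 / 2 ≤ Real.cos u.im ^ 2 := by
    rw [Real.cos_sq]
    have hcos2 := Real.cos_nonneg_of_neg_pi_div_two_le_of_le (x := 2 * u.im)
      (by linarith [(abs_le.1 hu).1]) (by linarith [(abs_le.1 hu).2])
    linarith
  refine le_of_sq_le_sq ?_ (norm_nonneg _)
  rw [norm_cosh_sq]
  have hexp := pow_le_pow_left₀ (by positivity) (exp_abs_div_two_le_cosh u.re) 2
  nlinarith [Real.cosh_sq u.re]

section Quadratic

variable {s y : ℝ} {z u : ℂ}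

theorem abs_im_le_abs_im_of_sq_eq (hy : |y| ≤ s) (hu : u ^ 2 = s ^ 2 + 2 * y * z + z ^ 2) :
    |u.im| ≤ |z.im| := by
  have hre : u.re ^ 2 - u.im ^ 2 = s ^ 2 + 2 * y * z.re + z.re ^ 2 - z.im ^ 2 := by
    have := congrArg Complex.re hu
    simp [pow_two] at this
    linarith
  have him : u.re * u.im = (y + z.re) * z.im := by
    have := congrArg Complex.im hu
    simp [pow_two] at this
    linarith
  have hys : y ^ 2 ≤ s ^ 2 := sq_le_sq' (by linarith [neg_abs_le y]) ((le_abs_self y).trans hy)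
  by_contra! hlt
  have him_lt : z.im ^ 2 < u.im ^ 2 := sq_lt_sq.2 hlt
  have hre_lt : (y + z.re) ^ 2 < u.re ^ 2 := by nlinarith
  have hmul := mul_lt_mul'' hre_lt him_lt (sq_nonneg _) (sq_nonneg _)
  rw [← mul_pow, ← mul_pow, him] at hmul
  exact lt_irrefl _ hmul

theorem sub_abs_le_abs_re_of_sq_eq (hy : |y| ≤ s) (hu : u ^ 2 = s ^ 2 + 2 * y * z + z ^ 2) :
    s - |z.re| - |z.im| ≤ |u.re| := by
  have hre : u.re ^ 2 - u.im ^ 2 = s ^ 2 + 2 * y * z.re + z.re ^ 2 - z.im ^ 2 := by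
    have := congrArg Complex.re hu
    simp [pow_two] at this
    linarith
  have hcross : -(s * |z.re|) ≤ y * z.re := by
    refine le_trans ?_ (neg_abs_le _)
    rw [abs_mul]
    exact neg_le_neg (mul_le_mul_of_nonneg_right hy (abs_nonneg _))
  have hsq : (s - |z.re|) ^ 2 ≤ (|u.re| + |z.im|) ^ 2 := by
    nlinarith [sq_abs z.re, sq_abs u.re, sq_abs z.im, sq_nonneg u.im,
      mul_nonneg (abs_nonneg u.re) (abs_nonneg z.im)]
  linarith [(le_abs_self _).trans (abs_le_of_sq_le_sq hsq (by positivity))]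

theorem exp_div_four_le_norm_coshSqrt {c : ℝ} (hc : 0 < c) (hy : |y| ≤ s)
    (hz : |z.im| ≤ Real.pi / (4 * c)) :
    Real.exp (c * (s - |z.re| - |z.im|)) / 4 ≤
      ‖coshSqrt (c ^ 2 * (s ^ 2 + 2 * y * z + z ^ 2))‖ := by
  obtain ⟨u, hu⟩ := IsAlgClosed.exists_pow_nat_eq ((s : ℂ) ^ 2 + 2 * y * z + z ^ 2) two_pos
  rw [← hu, ← mul_pow, coshSqrt_sq]
  refine le_trans ?_ (exp_abs_re_div_four_le_norm_cosh (u := c * u) ?_)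
  · rw [Complex.re_ofReal_mul, abs_mul, abs_of_pos hc]
    have := mul_le_mul_of_nonneg_left (sub_abs_le_abs_re_of_sq_eq hy hu) hc.le
    gcongr
  · rw [Complex.im_ofReal_mul, abs_mul, abs_of_pos hc]
    calc c * |u.im| ≤ c * (Real.pi / (4 * c)) :=
          mul_le_mul_of_nonneg_left ((abs_im_le_abs_im_of_sq_eq hy hu).trans hz) hc.le
      _ = Real.pi / 4 := by field_simp

end Quadratic

/-- The function `1 / cosh(c|x|)`. -/
def sechNorm (n : ℕ) (c : ℝ) (x : Sp n) : ℂ := ((Real.cosh (c * ‖x‖) : ℝ) : ℂ)⁻¹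

theorem contDiff_sechNorm (c : ℝ) : ContDiff ℝ ∞ (sechNorm n c) := by
  refine ContDiff.inv (Complex.ofRealCLM.contDiff.comp (contDiff_cosh_norm c)) fun x => ?_
  exact_mod_cast (Real.cosh_pos _).ne'

theorem norm_sechNorm_le (c : ℝ) (x : Sp n) :
    ‖sechNorm n c x‖ ≤ 2 * Real.exp (-c * ‖x‖) := by
  have hcosh := exp_abs_div_two_le_cosh (c * ‖x‖)
  rw [sechNorm, norm_inv, Complex.norm_real, Real.norm_of_nonneg (Real.cosh_pos _).le]
  calc (Real.cosh (c * ‖x‖))⁻¹ ≤ (Real.exp (c * ‖x‖) / 2)⁻¹ :=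
        inv_anti₀ (by positivity) (le_trans (by gcongr; exact le_abs_self _) hcosh)
    _ = 2 * Real.exp (-c * ‖x‖) := by rw [inv_div, neg_mul, Real.exp_neg, div_eq_mul_inv]

theorem norm_add_smul_single_sq (x : Sp n) (j : Fin n) (t : ℝ) :
    ‖x + t • EuclideanSpace.single j (1 : ℝ)‖ ^ 2 = ‖x‖ ^ 2 + 2 * x j * t + t ^ 2 := by
  rw [norm_add_sq_real, norm_smul, inner_smul_right, EuclideanSpace.inner_single_right]
  simp
  ring

/-- The holomorphic extension of `t ↦ 1 / cosh(c|x + t e_j|)` to the strip `|Im z| ≤ π / (4c)`, on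
which the denominator has no zeros. -/
def sechLine (c : ℝ) (j : Fin n) (x : Sp n) (z : ℂ) : ℂ :=
  (coshSqrt (c ^ 2 * ((‖x‖ : ℂ) ^ 2 + 2 * (x j : ℂ) * z + z ^ 2)))⁻¹

section SechLine

variable {c : ℝ}

theorem sechLine_ofReal (c : ℝ) (j : Fin n) (x : Sp n) (t : ℝ) :
    sechLine c j x t = sechNorm n c (x + t • EuclideanSpace.single j (1 : ℝ)) := by
  have hsq : (‖x‖ : ℂ) ^ 2 + 2 * (x j : ℂ) * t + (t : ℂ) ^ 2 =
      (‖x + t • EuclideanSpace.single j (1 : ℝ)‖ : ℂ) ^ 2 := by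
    exact_mod_cast (norm_add_smul_single_sq x j t).symm
  rw [sechLine, hsq, ← mul_pow, coshSqrt_sq, sechNorm, Complex.ofReal_cosh, Complex.ofReal_mul]

theorem sechLine_add_smul_single (c : ℝ) (j : Fin n) (x : Sp n) (t : ℝ) :
    sechLine c j (x + t • EuclideanSpace.single j (1 : ℝ)) = fun z => sechLine c j x (z + t) := by
  funext z
  simp only [sechLine, ← Complex.ofReal_pow, norm_add_smul_single_sq]
  congr 3
  simp
  ring

theorem differentiableAt_sechLine (hc : 0 < c) (j : Fin n) (x : Sp n) {z : ℂ}
    (hz : |z.im| ≤ Real.pi / (4 * c)) : DifferentiableAt ℂ (sechLine c j x) z := by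
  have hlow := exp_div_four_le_norm_coshSqrt hc (PiLp.norm_apply_le x j) hz
  refine DifferentiableAt.inv (differentiable_coshSqrt.differentiableAt.comp z (by fun_prop)) ?_
  exact norm_pos_iff.1 (lt_of_lt_of_le (by positivity) hlow)

theorem norm_sechLine_le (hc : 0 < c) (j : Fin n) (x : Sp n) {z : ℂ}
    (hz : ‖z‖ ≤ Real.pi / (4 * c)) :
    ‖sechLine c j x z‖ ≤ 4 * Real.exp (Real.pi / 2) * Real.exp (-c * ‖x‖) := by
  have hlow := exp_div_four_le_norm_coshSqrt hc (PiLp.norm_apply_le x j)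
    ((Complex.abs_im_le_norm z).trans hz)
  have hexp : c * ‖x‖ - Real.pi / 2 ≤ c * (‖x‖ - |z.re| - |z.im|) := by
    have hr : c * (2 * (Real.pi / (4 * c))) = Real.pi / 2 := by field_simp; ring
    nlinarith [Complex.abs_im_le_norm z, Complex.abs_re_le_norm z]
  rw [sechLine, norm_inv]
  calc _ ≤ (Real.exp (c * ‖x‖ - Real.pi / 2) / 4)⁻¹ :=
        inv_anti₀ (by positivity) (le_trans (by gcongr) hlow)
    _ = 4 * Real.exp (Real.pi / 2) * Real.exp (-c * ‖x‖) := by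
        rw [inv_div, mul_assoc, ← Real.exp_add, div_eq_mul_inv, ← Real.exp_neg]
        ring_nf

theorem differentiableAt_iteratedDeriv_sechLine (hc : 0 < c) (j : Fin n) (x : Sp n) (k : ℕ) :
    DifferentiableAt ℂ (iteratedDeriv k (sechLine c j x)) 0 := by
  have hopen : IsOpen {z : ℂ | |z.im| < Real.pi / (4 * c)} :=
    isOpen_lt (continuous_abs.comp Complex.continuous_im) continuous_const
  have hana : AnalyticAt ℂ (sechLine c j x) 0 :=
    DifferentiableOn.analyticAt (fun z (hz : |z.im| < _) =>
      (differentiableAt_sechLine hc j x hz.le).differentiableWithinAt)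
      (hopen.mem_nhds (by simpa using by positivity))
  rw [iteratedDeriv_eq_iterate]
  exact (hana.iterated_deriv k).differentiableAt

theorem dirD_iterate_sechNorm (hc : 0 < c) (j : Fin n) (k : ℕ) (x : Sp n) :
    (dirD j)^[k] (sechNorm n c) x = iteratedDeriv k (sechLine c j x) 0 := by
  induction k generalizing x with
  | zero => simpa using (sechLine_ofReal c j x 0).symm
  | succ k ih =>
    have hline : (fun t : ℝ => (dirD j)^[k] (sechNorm n c)
        (x + t • EuclideanSpace.single j (1 : ℝ))) =
        fun t : ℝ => iteratedDeriv k (sechLine c j x) (t : ℂ) := by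
      funext t
      rw [ih, sechLine_add_smul_single, iteratedDeriv_comp_add_const]
      simp only [zero_add]
    have hreal : HasDerivAt (fun t : ℝ => (dirD j)^[k] (sechNorm n c)
        (x + t • EuclideanSpace.single j (1 : ℝ))) (dirD j ((dirD j)^[k] (sechNorm n c)) x) 0 :=
      ((contDiff_dirD_iterate j (contDiff_sechNorm c) k).differentiable
        (by simp) x).hasFDerivAt.hasLineDerivAt _
    have hcomplex : HasDerivAt (fun t : ℝ => iteratedDeriv k (sechLine c j x) (t : ℂ))
        (deriv (iteratedDeriv k (sechLine c j x)) ((0 : ℝ) : ℂ)) 0 :=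
      HasDerivAt.comp_ofReal
        (by simpa using (differentiableAt_iteratedDeriv_sechLine hc j x k).hasDerivAt)
    rw [hline] at hreal
    rw [Function.iterate_succ_apply', hreal.unique hcomplex, iteratedDeriv_succ,
      Complex.ofReal_zero]

/-- Cauchy's estimates on discs of radius `π / (4c)`. -/
theorem norm_dirD_iterate_sechNorm_le (hc : 0 < c) (j : Fin n) (k : ℕ) (x : Sp n) :
    ‖(dirD j)^[k] (sechNorm n c) x‖ ≤
      k.factorial * (4 * Real.exp (Real.pi / 2)) / (Real.pi / (4 * c)) ^ k *
        Real.exp (-c * ‖x‖) := by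
  have hle := Complex.norm_iteratedDeriv_le_of_forall_mem_sphere_norm_le (c := (0 : ℂ)) k
    (by positivity : 0 < Real.pi / (4 * c))
    (DifferentiableOn.diffContOnCl fun z hz => (differentiableAt_sechLine hc j x
      ((Complex.abs_im_le_norm z).trans (mem_closedBall_zero_iff.1
        (Metric.closure_ball_subset_closedBall hz)))).differentiableWithinAt)
    fun z hz => norm_sechLine_le hc j x (mem_sphere_zero_iff_norm.1 hz).le
  rw [dirD_iterate_sechNorm hc]
  exact hle.trans_eq (by ring)

theorem exists_expDecay_sechNorm (n : ℕ) (hc : 0 < c) (M : ℕ) :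
    ∃ B : ℝ, ExpDecay M B c (sechNorm n c) := by
  set b : ℕ → ℝ := fun k => k.factorial * (4 * Real.exp (Real.pi / 2)) / (Real.pi / (4 * c)) ^ k
  have hb (k) : 0 ≤ b k := by positivity
  refine ⟨2 + ∑ k ∈ Finset.range (M + 1), b k, contDiff_sechNorm c,
    fun x => (norm_sechNorm_le c x).trans ?_,
    fun j k hk x => (norm_dirD_iterate_sechNorm_le hc j k x).trans ?_⟩
  · gcongr
    exact le_add_of_nonneg_right (Finset.sum_nonneg fun k _ => hb k)
  · gcongr
    exact (Finset.single_le_sum (f := b) (fun k _ => hb k)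
      (Finset.mem_range.2 (Nat.lt_succ_of_le hk))).trans (le_add_of_nonneg_left zero_le_two)

end SechLine

/-! ### The Fourier-Laplace transform of test functions -/

theorem dirD_test (j : Fin n) (f : Test n) : dirD j f = partialD j f :=
  funext fun x => (partialD_eq_fderiv j f x).symm

theorem dirD_iterate_test (j : Fin n) (f : Test n) (k : ℕ) :
    (dirD j)^[k] f = wordD (List.replicate k j) f := by
  induction k with
  | zero => rfl
  | succ k ih => rw [Function.iterate_succ_apply', ih, dirD_test, List.replicate_succ, wordD_cons]

theorem exists_norm_wordD_le_exp {K : Set (Sp n)} (hK : IsCompact K) (a : ℝ) :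
    ∃ A : ℝ, 0 ≤ A ∧ ∀ (M : ℕ) (f : Test n), tsupport f ⊆ K → ∀ w : List (Fin n),
      w.length ≤ M → ∀ x, ‖wordD w f x‖ ≤ A * semi K M f * Real.exp (-a * ‖x‖) := by
  obtain ⟨A, hA⟩ := hK.bddAbove_image (f := fun x : Sp n => Real.exp (a * ‖x‖)) (by fun_prop)
  refine ⟨max A 0, le_max_right _ _, fun M f hf w hw x => ?_⟩
  by_cases hx : x ∈ K
  · have hexp : 1 ≤ max A 0 * Real.exp (-a * ‖x‖) := by
      have hle : Real.exp (a * ‖x‖) ≤ max A 0 := (hA ⟨x, hx, rfl⟩).trans (le_max_left _ _)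
      rwa [neg_mul, Real.exp_neg, ← div_eq_mul_inv, one_le_div (Real.exp_pos _)]
    calc ‖wordD w f x‖ ≤ semi K M f := le_semi f hw hx
      _ ≤ semi K M f * (max A 0 * Real.exp (-a * ‖x‖)) :=
        le_mul_of_one_le_right (semi_nonneg K M f) hexp
      _ = max A 0 * semi K M f * Real.exp (-a * ‖x‖) := by ring
  · rw [image_eq_zero_of_notMem_tsupport fun h => hx (hf (tsupport_wordD w f h)), norm_zero]
    exact mul_nonneg (mul_nonneg (le_max_right _ _) (semi_nonneg _ _ _)) (Real.exp_pos _).le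

theorem exists_expDecay_test {K : Set (Sp n)} (hK : IsCompact K) (a : ℝ) :
    ∃ A : ℝ, 0 ≤ A ∧ ∀ (M : ℕ) (f : Test n), tsupport f ⊆ K →
      ExpDecay M (A * semi K M f) a f := by
  obtain ⟨A, hA0, hA⟩ := exists_norm_wordD_le_exp hK a
  refine ⟨A, hA0, fun M f hf => ⟨f.contDiff, hA M f hf [] (Nat.zero_le _), fun j k hk x => ?_⟩⟩
  rw [dirD_iterate_test]
  exact hA M f hf _ (by simpa using hk) x

theorem exists_expDecay (f : Test n) (M : ℕ) (a : ℝ) : ∃ B, ExpDecay M B a f := by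
  obtain ⟨A, -, hA⟩ := exists_expDecay_test f.hasCompactSupport a
  exact ⟨_, hA M f le_rfl⟩

theorem abs_im_apply_le_norm (z : Fin n → ℂ) (i : Fin n) : |(z i).im| ≤ ‖z‖ :=
  (Complex.abs_im_le_norm _).trans (norm_le_pi_norm z i)

theorem fourierLaplace_partialD (f : Test n) (j : Fin n) (z : Fin n → ℂ) :
    fourierLaplace (partialD j f) z = -(Complex.I * z j) * fourierLaplace f z := by
  obtain ⟨B, hB⟩ := exists_expDecay f 1 (n * ‖z‖ + 1)
  rw [← dirD_test]
  exact fourierLaplace_dirD f.contDiff j hB.norm_le (hB.norm_dirD_le j 1 le_rfl)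
    (abs_im_apply_le_norm z) (lt_add_one _)

theorem integrable_exp_pair_mul_test (f : Test n) (z : Fin n → ℂ) :
    Integrable fun x => Complex.exp (Complex.I * pair x z) * f x := by
  obtain ⟨B, hB⟩ := exists_expDecay f 0 (n * ‖z‖ + 1)
  exact integrable_exp_pair_mul f.continuous hB.norm_le (abs_im_apply_le_norm z) (lt_add_one _)

theorem measurable_fourierLaplace {f : Sp n → ℂ} (hf : Continuous f) :
    Measurable (fourierLaplace f) := by
  have hcont : Continuous fun q : (Fin n → ℂ) × Sp n =>
      Complex.exp (Complex.I * pair q.2 q.1) * f q.2 :=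
    (Complex.continuous_exp.comp (continuous_const.mul (continuous_pair.comp continuous_swap))).mul
      (hf.comp continuous_snd)
  exact (hcont.stronglyMeasurable.integral_prod_right' (ν := volume)).measurable

/-- The Fourier-Laplace transform at `z` as a linear functional on test functions. -/
def fourierLaplaceLM (z : Fin n → ℂ) : Test n →ₗ[ℂ] ℂ where
  toFun f := fourierLaplace f z
  map_add' f g := by
    simp only [fourierLaplace]
    rw [← integral_add (integrable_exp_pair_mul_test f z) (integrable_exp_pair_mul_test g z)]
    exact integral_congr_ae (Eventually.of_forall fun x => mul_add _ _ _)
  map_smul' c f := by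
    simp only [fourierLaplace, RingHom.id_apply, smul_eq_mul]
    rw [← integral_const_mul]
    exact integral_congr_ae (Eventually.of_forall fun x => mul_left_comm _ _ _)

theorem fourierLaplaceLM_apply (z : Fin n → ℂ) (f : Test n) :
    fourierLaplaceLM z f = fourierLaplace f z :=
  rfl

/-- The operator `D_i = -i ∂_i` on test functions. -/
def testD (i : Fin n) : Module.End ℂ (Test n) := (-Complex.I) • partialD i

/-- The operator `D^α` on test functions. -/
def testDpow (α : Fin n →₀ ℕ) : Module.End ℂ (Test n) :=
  ((List.finRange n).map fun i => testD i ^ α i).prod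

/-- The transpose `p(-D)` of `p(D)`, for a polynomial `p` of degree at most `m`, written as a sum
over all multi-indices of length at most `m`. -/
def testTranspose (m : ℕ) (p : MvPolynomial (Fin n) ℂ) : Module.End ℂ (Test n) :=
  ∑ α ∈ multiIdx n m, (p.coeff (Finsupp.equivFunOnFinite.symm α) * (-1) ^ ∑ i, α i) •
    testDpow (Finsupp.equivFunOnFinite.symm α)

theorem fourierLaplaceLM_testD (z : Fin n → ℂ) (i : Fin n) (f : Test n) :
    fourierLaplaceLM z (testD i f) = -z i * fourierLaplaceLM z f := by
  rw [testD, LinearMap.smul_apply, map_smul, fourierLaplaceLM_apply, fourierLaplace_partialD,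
    fourierLaplaceLM_apply, smul_eq_mul]
  linear_combination (z i * fourierLaplace f z) * Complex.I_mul_I

theorem fourierLaplaceLM_testD_pow (z : Fin n → ℂ) (i : Fin n) (k : ℕ) (f : Test n) :
    fourierLaplaceLM z ((testD i ^ k) f) = (-z i) ^ k * fourierLaplaceLM z f := by
  induction k with
  | zero => simp
  | succ k ih =>
    rw [pow_succ', Module.End.mul_apply, fourierLaplaceLM_testD, ih, pow_succ', mul_assoc]

theorem fourierLaplaceLM_testDpow (z : Fin n → ℂ) (α : Fin n →₀ ℕ) (f : Test n) :
    fourierLaplaceLM z (testDpow α f) = (∏ i, (-z i) ^ α i) * fourierLaplaceLM z f := by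
  have hlist (l : List (Fin n)) : fourierLaplaceLM z ((l.map fun i => testD i ^ α i).prod f) =
      (l.map fun i => (-z i) ^ α i).prod * fourierLaplaceLM z f := by
    induction l with
    | nil => simp
    | cons i l ih =>
      rw [List.map_cons, List.prod_cons, Module.End.mul_apply, fourierLaplaceLM_testD_pow, ih,
        List.map_cons, List.prod_cons, mul_assoc]
  rw [testDpow, hlist, ← List.ofFn_eq_map, List.prod_ofFn]

theorem fourierLaplace_testTranspose {m : ℕ} {p : MvPolynomial (Fin n) ℂ} (hp : p.totalDegree ≤ m)
    (f : Test n) (z : Fin n → ℂ) :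
    fourierLaplace (testTranspose m p f) z = MvPolynomial.eval z p * fourierLaplace f z := by
  rw [← fourierLaplaceLM_apply, ← fourierLaplaceLM_apply, testTranspose, LinearMap.sum_apply,
    map_sum, eval_eq_sum_multiIdx hp, Finset.sum_mul]
  refine Finset.sum_congr rfl fun α _ => ?_
  have hprod : (-1) ^ (∑ i, α i) * ∏ i, (-z i) ^ α i = ∏ i, z i ^ α i := by
    rw [← Finset.prod_pow_eq_pow_sum, ← Finset.prod_mul_distrib]
    exact Finset.prod_congr rfl fun i _ => by rw [← mul_pow, neg_one_mul, neg_neg]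
  rw [LinearMap.smul_apply, map_smul, smul_eq_mul, fourierLaplaceLM_testDpow, ← hprod]
  simp only [Finsupp.equivFunOnFinite_symm_apply_apply]
  ring

/-! ### Mean value property and Fourier inversion -/

/-- The normalized measure on the parameters of the unit circle, as a measure so that circle
averages can be combined with Fubini's theorem. -/
def circleMeasure : Measure ℝ :=
  ENNReal.ofReal (2 * Real.pi)⁻¹ • volume.restrict (Set.Ioc 0 (2 * Real.pi))

instance : IsProbabilityMeasure circleMeasure where
  measure_univ := by
    rw [circleMeasure, Measure.smul_apply, Measure.restrict_apply_univ, Real.volume_Ioc, sub_zero,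
      smul_eq_mul, ← ENNReal.ofReal_mul (by positivity), inv_mul_cancel₀ (by positivity),
      ENNReal.ofReal_one]

theorem integral_circleMeasure (F : ℂ → ℂ) :
    ∫ t, F (circleMap 0 1 t) ∂circleMeasure = Real.circleAverage F 0 1 := by
  rw [circleMeasure, integral_smul_measure, Real.circleAverage_def,
    intervalIntegral.integral_of_le (by positivity), ENNReal.toReal_ofReal (by positivity)]

theorem integral_exp_pair_circle (x : Sp n) (z θ : Fin n → ℂ) :
    ∫ t, Complex.exp (Complex.I * pair x (z + circleMap 0 1 t • θ)) ∂circleMeasure =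
      Complex.exp (Complex.I * pair x z) := by
  have hentire : Differentiable ℂ fun w : ℂ => Complex.exp (Complex.I * pair x (z + w • θ)) := by
    simp_rw [pair_add_right, pair_smul_right]
    fun_prop
  rw [integral_circleMeasure fun w => Complex.exp (Complex.I * pair x (z + w • θ)),
    hentire.diffContOnCl.circleAverage, zero_smul, add_zero]

theorem integral_fourierLaplace_circle {f : Sp n → ℂ} (hf : Continuous f) {B a ρ : ℝ}
    (hB : ∀ x, ‖f x‖ ≤ B * Real.exp (-a * ‖x‖)) {z θ : Fin n → ℂ}
    (hz : ∀ t : ℝ, ∀ i, |((z + circleMap 0 1 t • θ) i).im| ≤ ρ) (ha : n * ρ < a) :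
    ∫ t, fourierLaplace f (z + circleMap 0 1 t • θ) ∂circleMeasure = fourierLaplace f z := by
  have hpair : Continuous fun y : ℝ × Sp n => pair y.2 (z + circleMap 0 1 y.1 • θ) :=
    continuous_pair.comp (continuous_snd.prodMk (continuous_const.add
      (((continuous_circleMap 0 1).comp continuous_fst).smul continuous_const)))
  have hint : Integrable (fun y : ℝ × Sp n =>
      Complex.exp (Complex.I * pair y.2 (z + circleMap 0 1 y.1 • θ)) * f y.2)
      (circleMeasure.prod volume) :=
    (((integrable_exp_neg_norm volume (sub_pos.2 ha)).const_mul B).comp_snd circleMeasure).mono'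
      (((Complex.continuous_exp.comp (continuous_const.mul hpair)).mul
        (hf.comp continuous_snd)).aestronglyMeasurable)
      (Eventually.of_forall fun y => norm_exp_pair_mul_le hB (hz y.1) y.2)
  unfold fourierLaplace
  rw [integral_integral_swap hint]
  simp_rw [integral_mul_const, integral_exp_pair_circle]

theorem fourierLaplace_ofReal (f : Test n) (ξ : Sp n) :
    fourierLaplace f (fun i => (ξ i : ℂ)) =
      hat (f.hasCompactSupport.toSchwartzMap f.contDiff) (-ξ) := by
  rw [hat_apply, fourierLaplace]
  refine integral_congr_ae (Eventually.of_forall fun x => ?_)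
  simp only [pair_ofReal, inner_neg_left, real_inner_comm]
  push_cast
  rw [neg_mul_neg]
  rfl

theorem integral_hat (φ : 𝓢(Sp n, ℂ)) : ∫ ξ, hat φ (-ξ) = (2 * Real.pi) ^ n * φ 0 := by
  have hinv : ∫ ξ, (𝓕 φ) ξ = (𝓕⁻ (𝓕 φ)) 0 := by
    rw [SchwartzMap.fourierInv_coe, Real.fourierInv_eq']
    simp
  rw [integral_neg_eq_self fun ξ => hat φ ξ]
  change ∫ ξ, (𝓕 φ) ((2 * Real.pi)⁻¹ • ξ) = _
  rw [Measure.integral_comp_inv_smul_of_nonneg _ _ (by positivity), finrank_euclideanSpace_fin,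
    hinv, FourierTransform.fourierInv_fourier_eq, Complex.real_smul]
  push_cast
  rfl

theorem integral_fourierLaplace (f : Test n) :
    ∫ ξ : Sp n, fourierLaplace f (fun i => (ξ i : ℂ)) = (2 * Real.pi) ^ n * f 0 := by
  simp_rw [fourierLaplace_ofReal]
  exact integral_hat _

/-! ### The fundamental solution of a polynomial -/

/-- A measurable family of circles `ξ + {|z| = 1} θ(ξ)` of radius at most `ρ` on which `|p|` is
bounded below by `c` times the weight of `p` at the centre `ξ`: the paths over which the
fundamental solution of `p(D)` is integrated. -/
structure IsCircleChoice (m : ℕ) (p : MvPolynomial (Fin n) ℂ) (ρ c : ℝ)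
    (θ : Sp n → Fin n → ℂ) : Prop where
  totalDegree_le : p.totalDegree ≤ m
  ne_zero : p ≠ 0
  pos : 0 < c
  measurable : Measurable θ
  norm_le : ∀ ξ, ‖θ ξ‖ ≤ ρ
  le_norm_eval : ∀ ξ (z : ℂ), ‖z‖ = 1 →
    c * weight m p ξ ≤ ‖MvPolynomial.eval ((fun i => (ξ i : ℂ)) + z • θ ξ) p‖

/-- The point `ξ + e^{it}θ(ξ)` on the circle chosen for `ξ`. -/
def node (θ : Sp n → Fin n → ℂ) (y : Sp n × ℝ) : Fin n → ℂ :=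
  (fun i => (y.1 i : ℂ)) + circleMap 0 1 y.2 • θ y.1

theorem measurable_node {θ : Sp n → Fin n → ℂ} (hθ : Measurable θ) : Measurable (node θ) := by
  have hcenter : Measurable fun y : Sp n × ℝ => (fun i => (y.1 i : ℂ) : Fin n → ℂ) :=
    Continuous.measurable (by fun_prop)
  have hcircle : Measurable fun y : Sp n × ℝ => circleMap 0 1 y.2 :=
    (continuous_circleMap 0 1).measurable.comp measurable_snd
  exact hcenter.add (hcircle.smul (hθ.comp measurable_fst))

theorem node_sub (θ : Sp n → Fin n → ℂ) (y : Sp n × ℝ) (η : Sp n) :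
    (node θ y - fun i => (η i : ℂ)) =
      (fun i => ((y.1 - η) i : ℂ)) + circleMap 0 1 y.2 • θ y.1 := by
  ext i
  simp [node]
  ring

/-- The measure `dξ dt / 2π` over which the fundamental solution is an integral. -/
abbrev nodeMeasure (n : ℕ) : Measure (Sp n × ℝ) := (volume : Measure (Sp n)).prod circleMeasure

/-- The integral of `(1 + |ξ|)^{-n-1}`. -/
def japInt (n : ℕ) : ℝ := ∫ ξ : Sp n, ((1 + ‖ξ‖) ^ (n + 1))⁻¹

theorem integrable_node_japanese (η : Sp n) :
    Integrable (fun y : Sp n × ℝ => ((1 + ‖y.1 - η‖) ^ (n + 1))⁻¹) (nodeMeasure n) :=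
  ((integrable_one_add_norm_pow_inv volume (by simp)).comp_sub_right η).comp_fst circleMeasure

theorem integral_node_japanese (η : Sp n) :
    ∫ y, ((1 + ‖y.1 - η‖) ^ (n + 1))⁻¹ ∂nodeMeasure n = japInt n := by
  rw [integral_prod _ (integrable_node_japanese η)]
  simp only [integral_const, probReal_univ, one_smul]
  exact integral_sub_right_eq_self (fun ξ : Sp n => ((1 + ‖ξ‖) ^ (n + 1))⁻¹) η

theorem norm_integral_node_le {G : Sp n × ℝ → ℂ} {A : ℝ} (η : Sp n)
    (hG : ∀ y, ‖G y‖ ≤ A * ((1 + ‖y.1 - η‖) ^ (n + 1))⁻¹) :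
    ‖∫ y, G y ∂nodeMeasure n‖ ≤ A * japInt n := by
  rw [← integral_node_japanese η, ← integral_const_mul]
  exact norm_integral_le_of_norm_le ((integrable_node_japanese η).const_mul A)
    (Eventually.of_forall hG)

/-- The constant in the bound of `F(ζ - η) / p(ζ)` along the nodes `ζ`, for Fourier-Laplace
transforms `F` of functions which decay like `e^{-a|x|}`. -/
def quotConst (n m : ℕ) (ρ c a : ℝ) : ℝ :=
  (1 + n * ρ + n) ^ (m + n + 1) * expInt n (a - n * ρ) * ((multiIdx n m).card : ℝ) ^ 2 / c

theorem quotConst_nonneg {ρ c : ℝ} (hρ : 0 ≤ ρ) (hc : 0 ≤ c) (n m : ℕ) (a : ℝ) :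
    0 ≤ quotConst n m ρ c a :=
  div_nonneg (mul_nonneg (mul_nonneg (by positivity) (expInt_nonneg _ _)) (by positivity)) hc

namespace IsCircleChoice

variable {m : ℕ} {p : MvPolynomial (Fin n) ℂ} {ρ c : ℝ} {θ : Sp n → Fin n → ℂ}

theorem weight_pos (h : IsCircleChoice m p ρ c θ) (ξ : Sp n) : 0 < weight m p ξ := by
  obtain ⟨κ, hκ, hle⟩ := exists_forall_le_weight h.totalDegree_le h.ne_zero
  exact hκ.trans_le (hle ξ)

theorem le_norm_eval_node (h : IsCircleChoice m p ρ c θ) (y : Sp n × ℝ) :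
    c * weight m p y.1 ≤ ‖MvPolynomial.eval (node θ y) p‖ :=
  h.le_norm_eval y.1 _ (by simp)

theorem eval_node_ne_zero (h : IsCircleChoice m p ρ c θ) (y : Sp n × ℝ) :
    MvPolynomial.eval (node θ y) p ≠ 0 :=
  norm_pos_iff.1 ((mul_pos h.pos (h.weight_pos _)).trans_le (h.le_norm_eval_node y))

theorem norm_circleMap_smul_le (h : IsCircleChoice m p ρ c θ) (y : Sp n × ℝ) :
    ‖circleMap 0 1 y.2 • θ y.1‖ ≤ ρ := by
  rw [norm_smul, norm_circleMap_zero, abs_one, one_mul]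
  exact h.norm_le _

theorem measurable_eval_node (h : IsCircleChoice m p ρ c θ) :
    Measurable fun y => MvPolynomial.eval (node θ y) p :=
  (MvPolynomial.continuous_eval p).measurable.comp (measurable_node h.measurable)

theorem inv_norm_eval_node_le (h : IsCircleChoice m p ρ c θ) (η : Sp n) (y : Sp n × ℝ) :
    ‖MvPolynomial.eval (node θ y) p‖⁻¹ ≤
      ((multiIdx n m).card : ℝ) ^ 2 * (1 + ‖y.1 - η‖) ^ m / (c * weight m p η) := by
  rw [inv_eq_one_div, div_le_div_iff₀ (norm_pos_iff.2 (h.eval_node_ne_zero y))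
    (mul_pos h.pos (h.weight_pos η)), one_mul, norm_sub_rev]
  calc c * weight m p η
      ≤ c * (((multiIdx n m).card : ℝ) ^ 2 * (1 + ‖η - y.1‖) ^ m * weight m p y.1) :=
        mul_le_mul_of_nonneg_left (weight_le_mul_weight h.totalDegree_le y.1 η) h.pos.le
    _ = ((multiIdx n m).card : ℝ) ^ 2 * (1 + ‖η - y.1‖) ^ m * (c * weight m p y.1) := by ring
    _ ≤ _ := mul_le_mul_of_nonneg_left (h.le_norm_eval_node y) (by positivity)

theorem norm_quot_le (h : IsCircleChoice m p ρ c θ) {f : Sp n → ℂ} {B a : ℝ}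
    (hf : ExpDecay (m + n + 1) B a f) (ha : n * ρ < a) (η : Sp n) (y : Sp n × ℝ) :
    ‖fourierLaplace f (node θ y - fun i => (η i : ℂ)) / MvPolynomial.eval (node θ y) p‖ ≤
      (B * quotConst n m ρ c a / weight m p η) * ((1 + ‖y.1 - η‖) ^ (n + 1))⁻¹ := by
  have hs : 0 < 1 + ‖y.1 - η‖ := by positivity
  have hdecay := hf.one_add_norm_pow_mul_fourierLaplace_le ha (y.1 - η) (h.norm_circleMap_smul_le y)
  rw [← node_sub, mul_comm, ← le_div_iff₀ (by positivity)] at hdecay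
  rw [norm_div, div_eq_mul_inv]
  refine (mul_le_mul hdecay (h.inv_norm_eval_node_le η y) (by positivity)
    ((norm_nonneg _).trans hdecay)).trans_eq ?_
  have hc := h.pos
  have hη := h.weight_pos η
  rw [quotConst, add_assoc m, pow_add (1 + ‖y.1 - η‖) m]
  field_simp

theorem integrable_quot (h : IsCircleChoice m p ρ c θ) {f : Sp n → ℂ} {B a : ℝ}
    (hf : ExpDecay (m + n + 1) B a f) (ha : n * ρ < a) (η : Sp n) :
    Integrable (fun y => fourierLaplace f (node θ y - fun i => (η i : ℂ)) /
      MvPolynomial.eval (node θ y) p) (nodeMeasure n) :=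
  ((integrable_node_japanese η).const_mul _).mono'
    (((measurable_fourierLaplace hf.contDiff.continuous).comp
      ((measurable_node h.measurable).sub_const _)).div h.measurable_eval_node).aestronglyMeasurable
    (Eventually.of_forall (h.norm_quot_le hf ha η))

theorem integrable_quot_test (h : IsCircleChoice m p ρ c θ) (f : Test n) :
    Integrable (fun y => fourierLaplace f (node θ y) / MvPolynomial.eval (node θ y) p)
      (nodeMeasure n) := by
  obtain ⟨B, hB⟩ := exists_expDecay f (m + n + 1) (n * ρ + 1)
  simpa [← Pi.zero_def] using h.integrable_quot hB (lt_add_one _) 0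

end IsCircleChoice

/-- The functional `f ↦ (2π)^{-n} ∫ F(ξ + e^{it}θ(ξ)) / p(ξ + e^{it}θ(ξ)) dξ dt/2π`, where `F` is
the Fourier-Laplace transform of `f`. -/
def solFun (p : MvPolynomial (Fin n) ℂ) (θ : Sp n → Fin n → ℂ) (f : Test n) : ℂ :=
  ((2 * Real.pi) ^ n : ℂ)⁻¹ *
    ∫ y, fourierLaplace f (node θ y) / MvPolynomial.eval (node θ y) p ∂nodeMeasure n

theorem norm_two_pi_pow_inv (n : ℕ) :
    ‖((2 * Real.pi) ^ n : ℂ)⁻¹‖ = ((2 * Real.pi) ^ n)⁻¹ := by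
  rw [norm_inv, norm_pow, norm_mul, Complex.norm_real, Complex.norm_ofNat,
    Real.norm_of_nonneg Real.pi_pos.le]

theorem exists_norm_solFun_le (m : ℕ) (ρ c : ℝ) (ξ₀ : Sp n) {K : Set (Sp n)}
    (hK : IsCompact K) : ∃ C : ℝ, ∀ p θ, IsCircleChoice m p ρ c θ → ∀ f : Test n, tsupport f ⊆ K →
      ‖solFun p θ f‖ ≤ C / weight m p ξ₀ * semi K (m + n + 1) f := by
  obtain ⟨A, hA0, hA⟩ := exists_expDecay_test hK (n * ρ + 1)
  set k : ℝ := ((multiIdx n m).card : ℝ) ^ 2 * (1 + ‖ξ₀ - 0‖) ^ m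
  set q := quotConst n m ρ c (n * ρ + 1)
  refine ⟨((2 * Real.pi) ^ n)⁻¹ * (A * q * k * japInt n), fun p θ h f hf => ?_⟩
  set s := semi K (m + n + 1) f
  have hquot (y) : ‖fourierLaplace f (node θ y) / MvPolynomial.eval (node θ y) p‖ ≤
      A * s * q / weight m p 0 * ((1 + ‖y.1 - 0‖) ^ (n + 1))⁻¹ := by
    simpa [← Pi.zero_def] using h.norm_quot_le (hA _ f hf) (lt_add_one _) 0 y
  have hweight : 1 / weight m p 0 ≤ k / weight m p ξ₀ := by
    rw [div_le_div_iff₀ (h.weight_pos _) (h.weight_pos _), one_mul]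
    exact weight_le_mul_weight h.totalDegree_le 0 ξ₀
  have hq : 0 ≤ q := quotConst_nonneg ((norm_nonneg _).trans (h.norm_le 0)) h.pos.le _ _ _
  have hJ : 0 ≤ japInt n := integral_nonneg fun _ => by positivity
  have hs : 0 ≤ s := semi_nonneg _ _ _
  calc ‖solFun p θ f‖ ≤ ((2 * Real.pi) ^ n)⁻¹ * (A * s * q / weight m p 0 * japInt n) := by
        rw [solFun, norm_mul, norm_two_pi_pow_inv]
        exact mul_le_mul_of_nonneg_left (norm_integral_node_le 0 hquot) (by positivity)
    _ = ((2 * Real.pi) ^ n)⁻¹ * (A * s * q * (1 / weight m p 0) * japInt n) := by ring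
    _ ≤ ((2 * Real.pi) ^ n)⁻¹ * (A * s * q * (k / weight m p ξ₀) * japInt n) := by gcongr
    _ = _ := by ring

theorem continuous_partialD (i : Fin n) : Continuous (partialD i : Test n → Test n) :=
  (TestFunction.lineDerivCLM ℂ (EuclideanSpace.single i (1 : ℝ)) : Test n →L[ℂ] Test n).continuous

theorem continuous_wordD (w : List (Fin n)) : Continuous (wordD w : Test n → Test n) := by
  induction w with
  | nil => exact continuous_id
  | cons i w ih =>
    rw [funext (wordD_cons i w)]
    exact (continuous_partialD i).comp ih

theorem exists_continuous_semi_le (n j : ℕ) : ∃ Q : Test n → ℝ, Continuous Q ∧ Q 0 = 0 ∧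
    ∀ K f, semi K j f ≤ Q f := by
  set S := (List.finite_length_le (Fin n) j).toFinset
  set toBCF := TestFunction.toBoundedContinuousFunctionCLM ℂ (Ω := (⊤ : Opens (Sp n)))
    (F := ℂ) (n := ⊤)
  refine ⟨fun f => ∑ w ∈ S, ‖toBCF (wordD w f)‖, continuous_finsetSum _ fun w _ =>
    (toBCF.continuous.comp (continuous_wordD w)).norm, by simp, fun K f => ?_⟩
  refine semi_le (Finset.sum_nonneg fun _ _ => norm_nonneg _) fun w hw x _ => ?_
  calc ‖wordD w f x‖ ≤ ‖toBCF (wordD w f)‖ := (toBCF (wordD w f)).norm_coe_le_norm x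
    _ ≤ ∑ w ∈ S, ‖toBCF (wordD w f)‖ :=
      Finset.single_le_sum (f := fun w => ‖toBCF (wordD w f)‖) (fun _ _ => norm_nonneg _)
        (by simpa [S] using hw)

theorem continuous_of_norm_le_semi (T : Test n →ₗ[ℂ] ℂ)
    (hT : ∀ K : Set (Sp n), IsCompact K → ∃ (C : ℝ) (j : ℕ), ∀ f : Test n, tsupport f ⊆ K →
      ‖T f‖ ≤ C * semi K j f) : Continuous T := by
  rw [TestFunction.continuous_iff_continuous_comp]
  intro K hKΩ
  obtain ⟨C, j, hC⟩ := hT K K.isCompact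
  obtain ⟨Q, hQ, hQ0, hle⟩ := exists_continuous_semi_le n j
  set incl := TestFunction.ofSupportedInCLM ℂ (F := ℂ) (n := ⊤) hKΩ
  have hTQ (f) : ‖T (incl f)‖ ≤ |C| * Q (incl f) :=
    (hC _ f.tsupport_subset).trans (mul_le_mul (le_abs_self C) (hle K _) (semi_nonneg _ _ _)
      (abs_nonneg _))
  have hlim : Tendsto (fun f => |C| * Q (incl f)) (𝓝 0) (𝓝 0) := by
    have hcont : Continuous fun f => |C| * Q (incl f) :=
      continuous_const.mul (hQ.comp incl.continuous)
    simpa only [map_zero, hQ0, mul_zero] using hcont.tendsto 0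
  change Continuous (T ∘ₗ incl.toLinearMap)
  refine continuous_of_continuousAt_zero _ ?_
  rw [ContinuousAt, map_zero]
  exact squeeze_zero_norm hTQ hlim

namespace IsCircleChoice

variable {m : ℕ} {p : MvPolynomial (Fin n) ℂ} {ρ c : ℝ} {θ : Sp n → Fin n → ℂ}

/-- The fundamental solution `solFun p θ` of `p(D)` as a distribution. -/
def solDistr (h : IsCircleChoice m p ρ c θ) : Distr n :=
  let T : Test n →ₗ[ℂ] ℂ :=
    { toFun := solFun p θ
      map_add' := fun f g => by
        rw [solFun, solFun, solFun, ← mul_add, ← integral_add (h.integrable_quot_test f)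
          (h.integrable_quot_test g)]
        simp_rw [← fourierLaplaceLM_apply, map_add, add_div]
      map_smul' := fun a f => by
        simp_rw [solFun, ← fourierLaplaceLM_apply, map_smul, smul_eq_mul, mul_div_assoc,
          integral_const_mul, RingHom.id_apply, mul_left_comm] }
  ⟨T, continuous_of_norm_le_semi T fun _ hK =>
    let ⟨C, hC⟩ := exists_norm_solFun_le m ρ c 0 hK
    ⟨C / weight m p 0, m + n + 1, fun f hf => hC p θ h f hf⟩⟩

theorem solDistr_apply (h : IsCircleChoice m p ρ c θ) (f : Test n) : h.solDistr f = solFun p θ f :=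
  rfl

theorem integral_fourierLaplace_node (h : IsCircleChoice m p ρ c θ) (f : Test n) (ξ : Sp n) :
    ∫ t, fourierLaplace f (node θ (ξ, t)) ∂circleMeasure =
      fourierLaplace f fun i => (ξ i : ℂ) := by
  obtain ⟨B, hB⟩ := exists_expDecay f 0 (n * ρ + 1)
  have hstrip (t : ℝ) := abs_im_ofReal_add_le ξ (h.norm_circleMap_smul_le (ξ, t))
  simp only [node]
  exact integral_fourierLaplace_circle f.continuous hB.norm_le hstrip (lt_add_one _)

theorem solDistr_transpose (h : IsCircleChoice m p ρ c θ) (f : Test n) :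
    h.solDistr (testTranspose m p f) = f 0 := by
  have hcancel (y) : fourierLaplace (testTranspose m p f) (node θ y) /
      MvPolynomial.eval (node θ y) p = fourierLaplace f (node θ y) := by
    rw [fourierLaplace_testTranspose h.totalDegree_le,
      mul_div_cancel_left₀ _ (h.eval_node_ne_zero y)]
  have hint := h.integrable_quot_test (testTranspose m p f)
  rw [solDistr_apply, solFun]
  simp_rw [hcancel] at hint ⊢
  rw [integral_prod _ hint]
  simp_rw [h.integral_fourierLaplace_node]
  rw [integral_fourierLaplace, inv_mul_cancel_left₀]
  simp [Real.pi_ne_zero]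

end IsCircleChoice

/-! ### The quotient of the fundamental solution by `cosh(c|x|)` -/

/-- The map `φ ↦ φ(r ·)` on the Schwartz space. -/
def dilate (n : ℕ) {r : ℝ} (hr : r ≠ 0) : 𝓢(Sp n, ℂ) →L[ℂ] 𝓢(Sp n, ℂ) :=
  SchwartzMap.compCLMOfContinuousLinearEquiv ℂ (ContinuousLinearEquiv.smulLeft (Units.mk0 r hr))

theorem dilate_dilate {r s : ℝ} (hr : r ≠ 0) (hs : s ≠ 0) (hrs : s * r = 1) (φ : 𝓢(Sp n, ℂ)) :
    dilate n hr (dilate n hs φ) = φ := by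
  ext x
  change φ (s • r • x) = φ x
  rw [smul_smul, hrs, one_smul]

theorem hat_eq_dilate (φ : 𝓢(Sp n, ℂ)) :
    hat φ = dilate n (inv_ne_zero Real.two_pi_pos.ne') (𝓕 φ) :=
  rfl

/-- The inverse of the Fourier transform `hat` on the Schwartz space. -/
def hatInv (n : ℕ) : 𝓢(Sp n, ℂ) →L[ℂ] 𝓢(Sp n, ℂ) :=
  FourierTransform.fourierInvCLM ℂ 𝓢(Sp n, ℂ) ∘L dilate n Real.two_pi_pos.ne'

theorem hatInv_apply (φ : 𝓢(Sp n, ℂ)) : hatInv n φ = 𝓕⁻ (dilate n Real.two_pi_pos.ne' φ) :=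
  rfl

theorem hatInv_hat (φ : 𝓢(Sp n, ℂ)) : hatInv n (hat φ) = φ := by
  rw [hatInv_apply, hat_eq_dilate, dilate_dilate _ _ (inv_mul_cancel₀ Real.two_pi_pos.ne'),
    FourierTransform.fourierInv_fourier_eq]

theorem hat_hatInv (φ : 𝓢(Sp n, ℂ)) : hat (hatInv n φ) = φ := by
  rw [hatInv_apply, hat_eq_dilate, FourierTransform.fourier_fourierInv_eq,
    dilate_dilate _ _ (mul_inv_cancel₀ Real.two_pi_pos.ne')]

theorem exists_tempered_of_bounded {g : Sp n → ℂ} (hg : StronglyMeasurable g) {A : ℝ}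
    (hA : ∀ η, ‖g η‖ ≤ A) :
    ∃ w : 𝓢'(Sp n, ℂ), ∀ φ : 𝓢(Sp n, ℂ), w (hat φ) = ∫ ξ, g ξ * φ ξ := by
  have hmem : MemLp g ⊤ := memLp_top_of_bound hg.aestronglyMeasurable A (Eventually.of_forall hA)
  refine ⟨PointwiseConvergenceCLM.precomp ℂ (hatInv n) (Lp.toTemperedDistribution hmem.toLp),
    fun φ => ?_⟩
  change Lp.toTemperedDistribution hmem.toLp (hatInv n (hat φ)) = _
  rw [hatInv_hat, Lp.toTemperedDistribution_apply]
  refine integral_congr_ae ?_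
  filter_upwards [hmem.coeFn_toLp] with x hx
  rw [hx, smul_eq_mul, mul_comm]

theorem exp_pair_sub_ofReal (x η : Sp n) (z : Fin n → ℂ) :
    Complex.exp (Complex.I * pair x (z - fun i => (η i : ℂ))) =
      Complex.exp (-Complex.I * inner ℝ x η) * Complex.exp (Complex.I * pair x z) := by
  have hpair : pair x (z - fun i => (η i : ℂ)) = pair x z - (inner ℝ x η : ℝ) := by
    rw [← pair_ofReal, eq_sub_iff_add_eq, ← pair_add_right, sub_add_cancel]
  rw [hpair, ← Complex.exp_add]
  ring_nf

section FourierLaplaceMul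

variable {q : Sp n → ℂ} {B a ρ : ℝ} {z : Fin n → ℂ}

theorem integrable_mul_exp_pair_sub_mul (hq : Continuous q)
    (hB : ∀ x, ‖q x‖ ≤ B * Real.exp (-a * ‖x‖)) (hz : ∀ i, |(z i).im| ≤ ρ) (ha : n * ρ < a)
    {φ : Sp n → ℂ} (hφ : Integrable φ) :
    Integrable (fun y : Sp n × Sp n => φ y.2 *
      (Complex.exp (Complex.I * pair y.1 (z - fun i => (y.2 i : ℂ))) * q y.1)) := by
  have hpair : Continuous fun y : Sp n × Sp n => pair y.1 (z - fun i => (y.2 i : ℂ)) :=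
    continuous_pair.comp (continuous_fst.prodMk (by fun_prop))
  refine ((integrable_exp_pair_mul hq hB hz ha).norm.mul_prod hφ.norm).mono'
    (hφ.aestronglyMeasurable.comp_snd.mul ((Complex.continuous_exp.comp
      (continuous_const.mul hpair)).mul (hq.comp continuous_fst)).aestronglyMeasurable)
    (Eventually.of_forall fun y => le_of_eq ?_)
  have hphase : ‖Complex.exp (-Complex.I * inner ℝ y.1 y.2)‖ = 1 := by simp [Complex.norm_exp]
  rw [exp_pair_sub_ofReal, norm_mul, norm_mul, norm_mul, hphase, one_mul, norm_mul, mul_comm]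

theorem fourierLaplace_hat_mul (hq : Continuous q)
    (hB : ∀ x, ‖q x‖ ≤ B * Real.exp (-a * ‖x‖)) (hz : ∀ i, |(z i).im| ≤ ρ) (ha : n * ρ < a)
    (φ : 𝓢(Sp n, ℂ)) :
    fourierLaplace (fun x => hat φ x * q x) z =
      ∫ η : Sp n, φ η * fourierLaplace q (z - fun i => (η i : ℂ)) := by
  have hinner (x : Sp n) : Complex.exp (Complex.I * pair x z) * (hat φ x * q x) =
      ∫ η : Sp n, φ η * (Complex.exp (Complex.I * pair x (z - fun i => (η i : ℂ))) * q x) := by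
    rw [hat_apply, mul_left_comm, ← integral_mul_const]
    refine integral_congr_ae (Eventually.of_forall fun η => ?_)
    simp only [exp_pair_sub_ofReal]
    ring
  rw [fourierLaplace]
  simp_rw [hinner]
  rw [integral_integral_swap
    (integrable_mul_exp_pair_sub_mul hq hB hz ha (φ.integrable (μ := volume)))]
  simp_rw [integral_const_mul, fourierLaplace]

end FourierLaplaceMul

/-- The Fourier transform of the product of the fundamental solution and `q`. -/
def solHat (p : MvPolynomial (Fin n) ℂ) (θ : Sp n → Fin n → ℂ) (q : Sp n → ℂ) (η : Sp n) : ℂ :=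
  ((2 * Real.pi) ^ n : ℂ)⁻¹ * ∫ y, fourierLaplace q (node θ y - fun i => (η i : ℂ)) /
    MvPolynomial.eval (node θ y) p ∂nodeMeasure n

namespace IsCircleChoice

variable {m : ℕ} {p : MvPolynomial (Fin n) ℂ} {ρ c : ℝ} {θ : Sp n → Fin n → ℂ} {q : Sp n → ℂ}
  {B a : ℝ}

theorem measurable_quot (h : IsCircleChoice m p ρ c θ) (hq : Continuous q) :
    Measurable fun x : Sp n × (Sp n × ℝ) =>
      fourierLaplace q (node θ x.2 - fun i => (x.1 i : ℂ)) / MvPolynomial.eval (node θ x.2) p := by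
  have hfst : Measurable fun x : Sp n × (Sp n × ℝ) => (fun i => (x.1 i : ℂ) : Fin n → ℂ) :=
    Continuous.measurable (by fun_prop)
  exact ((measurable_fourierLaplace hq).comp
    (((measurable_node h.measurable).comp measurable_snd).sub hfst)).div
      (h.measurable_eval_node.comp measurable_snd)

theorem stronglyMeasurable_solHat (h : IsCircleChoice m p ρ c θ) (hq : Continuous q) :
    StronglyMeasurable (solHat p θ q) :=
  stronglyMeasurable_const.mul
    ((h.measurable_quot hq).stronglyMeasurable.integral_prod_right' (ν := nodeMeasure n))

theorem weight_mul_norm_solHat_le (h : IsCircleChoice m p ρ c θ)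
    (hq : ExpDecay (m + n + 1) B a q) (ha : n * ρ < a) (η : Sp n) :
    weight m p η * ‖solHat p θ q η‖ ≤
      ((2 * Real.pi) ^ n)⁻¹ * (B * quotConst n m ρ c a * japInt n) := by
  have hη := h.weight_pos η
  calc weight m p η * ‖solHat p θ q η‖
      ≤ weight m p η * (((2 * Real.pi) ^ n)⁻¹ *
          (B * quotConst n m ρ c a / weight m p η * japInt n)) := by
        rw [solHat, norm_mul, norm_two_pi_pow_inv]
        gcongr
        exact norm_integral_node_le η (h.norm_quot_le hq ha η)
    _ = _ := by field_simp

theorem exists_norm_solHat_le (h : IsCircleChoice m p ρ c θ)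
    (hq : ExpDecay (m + n + 1) B a q) (ha : n * ρ < a) : ∃ A, ∀ η, ‖solHat p θ q η‖ ≤ A := by
  obtain ⟨κ, hκ, hle⟩ := exists_forall_le_weight h.totalDegree_le h.ne_zero
  exact ⟨_, fun η => (le_div_iff₀' hκ).2 ((mul_le_mul_of_nonneg_right (hle η)
    (norm_nonneg _)).trans (h.weight_mul_norm_solHat_le hq ha η))⟩

theorem exists_norm_quot_le (h : IsCircleChoice m p ρ c θ)
    (hq : ExpDecay (m + n + 1) B a q) (ha : n * ρ < a) : ∃ D, ∀ (η : Sp n) (y : Sp n × ℝ),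
      ‖fourierLaplace q (node θ y - fun i => (η i : ℂ)) / MvPolynomial.eval (node θ y) p‖ ≤
        D * ((1 + ‖y.1 - η‖) ^ (n + 1))⁻¹ := by
  obtain ⟨κ, hκ, hle⟩ := exists_forall_le_weight h.totalDegree_le h.ne_zero
  have hconst : 0 ≤ B * quotConst n m ρ c a :=
    mul_nonneg hq.nonneg
      (quotConst_nonneg ((norm_nonneg _).trans (h.norm_le 0)) h.pos.le _ _ _)
  exact ⟨_, fun η y => (h.norm_quot_le hq ha η y).trans (mul_le_mul_of_nonneg_right
    (div_le_div_of_nonneg_left hconst hκ (hle η)) (by positivity))⟩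

theorem integrable_mul_quot (h : IsCircleChoice m p ρ c θ) (hq : ExpDecay (m + n + 1) B a q)
    (ha : n * ρ < a) {φ : Sp n → ℂ} (hφ : Integrable φ) :
    Integrable (fun x : Sp n × (Sp n × ℝ) =>
      φ x.1 * (fourierLaplace q (node θ x.2 - fun i => (x.1 i : ℂ)) /
        MvPolynomial.eval (node θ x.2) p)) (volume.prod (nodeMeasure n)) := by
  obtain ⟨D, hD⟩ := h.exists_norm_quot_le hq ha
  have hmeas : AEStronglyMeasurable (fun x : Sp n × (Sp n × ℝ) =>
      φ x.1 * (fourierLaplace q (node θ x.2 - fun i => (x.1 i : ℂ)) /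
        MvPolynomial.eval (node θ x.2) p)) (volume.prod (nodeMeasure n)) :=
    hφ.aestronglyMeasurable.comp_fst.mul
      (h.measurable_quot hq.contDiff.continuous).aestronglyMeasurable
  have hquot (η) := h.integrable_quot hq ha η
  rw [integrable_prod_iff hmeas]
  refine ⟨Eventually.of_forall fun η => (hquot η).const_mul (φ η), ?_⟩
  refine (hφ.norm.mul_const (D * japInt n)).mono' hmeas.norm.integral_prod_right'
    (Eventually.of_forall fun η => ?_)
  rw [Real.norm_of_nonneg (integral_nonneg fun _ => norm_nonneg _)]
  simp only [norm_mul, integral_const_mul]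
  refine mul_le_mul_of_nonneg_left ?_ (norm_nonneg _)
  rw [← integral_node_japanese η, ← integral_const_mul]
  exact integral_mono (hquot η).norm ((integrable_node_japanese η).const_mul D) (hD η)

theorem integral_solHat_mul (h : IsCircleChoice m p ρ c θ) (hq : ExpDecay (m + n + 1) B a q)
    (ha : n * ρ < a) (φ : 𝓢(Sp n, ℂ)) :
    ∫ η, solHat p θ q η * φ η = ((2 * Real.pi) ^ n : ℂ)⁻¹ *
      ∫ y, fourierLaplace (fun x => hat φ x * q x) (node θ y) /
        MvPolynomial.eval (node θ y) p ∂nodeMeasure n := by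
  have hinner (y) : fourierLaplace (fun x => hat φ x * q x) (node θ y) /
      MvPolynomial.eval (node θ y) p = ∫ η : Sp n, φ η *
        (fourierLaplace q (node θ y - fun i => (η i : ℂ)) / MvPolynomial.eval (node θ y) p) := by
    have hstrip : ∀ i, |(node θ y i).im| ≤ ρ :=
      abs_im_ofReal_add_le y.1 (h.norm_circleMap_smul_le y)
    rw [fourierLaplace_hat_mul hq.contDiff.continuous hq.norm_le hstrip ha φ, ← integral_div]
    simp_rw [mul_div_assoc]
  simp_rw [hinner]
  rw [← integral_integral_swap (h.integrable_mul_quot hq ha φ.integrable), ← integral_const_mul]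
  refine integral_congr_ae (Eventually.of_forall fun η => ?_)
  simp only [integral_const_mul, solHat]
  ring

theorem exists_hasFourierFun_solHat (h : IsCircleChoice m p ρ c θ)
    (hq : ExpDecay (m + n + 1) B a q) (ha : n * ρ < a) : ∃ w : 𝓢'(Sp n, ℂ),
      HasFourierFun w (solHat p θ q) ∧ ∀ φ : 𝓢(Sp n, ℂ), w (hat φ) = ∫ ξ, solHat p θ q ξ * φ ξ := by
  obtain ⟨A, hA⟩ := h.exists_norm_solHat_le hq ha
  have hmeas := h.stronglyMeasurable_solHat hq.contDiff.continuous
  obtain ⟨w, hw⟩ := exists_tempered_of_bounded hmeas hA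
  exact ⟨w, ⟨(memLp_top_of_bound hmeas.aestronglyMeasurable A
    (Eventually.of_forall hA)).locallyIntegrable le_top, fun φ _ => hw φ⟩, hw⟩

end IsCircleChoice

theorem HasFourierFun.normB_top_le {w : 𝓢'(Sp n, ℂ)} {g : Sp n → ℂ} (hw : HasFourierFun w g)
    {k : Sp n → ℝ} (hk : ∀ ξ, 0 ≤ k ξ) {C : ℝ} (hC : ∀ ξ, k ξ * ‖g ξ‖ ≤ C) :
    normB ⊤ k w ≤ ENNReal.ofReal (((2 * Real.pi) ^ n)⁻¹ * C) := by
  refine (iInf₂_le _ hw).trans ?_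
  rw [ENNReal.ofReal_mul (by positivity), eLpNorm_exponent_top]
  refine mul_le_mul_right (eLpNormEssSup_le_of_ae_bound (Eventually.of_forall fun ξ => ?_)) _
  rw [norm_mul, Complex.norm_real, Real.norm_of_nonneg (hk ξ)]
  exact hC ξ

/-- The quotient of the distribution `E` by `cosh(c|x|)` belongs to the space `B_{∞,k}(ℝⁿ)` with
norm at most `C`. -/
def IsDivCoshBounded (c : ℝ) (k : Sp n → ℝ) (C : ℝ) (E : Distr n) : Prop :=
  ∃ w : 𝓢'(Sp n, ℂ), IsDivCosh c E w ∧ MemB ⊤ k w ∧ normB ⊤ k w ≤ ENNReal.ofReal C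

theorem isDivCoshBounded_zero (c : ℝ) {k : Sp n → ℝ} (hk : ∀ ξ, 0 ≤ k ξ) (C : ℝ) :
    IsDivCoshBounded c k C 0 := by
  have hzero : HasFourierFun (0 : 𝓢'(Sp n, ℂ)) fun _ => 0 :=
    ⟨locallyIntegrable_zero, fun φ _ => by simp⟩
  have hnorm : normB ⊤ k (0 : 𝓢'(Sp n, ℂ)) ≤ 0 := by
    simpa using hzero.normB_top_le hk (C := 0) fun ξ => by simp
  exact ⟨0, fun _ => rfl, ⟨⟨_, hzero⟩, hnorm.trans_lt ENNReal.zero_lt_top⟩,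
    hnorm.trans zero_le⟩

theorem exists_isDivCoshBounded_solDistr (n m : ℕ) {c ρ κ : ℝ} (hc : 0 < c) (hρ : n * ρ < c) :
    ∃ C₀ : ℝ, ∀ p θ, ∀ h : IsCircleChoice (n := n) m p ρ κ θ,
      IsDivCoshBounded c (weight m p) C₀ h.solDistr := by
  obtain ⟨B, hB⟩ := exists_expDecay_sechNorm n hc (m + n + 1)
  refine ⟨((2 * Real.pi) ^ n)⁻¹ * (((2 * Real.pi) ^ n)⁻¹ * (B * quotConst n m ρ κ c * japInt n)),
    fun p θ h => ?_⟩
  obtain ⟨w, hw, hw_hat⟩ := h.exists_hasFourierFun_solHat hB hρ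
  have hnorm := hw.normB_top_le (weight_nonneg m p) (h.weight_mul_norm_solHat_le hB hρ)
  refine ⟨w, fun f => ?_, ⟨⟨_, hw⟩, hnorm.trans_lt ENNReal.ofReal_lt_top⟩, hnorm⟩
  have hpairing := h.integral_solHat_mul hB hρ
    (hatInv n (f.hasCompactSupport.toSchwartzMap f.contDiff))
  rw [← hw_hat, hat_hatInv] at hpairing
  exact hpairing

/-! ### Representatives of generalized numbers -/

namespace GenNum

variable {𝕜 : Type} [NormedField 𝕜]

theorem IsRep.add {r s : Idx → 𝕜} {z w : GenNum 𝕜} (hr : IsRep r z) (hs : IsRep s w) :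
    IsRep (fun ε => r ε + s ε) (z + w) := by
  obtain ⟨hr_mod, rfl⟩ := hr
  obtain ⟨hs_mod, rfl⟩ := hs
  exact ⟨(ModNet 𝕜).add_mem hr_mod hs_mod, rfl⟩

theorem IsRep.mul {r s : Idx → 𝕜} {z w : GenNum 𝕜} (hr : IsRep r z) (hs : IsRep s w) :
    IsRep (fun ε => r ε * s ε) (z * w) := by
  obtain ⟨hr_mod, rfl⟩ := hr
  obtain ⟨hs_mod, rfl⟩ := hs
  exact ⟨(ModNet 𝕜).mul_mem hr_mod hs_mod, rfl⟩

theorem IsRep.pow {r : Idx → 𝕜} {z : GenNum 𝕜} (hr : IsRep r z) (k : ℕ) :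
    IsRep (fun ε => r ε ^ k) (z ^ k) := by
  obtain ⟨hr_mod, rfl⟩ := hr
  exact ⟨(ModNet 𝕜).pow_mem hr_mod k, by rw [← map_pow]; rfl⟩

theorem isRep_const (a : 𝕜) : IsRep (fun _ => a) (const a) := ⟨Moderate.const ‖a‖, rfl⟩

theorem isRep_natCast (k : ℕ) : IsRep (fun _ => (k : 𝕜)) (k : GenNum 𝕜) := by
  rw [← map_natCast (const (𝕜 := 𝕜))]
  exact isRep_const _

theorem isRep_zero : IsRep (fun _ => (0 : 𝕜)) (0 : GenNum 𝕜) := by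
  simpa only [Nat.cast_zero] using isRep_natCast (𝕜 := 𝕜) 0

theorem IsRep.sum {ι : Type} (t : Finset ι) {r : ι → Idx → 𝕜} {z : ι → GenNum 𝕜}
    (h : ∀ i ∈ t, IsRep (r i) (z i)) : IsRep (fun ε => ∑ i ∈ t, r i ε) (∑ i ∈ t, z i) := by
  classical
  induction t using Finset.induction_on with
  | empty => simpa only [Finset.sum_empty] using isRep_zero
  | insert i t hi ih =>
    simp_rw [Finset.sum_insert hi]
    exact (h i (Finset.mem_insert_self i t)).add
      (ih fun j hj => h j (Finset.mem_insert_of_mem hj))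

theorem IsRep.abs {r : Idx → 𝕜} {z : GenNum 𝕜} (hr : IsRep r z) :
    IsRep (fun ε => ‖r ε‖) (GenNum.abs z) := by
  obtain ⟨hr_mod, rfl⟩ := hr
  exact ⟨by simpa [ModNet] using hr_mod, rfl⟩

theorem IsRep.sqrt {r : Idx → ℝ} {z : GenNum ℝ} (hr : IsRep r z) :
    IsRep (fun ε => √(r ε)) (GenNum.sqrt z) := by
  obtain ⟨_, rfl⟩ := hr
  exact ⟨_, rfl⟩

theorem IsRep.exists_moderate_half_le_norm_mul {r : Idx → 𝕜} {z : GenNum 𝕜} (hr : IsRep r z)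
    (hz : IsUnit z) :
    ∃ s : Idx → 𝕜, Moderate (fun ε => ‖s ε‖) ∧ ∀ᶠ ε in near0, 1 / 2 ≤ ‖r ε‖ * ‖s ε‖ := by
  obtain ⟨hr_mod, rfl⟩ := hr
  obtain ⟨w, hw⟩ := hz.exists_right_inv
  obtain ⟨s, rfl⟩ := mk_surjective w
  rw [← map_mul, ← map_one mk, mk_eq_mk] at hw
  obtain ⟨C, hC, hbound⟩ := (hw 1).exists_pos
  refine ⟨s, s.2, ?_⟩
  filter_upwards [hbound.bound, eventually_le_near0 (η := 1 / (2 * C)) (by positivity)]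
    with ε hdiff hε
  have hdiff_le : ‖1 - r ε * (s : Idx → 𝕜) ε‖ ≤ 1 / 2 := by
    rw [norm_sub_rev]
    calc ‖r ε * (s : Idx → 𝕜) ε - 1‖ ≤ C * ε := by
          simpa [abs_of_pos ε.2.1] using hdiff
      _ ≤ C * (1 / (2 * C)) := by gcongr
      _ = 1 / 2 := by field_simp
  have htri := norm_sub_norm_le (1 : 𝕜) (r ε * (s : Idx → 𝕜) ε)
  rw [norm_one, norm_mul] at htri
  linarith

theorem IsRep.exists_rpow_le_norm {r : Idx → 𝕜} {z : GenNum 𝕜} (hr : IsRep r z) (hz : IsUnit z) :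
    ∃ (N : ℕ) (c : ℝ), 0 < c ∧ ∀ᶠ ε : Idx in near0, c * (ε : ℝ) ^ (N : ℝ) ≤ ‖r ε‖ := by
  obtain ⟨s, ⟨N, hN⟩, hhalf⟩ := hr.exists_moderate_half_le_norm_mul hz
  obtain ⟨D, hD, hbound⟩ := hN.exists_pos
  refine ⟨N, 1 / (2 * D), by positivity, ?_⟩
  filter_upwards [hbound.bound, hhalf] with ε hs hrs
  have hpow : 0 < (ε : ℝ) ^ (N : ℝ) := Real.rpow_pos_of_pos ε.2.1 _
  rw [norm_norm, Real.rpow_neg ε.2.1.le, norm_inv, Real.norm_of_nonneg hpow.le] at hs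
  calc 1 / (2 * D) * (ε : ℝ) ^ (N : ℝ) = 1 / 2 * (ε ^ (N : ℝ) / D) := by field_simp
    _ ≤ ‖r ε‖ * (D * ((ε : ℝ) ^ (N : ℝ))⁻¹) * (ε ^ (N : ℝ) / D) := by
        gcongr
        exact hrs.trans (mul_le_mul_of_nonneg_left hs (norm_nonneg _))
    _ = ‖r ε‖ := by field_simp

end GenNum

namespace IsRepresentative

variable {m : ℕ} {P : MvPolynomial (Fin n) (GenNum ℂ)} {Pnet : Idx → MvPolynomial (Fin n) ℂ}

theorem map_polyD (h : IsRepresentative m P Pnet) (α : Fin n → ℕ) :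
    IsRepresentative m (polyD α P) fun ε => polyD α (Pnet ε) := by
  refine ⟨fun ε => totalDegree_polyD_le (h.1 ε) α, fun s => ?_⟩
  simp_rw [coeff_polyD]
  exact (GenNum.isRep_natCast _).mul (h.2 _)

theorem isRep_eval (hP : P.totalDegree ≤ m) (h : IsRepresentative m P Pnet) (z : Fin n → ℂ) :
    GenNum.IsRep (fun ε => MvPolynomial.eval z (Pnet ε))
      (MvPolynomial.eval (fun i => GenNum.const (z i)) P) := by
  rw [funext fun ε => eval_eq_sum_multiIdx (h.1 ε) z, eval_eq_sum_multiIdx hP]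
  refine GenNum.IsRep.sum _ fun α _ => (h.2 _).mul ?_
  simp_rw [← map_pow, ← map_prod]
  exact GenNum.isRep_const _

theorem isRep_weight (hP : P.totalDegree ≤ m) (h : IsRepresentative m P Pnet) (ξ : Sp n) :
    GenNum.IsRep (fun ε => weight m (Pnet ε) ξ) (genWeight m P ξ) :=
  (GenNum.IsRep.sum _ fun α _ =>
    (((h.map_polyD α).isRep_eval (totalDegree_polyD_le hP α) fun i => (ξ i : ℂ)).abs.pow 2)).sqrt

end IsRepresentative

/-- The polynomial of degree at most `m` with coefficients `a s` for `|s| ≤ m`. -/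
def polyOfCoeff {R : Type*} [CommSemiring R] (m : ℕ) (a : (Fin n →₀ ℕ) → R) :
    MvPolynomial (Fin n) R :=
  ∑ α ∈ multiIdx n m, MvPolynomial.monomial (Finsupp.equivFunOnFinite.symm α)
    (a (Finsupp.equivFunOnFinite.symm α))

section PolyOfCoeff

variable {R : Type*} [CommSemiring R] {m : ℕ}

theorem coeff_polyOfCoeff (a : (Fin n →₀ ℕ) → R) (s : Fin n →₀ ℕ) :
    (polyOfCoeff m a).coeff s = if ∑ i, s i ≤ m then a s else 0 := by
  classical
  have hterm (α : Fin n → ℕ) : (MvPolynomial.monomial (Finsupp.equivFunOnFinite.symm α)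
      (a (Finsupp.equivFunOnFinite.symm α))).coeff s = if s = α then a s else 0 := by
    rw [MvPolynomial.coeff_monomial]
    split_ifs with hsymm hs hs
    · rw [hsymm]
    · exact absurd (by rw [← hsymm]; rfl) hs
    · exact absurd (Finsupp.ext fun i => (congrFun hs i).symm) hsymm
    · rfl
  simp_rw [polyOfCoeff, MvPolynomial.coeff_sum, hterm, Finset.sum_ite_eq, mem_multiIdx]

theorem totalDegree_polyOfCoeff_le (a : (Fin n →₀ ℕ) → R) :
    (polyOfCoeff m a).totalDegree ≤ m :=
  totalDegree_le_iff_coeff.2 fun s hs => by rw [coeff_polyOfCoeff, if_neg hs.not_ge]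

end PolyOfCoeff

theorem exists_isRepresentative {m : ℕ} {P : MvPolynomial (Fin n) (GenNum ℂ)}
    (hP : P.totalDegree ≤ m) : ∃ Pnet, IsRepresentative m P Pnet := by
  choose r hr using fun s => GenNum.mk_surjective (P.coeff s)
  refine ⟨fun ε => polyOfCoeff m fun s => (r s : Idx → ℂ) ε,
    fun ε => totalDegree_polyOfCoeff_le _, fun s => ?_⟩
  simp_rw [coeff_polyOfCoeff]
  split_ifs with hs
  · exact ⟨(r s).2, hr s⟩
  · rw [totalDegree_le_iff_coeff.1 hP s (not_le.1 hs)]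
    exact GenNum.isRep_zero

/-! ### The transposed operator on representatives -/

/-- The operator `D^α` on moderate nets. -/
def netDpow (α : Fin n →₀ ℕ) : Module.End (ModNet ℂ) (EcM n) :=
  ((List.finRange n).map fun i => (netD i : Module.End (ModNet ℂ) (EcM n)) ^ α i).prod

theorem netD_pow_apply (i : Fin n) (k : ℕ) (f : EcM n) (ε : Idx) :
    ((((netD i : Module.End (ModNet ℂ) (EcM n)) ^ k) f : EcM n) : Idx → Test n) ε =
      (testD i ^ k) ((f : Idx → Test n) ε) := by
  induction k with
  | zero => rfl
  | succ k ih =>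
    rw [pow_succ', pow_succ', Module.End.mul_apply, Module.End.mul_apply, ← ih]
    rfl

theorem netDpow_apply (α : Fin n →₀ ℕ) (f : EcM n) (ε : Idx) :
    ((netDpow α f : EcM n) : Idx → Test n) ε = testDpow α ((f : Idx → Test n) ε) := by
  rw [netDpow, testDpow]
  induction List.finRange n with
  | nil => rfl
  | cons i l ih =>
    rw [List.map_cons, List.prod_cons, Module.End.mul_apply, netD_pow_apply, ih, List.map_cons,
      List.prod_cons, Module.End.mul_apply]

theorem Gc.D_pow_mk (i : Fin n) (k : ℕ) (f : EcM n) :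
    (Gc.D i ^ k) (Gc.mk f) = Gc.mk (((netD i : Module.End (ModNet ℂ) (EcM n)) ^ k) f) := by
  induction k with
  | zero => rfl
  | succ k ih =>
    rw [pow_succ', pow_succ', Module.End.mul_apply, Module.End.mul_apply, ih]
    rfl

theorem Gc.Dpow_mk (α : Fin n →₀ ℕ) (f : EcM n) :
    Gc.Dpow α (Gc.mk f) = Gc.mk (netDpow α f) := by
  rw [netDpow, Gc.Dpow]
  induction List.finRange n with
  | nil => rfl
  | cons i l ih =>
    rw [List.map_cons, List.prod_cons, Module.End.mul_apply, ih, Gc.D_pow_mk, List.map_cons,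
      List.prod_cons, Module.End.mul_apply]

theorem Gc.mk_sum {ι : Type*} (t : Finset ι) (f : ι → EcM n) :
    Gc.mk (∑ i ∈ t, f i) = ∑ i ∈ t, Gc.mk (f i) :=
  map_sum (AddMonoidHom.mk' Gc.mk Gc.mk_add) f t

theorem transposeD_eq_sum {m : ℕ} {P : MvPolynomial (Fin n) (GenNum ℂ)} (hP : P.totalDegree ≤ m) :
    transposeD P = ∑ α ∈ multiIdx n m,
      (P.coeff (Finsupp.equivFunOnFinite.symm α) * (-1) ^ ∑ i, α i) •
        Gc.Dpow (Finsupp.equivFunOnFinite.symm α) := by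
  rw [transposeD, sum_support_eq_sum_multiIdx hP fun s a => (a * (-1) ^ s.degree) • Gc.Dpow s]
  · simp [Finsupp.degree_eq_sum]
  · simp

theorem IsRepresentative.exists_transposeD_mk {m : ℕ} {P : MvPolynomial (Fin n) (GenNum ℂ)}
    (hP : P.totalDegree ≤ m) {Pnet : Idx → MvPolynomial (Fin n) ℂ}
    (h : IsRepresentative m P Pnet) (f : EcM n) : ∃ F : EcM n, transposeD P (Gc.mk f) = Gc.mk F ∧
      ∀ ε, (F : Idx → Test n) ε = testTranspose m (Pnet ε) ((f : Idx → Test n) ε) := by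
  choose hmod hmk using h.2
  refine ⟨∑ α ∈ multiIdx n m, ((⟨_, hmod (Finsupp.equivFunOnFinite.symm α)⟩ : ModNet ℂ) *
    (-1) ^ ∑ i, α i) • netDpow (Finsupp.equivFunOnFinite.symm α) f, ?_, fun ε => ?_⟩
  · rw [transposeD_eq_sum hP, LinearMap.sum_apply, Gc.mk_sum]
    refine Finset.sum_congr rfl fun α _ => ?_
    rw [LinearMap.smul_apply, Gc.Dpow_mk, Gc.mk_smul, map_mul, hmk, map_pow, map_neg, map_one]
  · rw [testTranspose, LinearMap.sum_apply, AddSubmonoidClass.coe_finsetSum, Finset.sum_apply]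
    refine Finset.sum_congr rfl fun α _ => ?_
    rw [LinearMap.smul_apply, ← netDpow_apply]
    rfl

/-! ### Nets of fundamental solutions -/

theorem ofNet_mk {T : Idx → Distr n} (hT : ModDistr T) (f : EcM n) :
    ofNet T hT (Gc.mk f) = GenNum.mk ⟨_, hT.moderate f⟩ :=
  rfl

theorem isFundamentalSolution_of_eventually {m : ℕ} {P : MvPolynomial (Fin n) (GenNum ℂ)}
    (hP : P.totalDegree ≤ m) {Pnet : Idx → MvPolynomial (Fin n) ℂ}
    (hrep : IsRepresentative m P Pnet) {T : Idx → Distr n} (hT : ModDistr T)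
    (hfund : ∀ᶠ ε in near0, ∀ f, T ε (testTranspose m (Pnet ε) f) = f 0) :
    IsFundamentalSolution P ⟨ofNet T hT, hT.continuous_ofNet⟩ := by
  refine LinearMap.ext fun u => ?_
  obtain ⟨f, rfl⟩ := Gc.mk_surjective u
  obtain ⟨F, hF, hFε⟩ := hrep.exists_transposeD_mk hP f
  change ofNet T hT (transposeD P (Gc.mk f)) = iotaDelta n (Gc.mk f)
  rw [hF, iotaDelta, ofNet_mk, ofNet_mk, GenNum.mk_eq_mk]
  refine Negligible.zero.mono ?_
  filter_upwards [hfund] with ε hε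
  have hdirac : T ε ((F : Idx → Test n) ε) = dirac n ((f : Idx → Test n) ε) := by
    rw [hFε, hε]
    rfl
  simp only [hdirac, sub_self, norm_zero, abs_zero, le_refl]

theorem exists_le_of_eventually_near0 {p : Idx → Prop} (h : ∀ᶠ ε in near0, p ε) :
    ∃ η : ℝ, 0 < η ∧ η ≤ 1 ∧ ∀ ε : Idx, (ε : ℝ) ≤ η → p ε := by
  obtain ⟨t, ht, hp⟩ := mem_comap.1 h
  obtain ⟨r, hr, hball⟩ := Metric.mem_nhds_iff.1 ht
  refine ⟨min (r / 2) 1, by positivity, min_le_right _ _, fun ε hε => hp (hball ?_)⟩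
  rw [Metric.mem_ball, Real.dist_eq, sub_zero, abs_of_pos ε.2.1]
  linarith [hε.trans (min_le_left _ _)]

theorem modDistr_of_norm_le {T : Idx → Distr n} {r : Idx → ℝ} {N j : ℕ} {c : ℝ} (hc : 0 < c)
    (hr : ∀ᶠ ε : Idx in near0, c * (ε : ℝ) ^ (N : ℝ) ≤ r ε) {C : Set (Sp n) → ℝ}
    (hT : ∀ᶠ ε in near0, ∀ K, IsCompact K → ∀ f : Test n, tsupport f ⊆ K →
      ‖T ε f‖ ≤ C K / r ε * semi K j f) : ModDistr T := by
  intro K hK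
  obtain ⟨η, hη, hη_le, hbound⟩ := exists_le_of_eventually_near0 (hr.and hT)
  refine ⟨j, (|C K| + 1) / c, N, η, by positivity, hη, hη_le, fun f hf ε hε => ?_⟩
  obtain ⟨hrε, hTε⟩ := hbound ε hε
  have hpow : 0 < (ε : ℝ) ^ (N : ℝ) := Real.rpow_pos_of_pos ε.2.1 _
  refine (hTε K hK f hf).trans (mul_le_mul_of_nonneg_right ?_ (semi_nonneg _ _ _))
  rw [Real.rpow_neg ε.2.1.le, ← div_eq_mul_inv, div_div]
  exact div_le_div₀ (by positivity) (by linarith [le_abs_self (C K)]) (by positivity) hrε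

theorem IsRepresentative.exists_rpow_le_weight {m : ℕ} {P : MvPolynomial (Fin n) (GenNum ℂ)}
    (hP : P.totalDegree ≤ m) {Pnet : Idx → MvPolynomial (Fin n) ℂ}
    (hrep : IsRepresentative m P Pnet) {ξ₀ : Sp n} (hξ₀ : IsUnit (genWeight m P ξ₀)) :
    ∃ (N : ℕ) (c : ℝ), 0 < c ∧
      ∀ᶠ ε : Idx in near0, c * (ε : ℝ) ^ (N : ℝ) ≤ weight m (Pnet ε) ξ₀ := by
  simpa only [Real.norm_of_nonneg (weight_nonneg _ _ _)] using
    (hrep.isRep_weight hP ξ₀).exists_rpow_le_norm hξ₀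

theorem weight_zero (m : ℕ) (ξ : Sp n) : weight m 0 ξ = 0 := by
  simp [weight, polyD]

theorem exists_uniform_fundamental_distr (n m : ℕ) {c : ℝ} (hc : 0 < c) :
    ∃ (C₀ : ℝ) (C : Sp n → Set (Sp n) → ℝ), ∀ p : MvPolynomial (Fin n) ℂ, p.totalDegree ≤ m →
      ∃ E : Distr n, IsDivCoshBounded c (weight m p) C₀ E ∧
        (p ≠ 0 → (∀ f, E (testTranspose m p f) = f 0) ∧
          ∀ ξ₀ K, IsCompact K → ∀ f : Test n, tsupport f ⊆ K →
            ‖E f‖ ≤ C ξ₀ K / weight m p ξ₀ * semi K (m + n + 1) f) := by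
  set ρ : ℝ := c / (n + 1) with hρ_def
  have hρ : n * ρ < c := by
    rw [hρ_def, mul_div_assoc', div_lt_iff₀ (by positivity)]
    linarith
  obtain ⟨κ, hκ, hcircle⟩ := exists_measurable_circle n m (show 0 < ρ by positivity)
  obtain ⟨C₀, hdiv⟩ := exists_isDivCoshBounded_solDistr n m (κ := κ) hc hρ
  choose! C hC using fun ξ₀ (K : Set (Sp n)) (hK : IsCompact K) =>
    exists_norm_solFun_le m ρ κ ξ₀ hK
  refine ⟨C₀, C, fun p hp => ?_⟩
  rcases eq_or_ne p 0 with rfl | hp_ne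
  · exact ⟨0, isDivCoshBounded_zero c (weight_nonneg m 0) C₀, fun h => absurd rfl h⟩
  · obtain ⟨θ, hθ, hle, hlower⟩ := hcircle p hp hp_ne
    have hchoice : IsCircleChoice m p ρ κ θ := ⟨hp, hp_ne, hκ, hθ, hle, hlower⟩
    exact ⟨hchoice.solDistr, hdiv p θ hchoice, fun _ => ⟨hchoice.solDistr_transpose,
      fun ξ₀ K hK => hC ξ₀ K hK p θ hchoice⟩⟩

theorem exists_fundamental_net (n m : ℕ) {c : ℝ} (hc : 0 < c) :
    ∃ C₀ : ℝ, ∀ P : MvPolynomial (Fin n) (GenNum ℂ), P.totalDegree ≤ m →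
      (∃ ξ₀ : Sp n, IsUnit (genWeight m P ξ₀)) →
      ∀ Pnet : Idx → MvPolynomial (Fin n) ℂ, IsRepresentative m P Pnet →
        ∃ (E : Gc n →L[GenNum ℂ] GenNum ℂ) (Enet : Idx → Distr n),
          IsFundamentalSolution P E ∧ IsGivenBy E Enet ∧
            ∀ ε, IsDivCoshBounded c (weight m (Pnet ε)) C₀ (Enet ε) := by
  obtain ⟨C₀, C, hdistr⟩ := exists_uniform_fundamental_distr n m hc
  refine ⟨C₀, fun P hP ⟨ξ₀, hξ₀⟩ Pnet hrep => ?_⟩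
  choose Enet hcosh hEnet using fun ε => hdistr (Pnet ε) (hrep.1 ε)
  obtain ⟨N, b, hb, hweight⟩ := hrep.exists_rpow_le_weight hP hξ₀
  have hne : ∀ᶠ ε in near0, Pnet ε ≠ 0 := by
    filter_upwards [hweight] with ε hε hzero
    rw [hzero, weight_zero] at hε
    exact (mul_pos hb (Real.rpow_pos_of_pos ε.2.1 _)).not_ge hε
  have hmod : ModDistr Enet :=
    modDistr_of_norm_le hb hweight (hne.mono fun ε hε => (hEnet ε hε).2 ξ₀)
  exact ⟨_, Enet, isFundamentalSolution_of_eventually hP hrep hmod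
    (hne.mono fun ε hε => (hEnet ε hε).1), ⟨hmod, rfl⟩, hcosh⟩

end Colombeau

end

/-- Operators `P(D)` of order at most `m` on `ℝⁿ` with coefficients in `ℂ~` correspond to
polynomials `P` of degree at most `m` over `ℂ~`. -/
theorem mainTheorem1 (n m : ℕ) :
    (∀ P : MvPolynomial (Fin n) (GenNum ℂ), P.totalDegree ≤ m →
      (∃ ξ₀ : EuclideanSpace ℝ (Fin n), IsUnit (genWeight m P ξ₀)) →
      ∃ E : Gc n →L[GenNum ℂ] GenNum ℂ, IsBasic E ∧ IsFundamentalSolution P E) ∧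
    ∀ c : ℝ, 0 < c → ∃ C₀ : ℝ, ∀ P : MvPolynomial (Fin n) (GenNum ℂ), P.totalDegree ≤ m →
      (∃ ξ₀ : EuclideanSpace ℝ (Fin n), IsUnit (genWeight m P ξ₀)) →
      ∀ Pnet : Set.Ioc (0 : ℝ) 1 → MvPolynomial (Fin n) ℂ, IsRepresentative m P Pnet →
        ∃ (E : Gc n →L[GenNum ℂ] GenNum ℂ) (Enet : Set.Ioc (0 : ℝ) 1 → Distr n),
          IsFundamentalSolution P E ∧ IsGivenBy E Enet ∧
          ∀ ε, ∃ w : TemperedDistribution (EuclideanSpace ℝ (Fin n)) ℂ,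
            IsDivCosh c (Enet ε) w ∧ MemB ⊤ (weight m (Pnet ε)) w ∧
              normB ⊤ (weight m (Pnet ε)) w ≤ ENNReal.ofReal C₀ := by
  refine ⟨fun P hP hξ => ?_, fun c hc => exists_fundamental_net n m hc⟩
  obtain ⟨_, hnet⟩ := exists_fundamental_net n m one_pos
  obtain ⟨Pnet, hrep⟩ := exists_isRepresentative hP
  obtain ⟨E, Enet, hE, hgiven, -⟩ := hnet P hP hξ Pnet hrep
  exact ⟨E, ⟨Enet, hgiven⟩, hE⟩
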